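/- For integers $l,m,n\ge 0$ let $A[l,m,n]\colon \mathrm{SL}_4(\mathbb C)\to\mathbb C$ denote the character of the irreducible rational representation of $\mathrm{SL}_4$ of highest weight $l\omega_1+m\omega_2+n\omega_3$ (with respect to the upper triangular Borel subgroup); this representation exists and its character is determined by $(l,m,n)$. Here $\omega_1,\omega_2,\omega_3$ are the fundamental weights, $\omega_k$ being the highest weight of $\wedge^k\mathbb C^4$, i.e. $\omega_k(\mathrm{diag}(t_1,\dots,t_4))=t_1\cdots t_k$. Then one has the identity of formal power series in $X,Y,Z$, whose coefficients are functions on $\mathrm{SL}_4(\mathbb C)$, $$\sum_{l,m,n\ge 0}A[l,m,n]\,Y^m\left(\frac{1-(XZ)^{m+1}}{1-XZ}\right)\left(\frac{X^{l+1}-(YZ)^{l+1}}{X-YZ}\right)\left(\frac{Z^{n+1}-(XY)^{n+1}}{Z-XY}\right)=\left(\sum_{t,v\ge 0}A[t,0,v]X^tZ^v\right)\left(\sum_{u\ge 0}A[0,u,0]Y^u\right).$$ The three quotients are exact quotients (polynomials), and each of the sums is a formal sum: every monomial in $X,Y,Z$ occurs in only finitely many of its terms. -/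

import Mathlib

noncomputable section

namespace SL4Char

/-- The group `SL₄(ℂ)`. -/
abbrev SL4 : Type := Matrix.SpecialLinearGroup (Fin 4) ℂ

section Rep

variable {V : Type*} [AddCommGroup V] [Module ℂ V]

/-- `ρ` is a rational (algebraic) representation: each of its matrix coefficients is a polynomial
function of the 16 matrix entries. (As `det = 1` on `SL₄`, the coordinate ring of `SL₄` is a
quotient of the polynomial ring in the matrix entries, so these are the regular functions.) -/
def IsRational (ρ : Representation ℂ SL4 V) : Prop :=
  ∀ (φ : Module.Dual ℂ V) (v : V), ∃ P : MvPolynomial (Fin 4 × Fin 4) ℂ,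
    ∀ g : SL4, φ (ρ g v) = MvPolynomial.eval (fun ij => g.1 ij.1 ij.2) P

/-- `v` is a highest weight vector of weight `l ω₁ + m ω₂ + n ω₃` for the Borel subgroup of upper
triangular matrices: `v ≠ 0`, and every upper triangular `b` (in particular every unipotent one)
acts on `v` by `ω₁(b) ^ l * ω₂(b) ^ m * ω₃(b) ^ n`, where `ωₖ` is the product of the first `k`
diagonal entries, that is, the highest weight of the `k`-th exterior power of `ℂ⁴`. -/
def IsHighestWeightVector (ρ : Representation ℂ SL4 V) (l m n : ℕ) (v : V) : Prop :=
  v ≠ 0 ∧ ∀ b : SL4, (∀ i j : Fin 4, j < i → b.1 i j = 0) →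
    ρ b v = ((b.1 0 0) ^ l * (b.1 0 0 * b.1 1 1) ^ m
      * (b.1 0 0 * b.1 1 1 * b.1 2 2) ^ n) • v

/-- `ρ` is an irreducible rational representation of `SL₄` of highest weight
`l ω₁ + m ω₂ + n ω₃`. -/
structure IsIrrepOfHighestWeight (ρ : Representation ℂ SL4 V) (l m n : ℕ) : Prop where
  finite : FiniteDimensional ℂ V
  rational : IsRational ρ
  irreducible : ρ.IsIrreducible
  highestWeight : ∃ v : V, IsHighestWeightVector ρ l m n v

end Rep

/-- `χ` is the character of some irreducible rational representation of `SL₄` of highest weight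
`l ω₁ + m ω₂ + n ω₃`. -/
def IsIrreducibleCharacter (l m n : ℕ) (χ : SL4 → ℂ) : Prop :=
  ∃ (V : Type) (_ : AddCommGroup V) (_ : Module ℂ V) (ρ : Representation ℂ SL4 V),
    IsIrrepOfHighestWeight ρ l m n ∧ ρ.character = χ

/-- `A[l,m,n]`: the character of the irreducible representation of `SL₄` of highest weight
`l ω₁ + m ω₂ + n ω₃`. -/
def A (l m n : ℕ) : SL4 → ℂ :=
  Classical.epsilon (IsIrreducibleCharacter l m n)

section Quot

variable {R : Type*} [CommRing R]

open Classical in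
/-- The quotient `a / b` in a commutative ring, for `b` dividing `a`: an element `c` with
`a = b * c`. In a domain it is unique for `b ≠ 0`. -/
def exactDiv (a b : R) : R :=
  if h : b ∣ a then h.choose else 0

theorem mul_exactDiv {a b : R} (h : b ∣ a) : b * exactDiv a b = a := by
  rw [exactDiv, dif_pos h]
  exact h.choose_spec.symm

theorem exactDiv_eq [NoZeroDivisors R] {a b c : R} (hb : b ≠ 0) (h : b * c = a) : exactDiv a b = c :=
  mul_left_cancel₀ hb ((mul_exactDiv ⟨c, h.symm⟩).trans h.symm)

end Quot

/-- Formal power series in three variables over `ℂ`. -/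
abbrev PS : Type := MvPowerSeries (Fin 3) ℂ

/-- The variable `X`. -/
def X : PS := MvPowerSeries.X 0

/-- The variable `Y`. -/
def Y : PS := MvPowerSeries.X 1

/-- The variable `Z`. -/
def Z : PS := MvPowerSeries.X 2

/-- A complex number as a constant power series. -/
def const (c : ℂ) : PS := MvPowerSeries.C c

section Sum

variable {ι : Type*}

/-- A family of power series is formally summable if each monomial occurs in only finitely many
members of the family. -/
def FormallySummable (f : ι → PS) : Prop :=
  ∀ d : Fin 3 →₀ ℕ, {i | MvPowerSeries.coeff d (f i) ≠ 0}.Finite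

/-- The coefficientwise sum of a (formally summable) family of power series. -/
def formalSum (f : ι → PS) : PS :=
  fun d => ∑ᶠ i, MvPowerSeries.coeff d (f i)

end Sum

/-- The `(l,m,n)` term of the left-hand side, evaluated at `g`. -/
def lhsTerm (g : SL4) (p : ℕ × ℕ × ℕ) : PS :=
  const (A p.1 p.2.1 p.2.2 g) * Y ^ p.2.1
    * exactDiv (1 - (X * Z) ^ (p.2.1 + 1)) (1 - X * Z)
    * exactDiv (X ^ (p.1 + 1) - (Y * Z) ^ (p.1 + 1)) (X - Y * Z)
    * exactDiv (Z ^ (p.2.2 + 1) - (X * Y) ^ (p.2.2 + 1)) (Z - X * Y)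

/-- The `(t,v)` term of the first factor of the right-hand side, evaluated at `g`. -/
def rhsTerm₁ (g : SL4) (p : ℕ × ℕ) : PS :=
  const (A p.1 0 p.2 g) * X ^ p.1 * Z ^ p.2

/-- The `u` term of the second factor of the right-hand side, evaluated at `g`. -/
def rhsTerm₂ (g : SL4) (u : ℕ) : PS :=
  const (A 0 u 0 g) * Y ^ u

end SL4Char

end

/-!
The identity of power series says, coefficient by coefficient, how `A[t,0,v] A[0,u,0]` decomposes
into irreducible characters (`A_mul_A_eq_sum`): the geometric sums on the left-hand side count the
triples `(a, b, c)` with `a + c ≤ t`, `a + b + c ≤ u`, `a + b ≤ v`, and the triple contributes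
`A[t - a - c + b, u - b - c, v - a - b + c]`. The decomposition follows from the Weyl character
formula and Pieri's rule; both, and the existence of the representations, are proved here.

*Reduction to the torus.* Every element of `SL₄` is conjugate to a lower triangular matrix, whose
conjugates by a one-parameter subgroup of the torus tend to its diagonal part. So a class function
that is a polynomial in the entries is determined by its values at the diagonal matrices with
distinct entries (`IsRegularClassFunction.ext`).

*The Weyl character formula* (`character_mul_alternant`). By the density of the big cell, an
irreducible representation is spanned by the translates of a highest weight vector by lower
triangular unipotent matrices; hence on the torus its character is the highest weight `e^λ` times a
polynomial `Q` with constant term `1` in the negative simple roots (`exists_character_polynomial`).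
The Casimir operator, built from the differential of the representation at `1`, commutes with the
group and is a scalar by Schur's lemma. Its radial part is a second order differential equation for
the character (`casimir_radial`), which multiplication by the Weyl denominator turns into an
equation with constant coefficients (`two_mul_laplacian_weylDenom_mul`). So the exponents `α` of the
product of `Q` with the Weyl denominator satisfy `|λ + ρ - α| = |λ + ρ|`. As this product is also
skew under the Weyl group, it is determined by its constant term (`IsSkew.eq_zero`), and the
alternant with leading term `e^(λ + ρ)` has the same properties. In particular the character is
determined by the highest weight.

*Existence* (`exists_isIrreducibleCharacter`). The product of powers of the leading principal minors
with exponents `l`, `m`, `n` is a highest weight vector for the right translations of functions on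
`SL₄`. Its translates span a finite-dimensional rational representation, and the quotient of this by
a maximal invariant subspace not containing the vector is irreducible.

*The product.* Multiplying an alternant by the generating function of the complete symmetric
polynomials and applying column operations gives Pieri's rule (`completeInv_mul_weightAlternant`),
hence the decomposition of `A[t,0,0] A[0,0,v] A[0,u,0]`. Since
`A[t,0,v] = A[t,0,0] A[0,0,v] - A[t-1,0,0] A[0,0,v-1]`, the terms of this decomposition in which a
box is removed from the first row cancel, and the remaining ones are indexed by the triples
`(a, b, c)`.
-/

open scoped Matrix

noncomputable section

namespace SL4Char

/-! ### Regular class functions -/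

/-- A class function on `SL₄` that is a polynomial in the matrix entries. -/
structure IsRegularClassFunction (f : SL4 → ℂ) : Prop where
  regular : ∃ P : MvPolynomial (Fin 4 × Fin 4) ℂ,
    ∀ g : SL4, f g = MvPolynomial.eval (fun ij => g.1 ij.1 ij.2) P
  conj : ∀ g h : SL4, f (h * g * h⁻¹) = f g

namespace IsRegularClassFunction

variable {f f₁ f₂ : SL4 → ℂ}

theorem zero : IsRegularClassFunction (0 : SL4 → ℂ) :=
  ⟨⟨0, by simp⟩, by simp⟩

theorem add (h₁ : IsRegularClassFunction f₁) (h₂ : IsRegularClassFunction f₂) :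
    IsRegularClassFunction (f₁ + f₂) := by
  obtain ⟨P, hP⟩ := h₁.regular
  obtain ⟨Q, hQ⟩ := h₂.regular
  exact ⟨⟨P + Q, by simp [hP, hQ]⟩, by simp [h₁.conj, h₂.conj]⟩

theorem neg (h : IsRegularClassFunction f) : IsRegularClassFunction (-f) := by
  obtain ⟨P, hP⟩ := h.regular
  exact ⟨⟨-P, by simp [hP]⟩, by simp [h.conj]⟩

theorem sub (h₁ : IsRegularClassFunction f₁) (h₂ : IsRegularClassFunction f₂) :
    IsRegularClassFunction (f₁ - f₂) := by
  rw [sub_eq_add_neg]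
  exact h₁.add h₂.neg

theorem mul (h₁ : IsRegularClassFunction f₁) (h₂ : IsRegularClassFunction f₂) :
    IsRegularClassFunction (f₁ * f₂) := by
  obtain ⟨P, hP⟩ := h₁.regular
  obtain ⟨Q, hQ⟩ := h₂.regular
  exact ⟨⟨P * Q, by simp [hP, hQ]⟩, by simp [h₁.conj, h₂.conj]⟩

theorem sum {ι : Type*} (s : Finset ι) {F : ι → SL4 → ℂ}
    (h : ∀ i ∈ s, IsRegularClassFunction (F i)) : IsRegularClassFunction (∑ i ∈ s, F i) :=
  Finset.sum_induction F IsRegularClassFunction (fun _ _ => add) zero h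

end IsRegularClassFunction

/-- The element `diag(x₁, …, x₄)` of `SL₄`. -/
def diagSL (x : Fin 4 → ℂ) (hx : ∏ i, x i = 1) : SL4 :=
  ⟨Matrix.diagonal x, by rw [Matrix.det_diagonal, hx]⟩

theorem prod_eq_one_ne_zero {x : Fin 4 → ℂ} (hx : ∏ i, x i = 1) (i : Fin 4) : x i ≠ 0 := by
  have : ∏ i, x i ≠ 0 := by rw [hx]; exact one_ne_zero
  exact Finset.prod_ne_zero_iff.1 this i (Finset.mem_univ i)

theorem coe_diagSL_inv {x : Fin 4 → ℂ} (hx : ∏ i, x i = 1) :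
    ((diagSL x hx)⁻¹).1 = Matrix.diagonal fun k => (x k)⁻¹ := by
  have h1 : ((diagSL x hx)⁻¹).1 * (diagSL x hx).1 = 1 := by
    rw [← Matrix.SpecialLinearGroup.coe_mul, inv_mul_cancel, Matrix.SpecialLinearGroup.coe_one]
  have h2 : (diagSL x hx).1 * (Matrix.diagonal fun k => (x k)⁻¹) = 1 := by
    change Matrix.diagonal x * _ = 1
    rw [Matrix.diagonal_mul_diagonal, ← Matrix.diagonal_one]
    congr 1
    funext k
    exact mul_inv_cancel₀ (prod_eq_one_ne_zero hx k)
  calc ((diagSL x hx)⁻¹).1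
      = ((diagSL x hx)⁻¹).1 * ((diagSL x hx).1 * (Matrix.diagonal fun k => (x k)⁻¹)) := by
        rw [h2, mul_one]
    _ = _ := by rw [← mul_assoc, h1, one_mul]

/-- Every endomorphism has a lower triangular matrix in some basis: the kernel of an eigenvector of
the dual map is an invariant hyperplane. -/
theorem exists_basis_lowerTriangular (n : ℕ) :
    ∀ (V : Type) [AddCommGroup V] [Module ℂ V] [FiniteDimensional ℂ V] (_ : Module.finrank ℂ V = n)
      (φ : Module.End ℂ V), ∃ b : Module.Basis (Fin n) ℂ V,
        ∀ i j, i < j → b.repr (φ (b j)) i = 0 := by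
  induction n with
  | zero =>
    intro V _ _ _ hV φ
    exact ⟨Module.finBasisOfFinrankEq ℂ V hV, fun i => i.elim0⟩
  | succ n ih =>
    intro V _ _ _ hV φ
    have : Nontrivial V := Module.nontrivial_of_finrank_pos (R := ℂ) (by omega)
    obtain ⟨μ, hμ⟩ := Module.End.exists_eigenvalue (Module.Dual.transpose (R := ℂ) φ)
    obtain ⟨ξ, hξ⟩ := hμ.exists_hasEigenvector
    have hξ0 : ξ ≠ 0 := hξ.2
    have hξφ : ∀ v, ξ (φ v) = μ * ξ v := fun v => LinearMap.congr_fun hξ.apply_eq_smul v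
    obtain ⟨y, hy⟩ : ∃ y, ξ y = 1 := by
      obtain ⟨y, hy⟩ := DFunLike.ne_iff.1 hξ0
      exact ⟨(ξ y)⁻¹ • y, by simpa using inv_mul_cancel₀ hy⟩
    have hker : ∀ v ∈ LinearMap.ker ξ, φ v ∈ LinearMap.ker ξ := by
      intro v hv
      rw [LinearMap.mem_ker] at hv ⊢
      rw [hξφ, hv, mul_zero]
    have hfin : Module.finrank ℂ (LinearMap.ker ξ) = n := by
      have := Module.Dual.finrank_ker_add_one_of_ne_zero hξ0
      omega
    obtain ⟨b, hb⟩ := ih (LinearMap.ker ξ) hfin (φ.restrict hker)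
    let b' := Module.Basis.mkFinCons y b
      (fun c x hx h => by
        have := congrArg ξ h
        rw [map_add, map_smul, hy, (LinearMap.mem_ker.1 hx)] at this
        simpa using this)
      (fun z => ⟨-ξ z, by
        rw [LinearMap.mem_ker, map_add, map_smul, hy]
        simp⟩)
    have h0 : b' 0 = y := by simp [b']
    have hs : ∀ j, b' (Fin.succ j) = b j := fun j => by simp [b']
    refine ⟨b', fun i j hij => ?_⟩
    obtain ⟨j, rfl⟩ := Fin.exists_succ_eq.2 (Fin.ne_zero_of_lt hij)
    have hexp : φ (b' j.succ) = ∑ k : Fin n, b.repr (φ.restrict hker (b j)) k • b' k.succ := by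
      have h1 := congrArg Subtype.val (b.sum_repr (φ.restrict hker (b j)))
      simp only [hs]
      rw [Submodule.coe_sum] at h1
      exact h1.symm
    rw [hexp, map_sum, Finsupp.finsetSum_apply]
    refine Finset.sum_eq_zero fun k _ => ?_
    rw [map_smul, Module.Basis.repr_self, Finsupp.smul_apply, Finsupp.single_apply]
    split_ifs with hk
    · subst hk
      rw [hb k j (Fin.succ_lt_succ_iff.1 hij), zero_smul]
    · simp

/-- Every element of `SL₄` is conjugate in `SL₄` to a lower triangular one. -/
theorem exists_conj_lowerTriangular (g : SL4) :
    ∃ p : SL4, ∀ i j : Fin 4, i < j → (p * g * p⁻¹).1 i j = 0 := by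
  obtain ⟨b, hb⟩ := exists_basis_lowerTriangular 4 (Fin 4 → ℂ) (by simp) (Matrix.toLin' g.1)
  let e := Pi.basisFun ℂ (Fin 4)
  -- the change of basis matrix and its inverse; the former is then divided by a fourth root of its
  -- determinant
  set P := b.toMatrix e with hP
  set Q := e.toMatrix b with hQ
  have hPQ : P * Q = 1 := b.toMatrix_mul_toMatrix_flip e
  have hdet : P.det * Q.det = 1 := by rw [← Matrix.det_mul, hPQ, Matrix.det_one]
  have hd0 : P.det ≠ 0 := left_ne_zero_of_mul_eq_one hdet
  obtain ⟨z, hz⟩ := IsAlgClosed.exists_pow_nat_eq P.det (n := 4) (by norm_num)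
  have hz0 : z ≠ 0 := by
    rintro rfl
    exact hd0 (by rw [← hz]; norm_num)
  let p : SL4 := ⟨z⁻¹ • P, by
    rw [Matrix.det_smul, ← hz, Fintype.card_fin, ← mul_pow, inv_mul_cancel₀ hz0, one_pow]⟩
  have hp : (p⁻¹).1 = z • Q := by
    have h1 : p.1 * (z • Q) = 1 := by
      change (z⁻¹ • P) * (z • Q) = 1
      rw [Matrix.smul_mul, Matrix.mul_smul, hPQ, smul_smul, inv_mul_cancel₀ hz0, one_smul]
    have h2 : (p⁻¹).1 * p.1 = 1 := by
      rw [← Matrix.SpecialLinearGroup.coe_mul, inv_mul_cancel, Matrix.SpecialLinearGroup.coe_one]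
    calc (p⁻¹).1 = (p⁻¹).1 * (p.1 * (z • Q)) := by rw [h1, mul_one]
      _ = z • Q := by rw [← mul_assoc, h2, one_mul]
  refine ⟨p, fun i j hij => ?_⟩
  have hpg : (p * g * p⁻¹).1 = LinearMap.toMatrix b b (Matrix.toLin' g.1) := by
    have h1 : (p * g * p⁻¹).1 = (z⁻¹ • P) * g.1 * (z • Q) := by
      rw [← hp]
      rfl
    rw [h1, ← basis_toMatrix_mul_linearMap_toMatrix_mul_basis_toMatrix b e b e,
      Matrix.smul_mul, Matrix.smul_mul, Matrix.mul_smul, smul_smul, inv_mul_cancel₀ hz0, one_smul,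
      ← Matrix.toLin_eq_toLin', LinearMap.toMatrix_toLin]
  rw [hpg, LinearMap.toMatrix_apply]
  exact hb i j hij

theorem continuous_eval_entries {α : Type*} [TopologicalSpace α] {M : α → Matrix (Fin 4) (Fin 4) ℂ}
    (hM : ∀ i j, Continuous fun s => M s i j) (P : MvPolynomial (Fin 4 × Fin 4) ℂ) :
    Continuous fun s => MvPolynomial.eval (fun ij => M s ij.1 ij.2) P :=
  P.continuous_eval.comp (continuous_pi fun ij => hM ij.1 ij.2)

/-- A regular class function takes the same value at a lower triangular matrix and at its diagonal
part, which is a limit of conjugates. -/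
theorem IsRegularClassFunction.apply_lowerTriangular {f : SL4 → ℂ} (hf : IsRegularClassFunction f)
    (g : SL4) (hg : ∀ i j : Fin 4, i < j → g.1 i j = 0) (hx : ∏ i, g.1 i i = 1) :
    f g = f (diagSL (fun i => g.1 i i) hx) := by
  obtain ⟨P, hP⟩ := hf.regular
  -- the conjugate of `g` by `diag (s⁻³, s⁻¹, s, s³)`; where the truncated exponent is wrong, that
  -- is for `i < j`, the entry of `g` vanishes
  let M : ℂ → Matrix (Fin 4) (Fin 4) ℂ := fun s => Matrix.of fun i j =>
    g.1 i j * s ^ (2 * i.val - 2 * j.val)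
  have hcont : Continuous fun s => MvPolynomial.eval (fun ij => M s ij.1 ij.2) P :=
    continuous_eval_entries (fun i j => by simp only [M, Matrix.of_apply]; fun_prop) P
  have hne : ∀ s : ℂ, s ≠ 0 → MvPolynomial.eval (fun ij => M s ij.1 ij.2) P = f g := by
    intro s hs
    let d : Fin 4 → ℂ := ![s⁻¹ ^ 3, s⁻¹, s, s ^ 3]
    let d' : Fin 4 → ℂ := ![s ^ 3, s, s⁻¹, s⁻¹ ^ 3]
    have hd : ∏ i, d i = 1 := by
      simp only [Fin.prod_univ_four, d, Matrix.cons_val]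
      field_simp
    have hd' : ∏ i, d' i = 1 := by
      simp only [Fin.prod_univ_four, d', Matrix.cons_val]
      field_simp
    have hinv : (diagSL d hd)⁻¹ = diagSL d' hd' := by
      refine inv_eq_of_mul_eq_one_right (Subtype.ext ?_)
      change Matrix.diagonal d * Matrix.diagonal d' = 1
      rw [Matrix.diagonal_mul_diagonal, ← Matrix.diagonal_one]
      congr 1
      funext i
      fin_cases i <;> simp [d, d', hs]
    rw [← hf.conj g (diagSL d hd), hP, hinv]
    congr 2
    funext ⟨i, j⟩
    change M s i j = (Matrix.diagonal d * g.1 * Matrix.diagonal d') i j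
    rw [Matrix.mul_diagonal, Matrix.diagonal_mul]
    rcases lt_or_ge i j with hij | hij
    · simp [M, hg i j hij]
    · fin_cases i <;> fin_cases j <;> simp [M, d, d'] at hij ⊢ <;> field_simp
  have hclosed : ∀ s, MvPolynomial.eval (fun ij => M s ij.1 ij.2) P = f g := by
    have : Dense ({0}ᶜ : Set ℂ) := dense_compl_singleton 0
    exact congrFun (hcont.ext_on this continuous_const fun s hs => hne s hs)
  rw [← hclosed 0, hP]
  congr 2
  funext ⟨i, j⟩
  change M 0 i j = Matrix.diagonal _ i j
  rw [Matrix.diagonal_apply]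
  split_ifs with h
  · subst h; simp [M]
  · rcases lt_or_gt_of_ne h with hij | hij
    · simp [M, hg i j hij]
    · have : 2 * i.val - 2 * j.val ≠ 0 := by omega
      simp [M, this]

/-- A continuous function on the torus that vanishes at the points with distinct coordinates
vanishes: perturb along a one-parameter subgroup with distinct real exponents. -/
theorem torus_eq_zero_of_injective {F : (Fin 4 → ℂ) → ℂ} (hF : Continuous F)
    (h : ∀ x : Fin 4 → ℂ, ∏ i, x i = 1 → Function.Injective x → F x = 0)
    (x : Fin 4 → ℂ) (hx : ∏ i, x i = 1) : F x = 0 := by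
  let w : Fin 4 → ℝ := ![3, 1, -1, -3]
  let y : ℝ → Fin 4 → ℂ := fun s i => x i * (Real.exp (s * w i) : ℂ)
  have hy : Continuous y := by
    refine continuous_pi fun i => ?_
    simp only [y]
    fun_prop
  have hy0 : y 0 = x := by funext i; simp [y]
  have hx0 := prod_eq_one_ne_zero hx
  have hprod : ∀ s, ∏ i, y s i = 1 := fun s => by
    simp only [y, Finset.prod_mul_distrib, hx, one_mul]
    have hw : ∑ i, s * w i = 0 := by
      simp only [Fin.sum_univ_four, w, Matrix.cons_val]
      ring
    rw [← Complex.ofReal_prod, ← Real.exp_sum, hw, Real.exp_zero, Complex.ofReal_one]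
  have hw : Function.Injective w := by
    intro i j hij
    fin_cases i <;> fin_cases j <;> first | rfl | (exfalso; norm_num [w] at hij)
  have hinj : ∀ᶠ s in nhdsWithin (0 : ℝ) {0}ᶜ, Function.Injective (y s) := by
    have h1 : ∀ i j, i ≠ j → ∀ᶠ s in nhdsWithin (0 : ℝ) {0}ᶜ, y s i ≠ y s j := by
      intro i j hij
      by_cases hxx : x i = x j
      · filter_upwards [self_mem_nhdsWithin] with s hs heq
        simp only [y, hxx] at heq
        have h2 := mul_left_cancel₀ (hx0 j) heq
        rw [Complex.ofReal_inj, Real.exp_eq_exp] at h2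
        exact hij (hw (mul_left_cancel₀ hs h2))
      · refine nhdsWithin_le_nhds ?_
        have hi : Continuous fun s => y s i := (continuous_apply i).comp hy
        have hj : Continuous fun s => y s j := (continuous_apply j).comp hy
        exact (hi.continuousAt.ne_iff_eventually_ne hj.continuousAt).1 (by rw [hy0]; exact hxx)
    have h2 : ∀ᶠ s in nhdsWithin (0 : ℝ) {0}ᶜ, ∀ i j, i ≠ j → y s i ≠ y s j := by
      simp only [Filter.eventually_all]
      exact h1
    filter_upwards [h2] with s hs i j hij
    by_contra hne
    exact hs i j hne hij
  have hlim : Filter.Tendsto (fun s => F (y s)) (nhdsWithin 0 {0}ᶜ) (nhds (F x)) := by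
    rw [← hy0]
    exact ((hF.comp hy).tendsto 0).mono_left nhdsWithin_le_nhds
  refine tendsto_nhds_unique hlim ?_
  refine tendsto_const_nhds.congr' ?_
  filter_upwards [hinj] with s hs
  exact (h (y s) (hprod s) hs).symm

/-- A regular class function is determined by its values at the diagonal matrices with distinct
entries. -/
theorem IsRegularClassFunction.ext {f₁ f₂ : SL4 → ℂ} (h₁ : IsRegularClassFunction f₁)
    (h₂ : IsRegularClassFunction f₂)
    (h : ∀ (x : Fin 4 → ℂ) (hx : ∏ i, x i = 1), Function.Injective x →
      f₁ (diagSL x hx) = f₂ (diagSL x hx)) : f₁ = f₂ := by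
  have hf := h₁.sub h₂
  obtain ⟨P, hP⟩ := hf.regular
  have heval : ∀ (x : Fin 4 → ℂ) (hx : ∏ i, x i = 1), (f₁ - f₂) (diagSL x hx) =
      MvPolynomial.eval (fun ij => Matrix.diagonal x ij.1 ij.2) P := fun x hx => hP _
  have hdiag : ∀ (x : Fin 4 → ℂ) (hx : ∏ i, x i = 1), (f₁ - f₂) (diagSL x hx) = 0 := by
    have hcont : Continuous fun x : Fin 4 → ℂ =>
        MvPolynomial.eval (fun ij => Matrix.diagonal x ij.1 ij.2) P :=
      continuous_eval_entries
        (fun i j => (Continuous.matrix_diagonal continuous_id).matrix_elem i j) P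
    intro x hx
    rw [heval]
    refine torus_eq_zero_of_injective hcont (fun y hy hinj => ?_) x hx
    rw [← heval y hy, Pi.sub_apply, h y hy hinj, sub_self]
  refine sub_eq_zero.1 (funext fun g => ?_)
  obtain ⟨p, hp⟩ := exists_conj_lowerTriangular g
  have hdet : ∏ i, (p * g * p⁻¹).1 i i = 1 := by
    rw [← Matrix.det_of_isLowerTriangular _ fun i j hij => hp i j hij, (p * g * p⁻¹).2]
  rw [← hf.conj g p, hf.apply_lowerTriangular _ hp hdet, hdiag]
  rfl

/-! ### The differential of a rational matrix representation -/

/-- Chain rule for a polynomial evaluated along a curve. -/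
theorem hasDerivAt_eval {σ : Type*} [Fintype σ] (P : MvPolynomial σ ℂ) {c : ℂ → σ → ℂ} {c' : σ → ℂ}
    {s : ℂ} (hc : ∀ i, HasDerivAt (fun s => c s i) (c' i) s) :
    HasDerivAt (fun s => MvPolynomial.eval (c s) P)
      (∑ i, c' i * MvPolynomial.eval (c s) (MvPolynomial.pderiv i P)) s := by
  classical
  induction P using MvPolynomial.induction_on with
  | C a => simpa using hasDerivAt_const s a
  | add p q hp hq =>
    simp only [map_add, mul_add, Finset.sum_add_distrib]
    exact hp.add hq
  | mul_X p i hp =>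
    simp only [map_mul, MvPolynomial.eval_X]
    refine (hp.mul (hc i)).congr_deriv ?_
    simp only [Derivation.leibniz, MvPolynomial.pderiv_X, smul_eq_mul, map_add, map_mul,
      MvPolynomial.eval_X, Pi.single_apply, mul_add, Finset.sum_add_distrib, Finset.sum_mul]
    rw [add_comm]
    congr 1
    · rw [Finset.sum_eq_single i]
      · simp [mul_comm]
      · intro j _ hj
        simp [hj.symm]
      · simp
    · exact Finset.sum_congr rfl fun j _ => by ring

/-- The curve `c` in `SL₄` passes through `1` with velocity `M`. -/
structure IsTangent (M : Matrix (Fin 4) (Fin 4) ℂ) (c : ℂ → SL4) : Prop where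
  zero : c 0 = 1
  hasDerivAt : ∀ i j, HasDerivAt (fun s => (c s).1 i j) (M i j) 0

theorem isTangent_transvection {i j : Fin 4} (hij : i ≠ j) :
    IsTangent (Matrix.single i j 1) (Matrix.SpecialLinearGroup.transvection hij) := by
  refine ⟨Matrix.SpecialLinearGroup.transvection_coeff_zero hij, fun k l => ?_⟩
  have h : ∀ s : ℂ, (Matrix.SpecialLinearGroup.transvection hij s).1 k l =
      (1 : Matrix (Fin 4) (Fin 4) ℂ) k l + s * Matrix.single i j (1 : ℂ) k l := by
    intro s
    change Matrix.transvection i j s k l = _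
    simp [Matrix.transvection, Matrix.single_apply]
  simp only [h]
  simpa using ((hasDerivAt_id (0 : ℂ)).mul_const (Matrix.single i j (1 : ℂ) k l)).const_add
    ((1 : Matrix (Fin 4) (Fin 4) ℂ) k l)

/-- The one-parameter subgroup `s ↦ exp (s • diag h)`. -/
def expDiag (h : Fin 4 → ℂ) (hh : ∑ i, h i = 0) (s : ℂ) : SL4 :=
  diagSL (fun i => Complex.exp (s * h i)) (by
    rw [← Complex.exp_sum, ← Finset.mul_sum, hh, mul_zero, Complex.exp_zero])

theorem isTangent_expDiag (h : Fin 4 → ℂ) (hh : ∑ i, h i = 0) :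
    IsTangent (Matrix.diagonal h) (expDiag h hh) := by
  refine ⟨Subtype.ext ?_, fun k l => ?_⟩
  · change Matrix.diagonal _ = 1
    simp
  · have h : ∀ s : ℂ, (expDiag h hh s).1 k l =
        Matrix.diagonal (fun i => Complex.exp (s * h i)) k l := fun s => rfl
    simp only [h, Matrix.diagonal_apply]
    split_ifs
    · simpa using ((hasDerivAt_id (0 : ℂ)).mul_const _).cexp
    · exact hasDerivAt_const _ _

section Representation

variable {ι : Type*} [Fintype ι] [DecidableEq ι]

/-- The differential at the identity of a matrix of polynomial functions, in the direction `M`. -/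
def differential (P : ι → ι → MvPolynomial (Fin 4 × Fin 4) ℂ) :
    Matrix (Fin 4) (Fin 4) ℂ →ₗ[ℂ] Matrix ι ι ℂ where
  toFun M := Matrix.of fun k l => ∑ ij : Fin 4 × Fin 4, M ij.1 ij.2 *
    MvPolynomial.eval (fun ij => (1 : Matrix (Fin 4) (Fin 4) ℂ) ij.1 ij.2)
      (MvPolynomial.pderiv ij (P k l))
  map_add' M N := by
    ext k l
    simp [add_mul, Finset.sum_add_distrib]
  map_smul' a M := by
    ext k l
    simp [mul_assoc, Finset.mul_sum]

/-- `R` is a matrix representation of `SL₄` whose entries are given by the polynomials `P`. -/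
def HasPolynomialEntries (R : SL4 →* Matrix ι ι ℂ)
    (P : ι → ι → MvPolynomial (Fin 4 × Fin 4) ℂ) : Prop :=
  ∀ g k l, R g k l = MvPolynomial.eval (fun ij => g.1 ij.1 ij.2) (P k l)

section Differential

variable {R : SL4 →* Matrix ι ι ℂ} {P : ι → ι → MvPolynomial (Fin 4 × Fin 4) ℂ}
  {M : Matrix (Fin 4) (Fin 4) ℂ} {c : ℂ → SL4}

theorem IsTangent.hasDerivAt_rep (hR : HasPolynomialEntries R P) (hc : IsTangent M c) (k l : ι) :
    HasDerivAt (fun s => R (c s) k l) (differential P M k l) 0 := by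
  simp only [hR (c _) k l]
  refine (hasDerivAt_eval (P k l) (c := fun s ij => (c s).1 ij.1 ij.2)
    (c' := fun ij => M ij.1 ij.2) fun ij => hc.hasDerivAt ij.1 ij.2).congr_deriv ?_
  rw [hc.zero]
  rfl

theorem IsTangent.hasDerivAt_mul_rep_mul (hR : HasPolynomialEntries R P) (hc : IsTangent M c)
    (A B : Matrix ι ι ℂ) (k l : ι) :
    HasDerivAt (fun s => (A * R (c s) * B) k l) ((A * differential P M * B) k l) 0 := by
  simp only [Matrix.mul_apply]
  exact HasDerivAt.fun_sum fun j _ => (HasDerivAt.fun_sum fun i _ =>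
    (hc.hasDerivAt_rep hR i j).const_mul _).mul_const _

theorem IsTangent.conj (hc : IsTangent M c) (g : SL4) :
    IsTangent (g.1 * M * (g⁻¹).1) fun s => g * c s * g⁻¹ := by
  refine ⟨by rw [hc.zero, mul_one, mul_inv_cancel], fun i j => ?_⟩
  have h : ∀ s, (g * c s * g⁻¹).1 = g.1 * (c s).1 * (g⁻¹).1 := fun s => rfl
  simp only [h, Matrix.mul_apply]
  exact HasDerivAt.fun_sum fun j _ => (HasDerivAt.fun_sum fun i _ =>
    (hc.hasDerivAt i j).const_mul _).mul_const _

/-- The differential is equivariant for the adjoint action. -/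
theorem rep_mul_differential (hR : HasPolynomialEntries R P) (hc : IsTangent M c) (g : SL4) :
    R g * differential P M * R g⁻¹ = differential P (g.1 * M * (g⁻¹).1) := by
  ext k l
  refine (hc.hasDerivAt_mul_rep_mul hR _ _ k l).unique ?_
  refine ((hc.conj g).hasDerivAt_rep hR k l).congr_of_eventuallyEq (.of_forall fun s => ?_)
  simp only [map_mul]

theorem rep_mul_differential' (hR : HasPolynomialEntries R P) (hc : IsTangent M c) (g : SL4) :
    R g * differential P M = differential P (g.1 * M * (g⁻¹).1) * R g := by
  rw [← rep_mul_differential hR hc g, mul_assoc, mul_assoc, ← map_mul, inv_mul_cancel, map_one,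
    mul_one]

/-- The commutator of the differentials of two opposite root vectors. It is the derivative of the
equivariance of the differential along the root subgroup. -/
theorem differential_single_commutator (hR : HasPolynomialEntries R P) {i j : Fin 4} (hij : i ≠ j) :
    differential P (Matrix.single i j 1) * differential P (Matrix.single j i 1) =
      differential P (Matrix.single i i 1 - Matrix.single j j 1) +
        differential P (Matrix.single j i 1) * differential P (Matrix.single i j 1) := by
  have hc := isTangent_transvection hij
  have hc' := isTangent_transvection hij.symm
  set E : Matrix (Fin 4) (Fin 4) ℂ := Matrix.single i j 1 with hE
  set F : Matrix (Fin 4) (Fin 4) ℂ := Matrix.single j i 1 with hF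
  set D := differential P
  have hconj : ∀ s : ℂ, R (Matrix.SpecialLinearGroup.transvection hij s) * D F =
      (D F + s • D (Matrix.single i i 1 - Matrix.single j j 1) - (s ^ 2) • D E) *
        R (Matrix.SpecialLinearGroup.transvection hij s) := by
    intro s
    rw [rep_mul_differential' hR hc']
    congr 1
    rw [← map_smul, ← map_smul, ← map_add, ← map_sub]
    congr 1
    have h1 : (Matrix.SpecialLinearGroup.transvection hij s).1 = 1 + s • E := by
      change Matrix.transvection i j s = _
      simp [Matrix.transvection, hE]
    have h2 : ((Matrix.SpecialLinearGroup.transvection hij s)⁻¹).1 = 1 - s • E := by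
      rw [Matrix.SpecialLinearGroup.transvection_inv]
      change Matrix.transvection i j (-s) = _
      simp [Matrix.transvection, hE, sub_eq_add_neg, Matrix.single_neg]
    rw [h1, h2]
    simp only [add_mul, mul_sub, one_mul, mul_one, Matrix.smul_mul, Matrix.mul_smul]
    rw [hE, hF]
    simp only [Matrix.single_mul_single_same, mul_one, smul_smul]
    module
  ext k l
  have hd1 := hc.hasDerivAt_mul_rep_mul hR 1 (D F) k l
  simp only [one_mul] at hd1
  refine hd1.unique ?_
  simp only [hconj]
  -- differentiate the right-hand side of `hconj` entrywise by the product rule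
  have hcoef : ∀ a b, HasDerivAt (fun s : ℂ => (D F + s • D (Matrix.single i i 1 -
      Matrix.single j j 1) - (s ^ 2) • D E) a b)
      (D (Matrix.single i i 1 - Matrix.single j j 1) a b) 0 := by
    intro a b
    simp only [Matrix.sub_apply, Matrix.add_apply, Matrix.smul_apply, smul_eq_mul]
    have h1 := ((hasDerivAt_id (0 : ℂ)).mul_const
      (D (Matrix.single i i 1 - Matrix.single j j 1) a b)).const_add (D F a b)
    have h2 := (((hasDerivAt_id (0 : ℂ)).pow 2).mul_const (D E a b))
    exact (h1.sub h2).congr_deriv (by simp)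
  simp only [Matrix.mul_apply (M := D F + _ - _)]
  refine (HasDerivAt.fun_sum fun a _ => (hcoef k a).mul (hc.hasDerivAt_rep hR a l)).congr_deriv ?_
  rw [Finset.sum_add_distrib, hc.zero, map_one]
  simp only [Matrix.one_apply, mul_ite, mul_one, mul_zero, Finset.sum_ite_eq', Finset.mem_univ,
    if_true, Matrix.add_apply, Matrix.mul_apply]
  simp [D]

/-! ### The Casimir operator -/

/-- The matrix unit `Eᵢⱼ` projected to trace zero. -/
def tracelessUnit (i j : Fin 4) : Matrix (Fin 4) (Fin 4) ℂ :=
  Matrix.single i j 1 - (if i = j then (1 / 4 : ℂ) else 0) • 1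

theorem tracelessUnit_of_ne {i j : Fin 4} (h : i ≠ j) :
    tracelessUnit i j = Matrix.single i j 1 := by
  simp [tracelessUnit, h]

theorem tracelessUnit_self (i : Fin 4) :
    tracelessUnit i i = Matrix.diagonal fun k => (if k = i then 1 else 0) - 1 / 4 := by
  ext k l
  by_cases hkl : k = l
  · subst hkl
    simp [tracelessUnit, Matrix.single_apply, eq_comm]
  · simp [tracelessUnit, Matrix.single_apply, hkl]
    intro h1 h2
    exact hkl (h1.symm.trans h2)

theorem sum_tracelessUnit_exponent (i : Fin 4) :
    ∑ k, ((if k = i then 1 else 0) - 1 / 4 : ℂ) = 0 := by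
  simp

theorem exists_isTangent_tracelessUnit (i j : Fin 4) : ∃ c, IsTangent (tracelessUnit i j) c := by
  by_cases h : i = j
  · subst h
    rw [tracelessUnit_self]
    exact ⟨_, isTangent_expDiag _ (sum_tracelessUnit_exponent i)⟩
  · rw [tracelessUnit_of_ne h]
    exact ⟨_, isTangent_transvection h⟩

theorem conj_tracelessUnit {G H : Matrix (Fin 4) (Fin 4) ℂ} (hGH : G * H = 1) (i j : Fin 4) :
    G * tracelessUnit i j * H =
      ∑ b : Fin 4 × Fin 4, (G b.1 i * H j b.2) • tracelessUnit b.1 b.2 := by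
  have hHG : H * G = 1 := mul_eq_one_comm.1 hGH
  have h1 : ∑ b : Fin 4 × Fin 4, (G b.1 i * H j b.2) • (if b.1 = b.2 then (1 / 4 : ℂ) else 0) =
      if i = j then (1 / 4 : ℂ) else 0 := by
    have := congrFun (congrFun hHG j) i
    rw [Matrix.mul_apply, Matrix.one_apply] at this
    simp only [Fintype.sum_prod_type, smul_eq_mul, mul_ite, mul_zero, Finset.sum_ite_eq,
      Finset.mem_univ, if_true]
    rw [← Finset.sum_mul]
    simp only [mul_comm (G _ i), this, eq_comm (a := j)]
    split_ifs <;> simp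
  simp only [tracelessUnit, smul_sub, Finset.sum_sub_distrib, smul_smul]
  simp only [smul_eq_mul] at h1
  rw [← Finset.sum_smul, h1, mul_sub, sub_mul, Matrix.mul_smul, Matrix.smul_mul, mul_one, hGH]
  congr 1
  ext k l
  rw [Matrix.sum_apply]
  simp only [Matrix.smul_apply, Matrix.single_apply, smul_eq_mul, mul_ite, mul_one, mul_zero,
    Fintype.sum_prod_type, ite_and]
  simp [Matrix.mul_apply, Matrix.single_apply, ite_and]

/-- The Casimir operator of the representation with entries `P`. The traceless matrix units are
linearly dependent, but `∑ E'ᵢⱼ ⊗ E'ⱼᵢ` is the tensor of the trace form of `𝔰𝔩₄`. -/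
def casimir (P : ι → ι → MvPolynomial (Fin 4 × Fin 4) ℂ) : Matrix ι ι ℂ :=
  ∑ a : Fin 4 × Fin 4, differential P (tracelessUnit a.1 a.2) *
    differential P (tracelessUnit a.2 a.1)

/-- The Casimir operator commutes with the representation. -/
theorem rep_mul_casimir (hR : HasPolynomialEntries R P) (g : SL4) :
    R g * casimir P = casimir P * R g := by
  set D := differential P with hD
  have hgh : g.1 * (g⁻¹).1 = 1 := by
    rw [← Matrix.SpecialLinearGroup.coe_mul, mul_inv_cancel, Matrix.SpecialLinearGroup.coe_one]
  set G := g.1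
  set H := (g⁻¹).1
  have hterm : ∀ a : Fin 4 × Fin 4, R g * (D (tracelessUnit a.1 a.2) * D (tracelessUnit a.2 a.1)) =
      (∑ b : Fin 4 × Fin 4, (G b.1 a.1 * H a.2 b.2) • D (tracelessUnit b.1 b.2)) *
      (∑ c : Fin 4 × Fin 4, (G c.1 a.2 * H a.1 c.2) • D (tracelessUnit c.1 c.2)) * R g := by
    intro a
    obtain ⟨c₁, h₁⟩ := exists_isTangent_tracelessUnit a.1 a.2
    obtain ⟨c₂, h₂⟩ := exists_isTangent_tracelessUnit a.2 a.1
    simp only [← map_smul, ← map_sum, ← conj_tracelessUnit hgh]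
    calc R g * (D (tracelessUnit a.1 a.2) * D (tracelessUnit a.2 a.1))
        = R g * D (tracelessUnit a.1 a.2) * D (tracelessUnit a.2 a.1) := (mul_assoc _ _ _).symm
      _ = D (G * tracelessUnit a.1 a.2 * H) * (R g * D (tracelessUnit a.2 a.1)) := by
        rw [rep_mul_differential' hR h₁, mul_assoc]
      _ = _ := by
        rw [rep_mul_differential' hR h₂]
        exact (mul_assoc _ _ _).symm
  -- the two sums over `a` are the products `G * H = 1`
  have hcoef : ∀ b c : Fin 4 × Fin 4,
      ∑ a : Fin 4 × Fin 4, (G c.1 a.2 * H a.1 c.2) * (G b.1 a.1 * H a.2 b.2) =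
        if c = b.swap then 1 else 0 := by
    intro b c
    have e1 := congrFun (congrFun hgh b.1) c.2
    have e2 := congrFun (congrFun hgh c.1) b.2
    rw [Matrix.mul_apply, Matrix.one_apply] at e1 e2
    have : (if c = b.swap then (1 : ℂ) else 0) =
        (if b.1 = c.2 then 1 else 0) * (if c.1 = b.2 then 1 else 0) := by
      rw [ite_zero_mul_ite_zero, mul_one]
      exact if_congr ⟨fun h => by subst h; simp, fun h => Prod.ext h.2 h.1.symm⟩ rfl rfl
    rw [this, ← e1, ← e2, Finset.sum_mul_sum, Fintype.sum_prod_type]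
    exact Finset.sum_congr rfl fun i _ => Finset.sum_congr rfl fun j _ => by ring
  rw [casimir, Finset.mul_sum, Finset.sum_congr rfl fun a _ => hterm a, ← Finset.sum_mul]
  congr 1
  simp only [Finset.sum_mul_sum, Matrix.smul_mul, Matrix.mul_smul, smul_smul]
  rw [Finset.sum_comm]
  refine Finset.sum_congr rfl fun b _ => ?_
  rw [Finset.sum_comm]
  simp only [← Finset.sum_smul]
  simp only [hcoef, ite_smul, one_smul, zero_smul]
  simp [D]

/-- At a regular element of the torus, the contribution of a pair of opposite roots to the trace of
the Casimir operator is a first order operator applied to the character. -/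
theorem trace_root_pair (hR : HasPolynomialEntries R P) (x : Fin 4 → ℂ) (hx : ∏ i, x i = 1)
    {i j : Fin 4} (hij : x i ≠ x j) :
    Matrix.trace (R (diagSL x hx) * (differential P (Matrix.single i j 1) *
        differential P (Matrix.single j i 1))) +
      Matrix.trace (R (diagSL x hx) * (differential P (Matrix.single j i 1) *
        differential P (Matrix.single i j 1))) =
    (x i + x j) / (x i - x j) * Matrix.trace (R (diagSL x hx) *
      differential P (Matrix.single i i 1 - Matrix.single j j 1)) := by
  have hne : i ≠ j := fun h => hij (by rw [h])
  have hx0 := prod_eq_one_ne_zero hx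
  set D := differential P
  set t := diagSL x hx with ht
  have hcomm : R t * D (Matrix.single i j 1) = (x i / x j) • (D (Matrix.single i j 1) * R t) := by
    rw [rep_mul_differential' hR (isTangent_transvection hne), ht, coe_diagSL_inv,
      ← Matrix.smul_mul]
    congr 1
    rw [← map_smul]
    congr 1
    change Matrix.diagonal x * _ * _ = _
    ext k l
    rw [Matrix.mul_diagonal, Matrix.diagonal_mul, Matrix.smul_apply, Matrix.single_apply]
    split_ifs with h
    · rw [← h.1, ← h.2, smul_eq_mul]
      field_simp
    · simp
  have h1 : Matrix.trace (R t * (D (Matrix.single i j 1) * D (Matrix.single j i 1))) =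
      x i / x j * Matrix.trace (R t * (D (Matrix.single j i 1) * D (Matrix.single i j 1))) := by
    rw [← mul_assoc, hcomm, Matrix.smul_mul, Matrix.trace_smul, smul_eq_mul, mul_assoc,
      Matrix.trace_mul_comm, mul_assoc]
  have h2 : Matrix.trace (R t * (D (Matrix.single i j 1) * D (Matrix.single j i 1))) =
      Matrix.trace (R t * D (Matrix.single i i 1 - Matrix.single j j 1)) +
      Matrix.trace (R t * (D (Matrix.single j i 1) * D (Matrix.single i j 1))) := by
    rw [differential_single_commutator hR hne, mul_add, Matrix.trace_add]
  have hsub : x i - x j ≠ 0 := sub_ne_zero.2 hij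
  have hxj := hx0 j
  rw [h1] at h2 ⊢
  rw [← sub_eq_iff_eq_add] at h2
  rw [← h2]
  field_simp

/-- If the Casimir operator is a scalar, the character satisfies a second order differential
equation at the regular elements of the torus: the radial part of the Casimir operator. -/
theorem casimir_radial (hR : HasPolynomialEntries R P) {c : ℂ} (hc : casimir P = c • 1)
    (x : Fin 4 → ℂ) (hx : ∏ i, x i = 1) (hinj : Function.Injective x) :
    let H : Fin 4 → Fin 4 → ℂ := fun i j => (x i + x j) / (x i - x j) *
      Matrix.trace (R (diagSL x hx) * differential P (Matrix.single i i 1 - Matrix.single j j 1))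
    ∑ i, Matrix.trace (R (diagSL x hx) * (differential P (tracelessUnit i i) *
        differential P (tracelessUnit i i))) +
      (H 0 1 + H 0 2 + H 0 3 + H 1 2 + H 1 3 + H 2 3) = c * Matrix.trace (R (diagSL x hx)) := by
  intro H
  have hpair : ∀ i j : Fin 4, i ≠ j → H i j = Matrix.trace (R (diagSL x hx) *
      (differential P (tracelessUnit i j) * differential P (tracelessUnit j i))) +
      Matrix.trace (R (diagSL x hx) *
        (differential P (tracelessUnit j i) * differential P (tracelessUnit i j))) := by
    intro i j hij
    rw [tracelessUnit_of_ne hij, tracelessUnit_of_ne hij.symm]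
    exact (trace_root_pair hR x hx (hinj.ne hij)).symm
  have h : Matrix.trace (R (diagSL x hx) * casimir P) = c * Matrix.trace (R (diagSL x hx)) := by
    rw [hc, Matrix.mul_smul, mul_one, Matrix.trace_smul, smul_eq_mul]
  rw [← h, casimir, Finset.mul_sum, Matrix.trace_sum, hpair 0 1 (by decide), hpair 0 2 (by decide),
    hpair 0 3 (by decide), hpair 1 2 (by decide), hpair 1 3 (by decide), hpair 2 3 (by decide)]
  simp only [Fintype.sum_prod_type, Fin.sum_univ_four]
  ring

end Differential

end Representation

/-! ### The big cell -/

/-- The leading principal minor of size two. -/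
def minor₂ {S : Type*} [CommRing S] (M : Fin 4 → Fin 4 → S) : S :=
  M 0 0 * M 1 1 - M 0 1 * M 1 0

/-- The leading principal minor of size three. -/
def minor₃ {S : Type*} [CommRing S] (M : Fin 4 → Fin 4 → S) : S :=
  M 0 0 * (M 1 1 * M 2 2 - M 1 2 * M 2 1) - M 0 1 * (M 1 0 * M 2 2 - M 1 2 * M 2 0)
    + M 0 2 * (M 1 0 * M 2 1 - M 1 1 * M 2 0)

/-- `u` is a lower triangular unipotent matrix. -/
structure IsLowerUnipotent (u : SL4) : Prop where
  diag : ∀ i, u.1 i i = 1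
  upper : ∀ i j : Fin 4, i < j → u.1 i j = 0

theorem IsLowerUnipotent.one : IsLowerUnipotent 1 :=
  ⟨fun i => Matrix.one_apply_eq i, fun _ _ h => Matrix.one_apply_ne h.ne⟩

/-- An element of `SL₄` with non-zero leading principal minors has an `LU` decomposition; the
entries of the factors are the quotients of minors given by Gaussian elimination. -/
theorem exists_lower_mul_upper (g : SL4) (h₁ : g.1 0 0 ≠ 0) (h₂ : minor₂ g.1 ≠ 0)
    (h₃ : minor₃ g.1 ≠ 0) :
    ∃ u b : SL4, IsLowerUnipotent u ∧ (∀ i j : Fin 4, j < i → b.1 i j = 0) ∧ g = u * b := by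
  obtain ⟨M, hM⟩ := g
  change M 0 0 ≠ 0 at h₁
  change minor₂ M ≠ 0 at h₂
  change minor₃ M ≠ 0 at h₃
  set d₂ := minor₂ M with hd₂
  set d₃ := minor₃ M with hd₃
  let U : Matrix (Fin 4) (Fin 4) ℂ := !![1, 0, 0, 0;
    M 1 0 / M 0 0, 1, 0, 0;
    M 2 0 / M 0 0, (M 0 0 * M 2 1 - M 0 1 * M 2 0) / d₂, 1, 0;
    M 3 0 / M 0 0, (M 0 0 * M 3 1 - M 0 1 * M 3 0) / d₂,
      (M 0 0 * (M 1 1 * M 3 2 - M 1 2 * M 3 1) - M 0 1 * (M 1 0 * M 3 2 - M 1 2 * M 3 0)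
        + M 0 2 * (M 1 0 * M 3 1 - M 1 1 * M 3 0)) / d₃, 1]
  let B : Matrix (Fin 4) (Fin 4) ℂ := !![M 0 0, M 0 1, M 0 2, M 0 3;
    0, d₂ / M 0 0, (M 0 0 * M 1 2 - M 0 2 * M 1 0) / M 0 0,
      (M 0 0 * M 1 3 - M 0 3 * M 1 0) / M 0 0;
    0, 0, d₃ / d₂, (M 0 0 * (M 1 1 * M 2 3 - M 1 3 * M 2 1)
      - M 0 1 * (M 1 0 * M 2 3 - M 1 3 * M 2 0) + M 0 3 * (M 1 0 * M 2 1 - M 1 1 * M 2 0)) / d₂;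
    0, 0, 0, M 3 3 - (U 3 0 * M 0 3 + U 3 1 * ((M 0 0 * M 1 3 - M 0 3 * M 1 0) / M 0 0)
      + U 3 2 * ((M 0 0 * (M 1 1 * M 2 3 - M 1 3 * M 2 1)
        - M 0 1 * (M 1 0 * M 2 3 - M 1 3 * M 2 0)
        + M 0 3 * (M 1 0 * M 2 1 - M 1 1 * M 2 0)) / d₂))]
  have hUB : U * B = M := by
    have e₂ : d₂ = M 0 0 * M 1 1 - M 0 1 * M 1 0 := rfl
    have e₃ : d₃ = M 0 0 * (M 1 1 * M 2 2 - M 1 2 * M 2 1)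
      - M 0 1 * (M 1 0 * M 2 2 - M 1 2 * M 2 0) + M 0 2 * (M 1 0 * M 2 1 - M 1 1 * M 2 0) := rfl
    clear_value d₂ d₃
    ext i j
    rw [Matrix.mul_apply, Fin.sum_univ_four]
    fin_cases i <;> fin_cases j <;>
      simp only [U, B, Matrix.of_apply, Matrix.cons_val', Matrix.cons_val, Fin.mk_one, Fin.zero_eta,
        Fin.reduceFinMk, mul_zero, zero_mul, one_mul, add_zero]
    all_goals first
      | rfl
      | ring1
      | (field_simp; done)
      | (field_simp; ring1)
      | (field_simp; rw [e₂]; ring1)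
      | (field_simp; rw [e₃, e₂]; ring1)
  have hUdet : U.det = 1 := by
    rw [Matrix.det_of_isLowerTriangular U fun i j hij => ?_, Fin.prod_univ_four]
    · simp [U]
    · fin_cases i <;> fin_cases j <;> first | (exfalso; revert hij; decide) | rfl
  have hBdet : B.det = 1 := by
    rw [← hUB, Matrix.det_mul, hUdet, one_mul] at hM
    exact hM
  refine ⟨⟨U, hUdet⟩, ⟨B, hBdet⟩, ⟨fun i => ?_, fun i j hij => ?_⟩, fun i j hij => ?_,
    Subtype.ext hUB.symm⟩
  · fin_cases i <;> rfl
  · fin_cases i <;> fin_cases j <;> first | (exfalso; revert hij; decide) | rfl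
  · fin_cases i <;> fin_cases j <;> first | (exfalso; revert hij; decide) | rfl

theorem eval_aeval {σ τ : Type*} (x : τ → ℂ) (f : σ → MvPolynomial τ ℂ) (P : MvPolynomial σ ℂ) :
    MvPolynomial.eval x (MvPolynomial.aeval f P) =
      MvPolynomial.eval (fun i => MvPolynomial.eval x (f i)) P := by
  induction P using MvPolynomial.induction_on with
  | C a => simp
  | add p q hp hq => rw [map_add, map_add, map_add, hp, hq]
  | mul_X p i hp => rw [map_mul, map_mul, map_mul, hp, MvPolynomial.aeval_X, MvPolynomial.eval_X]

theorem eval_minor₂ (M : Fin 4 → Fin 4 → Polynomial ℂ) (s : ℂ) :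
    (minor₂ M).eval s = minor₂ fun i j => (M i j).eval s := by
  simp [minor₂]

theorem eval_minor₃ (M : Fin 4 → Fin 4 → Polynomial ℂ) (s : ℂ) :
    (minor₃ M).eval s = minor₃ fun i j => (M i j).eval s := by
  simp [minor₃]

/-! ### Highest weight vectors and the weights below them -/

section HighestWeight

variable {V : Type*} [AddCommGroup V] [Module ℂ V] {ρ : Representation ℂ SL4 V} {l m n : ℕ} {v : V}

/-- The translates of a highest weight vector by the elements of the big cell lie in the span of its
translates by lower triangular unipotent matrices. -/
theorem bigCell_mem_span (hv : IsHighestWeightVector ρ l m n v) (g : SL4) (h₁ : g.1 0 0 ≠ 0)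
    (h₂ : minor₂ g.1 ≠ 0) (h₃ : minor₃ g.1 ≠ 0) :
    ρ g v ∈ Submodule.span ℂ {w | ∃ u, IsLowerUnipotent u ∧ ρ u v = w} := by
  obtain ⟨u, b, hu, hb, rfl⟩ := exists_lower_mul_upper g h₁ h₂ h₃
  rw [map_mul, Module.End.mul_apply, hv.2 b hb, map_smul]
  exact Submodule.smul_mem _ _ (Submodule.subset_span ⟨u, hu, rfl⟩)

/-- Since the big cell is dense, the span of the translates of a highest weight vector by lower
triangular unipotent matrices is a subrepresentation. It suffices to test generators of `SL₄`, and
for a transvection to follow the polynomial curve `s ↦ (1 + s Eᵢⱼ) u`, which meets the big cell. -/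
theorem rep_mem_span_lowerUnipotent (hρ : IsRational ρ) (hv : IsHighestWeightVector ρ l m n v)
    (g : SL4) : ∀ w ∈ Submodule.span ℂ {w | ∃ u, IsLowerUnipotent u ∧ ρ u v = w},
      ρ g w ∈ Submodule.span ℂ {w | ∃ u, IsLowerUnipotent u ∧ ρ u v = w} := by
  set W := Submodule.span ℂ {w | ∃ u, IsLowerUnipotent u ∧ ρ u v = w} with hW
  have reduce : ∀ g : SL4, (∀ u, IsLowerUnipotent u → ρ (g * u) v ∈ W) → ∀ w ∈ W, ρ g w ∈ W := by
    intro g h w hw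
    induction hw using Submodule.span_induction with
    | mem x hx =>
      obtain ⟨u, hu, rfl⟩ := hx
      rw [← Module.End.mul_apply, ← map_mul]
      exact h u hu
    | zero => rw [map_zero]; exact W.zero_mem
    | add x y _ _ hx hy => rw [map_add]; exact W.add_mem hx hy
    | smul a x _ hx => rw [map_smul]; exact W.smul_mem a hx
  have hdiag : ∀ (x : Fin 4 → ℂ) (hx : ∏ i, x i = 1), ∀ w ∈ W, ρ (diagSL x hx) w ∈ W := by
    intro x hx
    refine reduce _ fun u hu => ?_
    have hent : ∀ i j, (diagSL x hx * u).1 i j = x i * u.1 i j := fun i j =>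
      Matrix.diagonal_mul _ _ _ _
    have hx0 := prod_eq_one_ne_zero hx
    have h01 := hu.upper 0 1 (by decide)
    have h02 := hu.upper 0 2 (by decide)
    have h12 := hu.upper 1 2 (by decide)
    refine bigCell_mem_span hv _ ?_ ?_ ?_
    · rw [hent, hu.diag]
      simpa using hx0 0
    · simp only [minor₂, hent, hu.diag, h01]
      simpa using ⟨hx0 0, hx0 1⟩
    · simp only [minor₃, hent, hu.diag, h01, h02, h12]
      simpa using ⟨hx0 0, hx0 1, hx0 2⟩
  refine Matrix.SpecialLinearGroup.diagonal_transvection_induction'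
    (fun g => ∀ w ∈ W, ρ g w ∈ W) g (fun i j hij c hc => ?_) (fun i j hij s₀ => ?_)
    (fun A B hA hB w hw => ?_)
  · have hdet := (Matrix.SpecialLinearGroup.diag2n hij c hc).2
    have hd : (Matrix.SpecialLinearGroup.diag2n hij c hc).1 = Matrix.diagonal _ :=
      Matrix.SpecialLinearGroup.diag2n_coe hij c hc
    rw [hd, Matrix.det_diagonal] at hdet
    have : Matrix.SpecialLinearGroup.diag2n hij c hc = diagSL _ hdet := Subtype.ext hd
    rw [this]
    exact hdiag _ hdet
  · refine reduce _ fun u hu => ?_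
    by_contra hnot
    obtain ⟨φ, hφ, hφW⟩ := Submodule.exists_le_ker_of_notMem hnot
    obtain ⟨P, hP⟩ := hρ φ v
    let M : Fin 4 → Fin 4 → Polynomial ℂ := fun k q =>
      Polynomial.C (u.1 k q) + Polynomial.X * Polynomial.C (if k = i then u.1 j q else 0)
    have hM : ∀ (s : ℂ) (k q : Fin 4),
        (Matrix.SpecialLinearGroup.transvection hij s * u).1 k q = (M k q).eval s := by
      intro s k q
      change (Matrix.transvection i j s * u.1) k q = _
      by_cases hk : k = i
      · subst hk
        rw [Matrix.transvection_mul_apply_same]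
        simp [M]
        ring
      · rw [Matrix.transvection_mul_apply_of_ne _ _ _ _ hk]
        simp [M, hk]
    have hM0 : ∀ k q, (M k q).eval 0 = u.1 k q := fun k q => by simp [M]
    set p : Polynomial ℂ := MvPolynomial.aeval (fun ij : Fin 4 × Fin 4 => M ij.1 ij.2) P with hp
    have hpeval : ∀ s, p.eval s =
        φ (ρ (Matrix.SpecialLinearGroup.transvection hij s * u) v) := by
      intro s
      rw [hP, hp, ← Polynomial.coe_aeval_eq_eval, ← AlgHom.comp_apply, MvPolynomial.comp_aeval,
        ← MvPolynomial.coe_aeval_eq_eval]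
      simp only [hM, Polynomial.coe_aeval_eq_eval]
      rfl
    have hzero : p * (M 0 0 * (minor₂ M * minor₃ M)) = 0 := by
      refine Polynomial.funext fun s => ?_
      rw [Polynomial.eval_zero, Polynomial.eval_mul, Polynomial.eval_mul, Polynomial.eval_mul,
        eval_minor₂, eval_minor₃]
      by_contra hne
      have h0 := left_ne_zero_of_mul hne
      have h' := right_ne_zero_of_mul hne
      have h1 := left_ne_zero_of_mul h'
      have h2 := left_ne_zero_of_mul (right_ne_zero_of_mul h')
      have h3 := right_ne_zero_of_mul (right_ne_zero_of_mul h')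
      simp only [← hM] at h1 h2 h3
      refine h0 ?_
      rw [hpeval]
      exact hφW (bigCell_mem_span hv _ h1 h2 h3)
    have hone : (M 0 0 * (minor₂ M * minor₃ M)).eval 0 = 1 := by
      rw [Polynomial.eval_mul, Polynomial.eval_mul, eval_minor₂, eval_minor₃]
      simp only [hM0, minor₂, minor₃, hu.diag, hu.upper 0 1 (by decide), hu.upper 0 2 (by decide),
        hu.upper 1 2 (by decide)]
      ring
    have hp0 : p = 0 := by
      refine (mul_eq_zero.1 hzero).resolve_right fun h => ?_
      rw [h, Polynomial.eval_zero] at hone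
      exact zero_ne_one hone
    refine hφ ?_
    rw [← hpeval, hp0, Polynomial.eval_zero]
  · rw [map_mul, Module.End.mul_apply]
    exact hA _ (hB w hw)

/-- An irreducible representation is spanned by the translates of a highest weight vector by lower
triangular unipotent matrices. -/
theorem span_lowerUnipotent_eq_top (hρ : IsRational ρ) (hirr : ρ.IsIrreducible)
    (hv : IsHighestWeightVector ρ l m n v) :
    Submodule.span ℂ {w | ∃ u, IsLowerUnipotent u ∧ ρ u v = w} = ⊤ := by
  let W : Subrepresentation ρ :=
    ⟨_, fun g _ hw => rep_mem_span_lowerUnipotent hρ hv g _ hw⟩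
  rcases hirr.eq_bot_or_eq_top W with h | h
  · have hvW : v ∈ W.toSubmodule :=
      Submodule.subset_span ⟨1, .one, by rw [map_one, Module.End.one_apply]⟩
    rw [h] at hvW
    exact absurd ((Submodule.mem_bot ℂ).1 hvW) hv.1
  · exact congrArg Subrepresentation.toSubmodule h

/-- The weight `l ω₁ + m ω₂ + n ω₃` as a function on the torus. -/
def torusWeight (l m n : ℕ) (x : Fin 4 → ℂ) : ℂ :=
  x 0 ^ l * (x 0 * x 1) ^ m * (x 0 * x 1 * x 2) ^ n

/-- The values of the negative simple roots at a point of the torus. -/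
def rootCoord (x : Fin 4 → ℂ) : Fin 3 → ℂ :=
  ![x 1 / x 0, x 2 / x 1, x 3 / x 2]

/-- The negative roots `xᵢ / xⱼ`, `j < i`, as monomials in the negative simple roots. -/
def rootMonomial : Matrix (Fin 4) (Fin 4) (MvPolynomial (Fin 3) ℂ) :=
  let X := fun i : Fin 3 => (MvPolynomial.X i : MvPolynomial (Fin 3) ℂ)
  !![1, 0, 0, 0; X 0, 1, 0, 0; X 0 * X 1, X 1, 1, 0; X 0 * X 1 * X 2, X 1 * X 2, X 2, 1]

/-- The entries of `diag x * u * (diag x)⁻¹` are polynomials in the negative simple roots. -/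
theorem eval_rootMonomial {x : Fin 4 → ℂ} (hx : ∀ i, x i ≠ 0) (u : SL4) (hu : IsLowerUnipotent u)
    (i j : Fin 4) : u.1 i j * MvPolynomial.eval (rootCoord x) (rootMonomial i j) =
      x i * u.1 i j * (x j)⁻¹ := by
  rcases lt_or_ge i j with hij | hij
  · rw [hu.upper i j hij]; simp
  · have h0 := hx 0
    have h1 := hx 1
    have h2 := hx 2
    have h3 := hx 3
    fin_cases i <;> fin_cases j <;>
      first
      | (exfalso; revert hij; decide)
      | (simp [rootMonomial, rootCoord]; field_simp)

theorem eval_zero_rootMonomial (i j : Fin 4) :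
    MvPolynomial.eval (0 : Fin 3 → ℂ) (rootMonomial i j) = (1 : Matrix _ _ ℂ) i j := by
  fin_cases i <;> fin_cases j <;> simp [rootMonomial]

/-- The character of an irreducible representation with a highest weight vector is, on the torus,
the highest weight times a polynomial in the negative simple roots with constant term `1`. -/
theorem exists_character_polynomial (h : IsIrrepOfHighestWeight ρ l m n) :
    ∃ Q : MvPolynomial (Fin 3) ℂ, MvPolynomial.eval 0 Q = 1 ∧
      ∀ (x : Fin 4 → ℂ) (hx : ∏ i, x i = 1),
        ρ.character (diagSL x hx) = torusWeight l m n x * MvPolynomial.eval (rootCoord x) Q := by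
  classical
  have := h.finite
  obtain ⟨v, hv⟩ := h.highestWeight
  -- choose a basis of translates `u v` with `u` lower triangular unipotent, among them `v` itself
  set S := {w | ∃ u, IsLowerUnipotent u ∧ ρ u v = w} with hS
  have hspan : Submodule.span ℂ S = ⊤ := span_lowerUnipotent_eq_top h.rational h.irreducible hv
  have hind : LinearIndepOn ℂ id ({v} : Set V) := LinearIndepOn.singleton (R := ℂ) (v := id) hv.1
  have hvS : ({v} : Set V) ⊆ S := by
    rw [Set.singleton_subset_iff]
    exact ⟨1, .one, by rw [map_one, Module.End.one_apply]⟩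
  let b := Module.Basis.extendLe hind hvS hspan.ge
  have hb : ∀ i, b i = i.1 := Module.Basis.extendLe_apply_self hind hvS hspan.ge
  have : Fintype (hind.extend hvS) := FiniteDimensional.fintypeBasisIndex b
  have hex : ∀ i, ∃ u, IsLowerUnipotent u ∧ ρ u v = b i := fun i => by
    rw [hb]
    exact hind.extend_subset hvS i.2
  choose u hu hub using hex
  have hpoly := fun i => h.rational (b.coord i) v
  choose P hP using hpoly
  refine ⟨∑ i, MvPolynomial.aeval (fun kl : Fin 4 × Fin 4 =>
    MvPolynomial.C ((u i).1 kl.1 kl.2) * rootMonomial kl.1 kl.2) (P i), ?_, fun x hx => ?_⟩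
  · let i₀ : hind.extend hvS := ⟨v, hind.subset_extend hvS rfl⟩
    have hterm : ∀ i, MvPolynomial.eval 0 (MvPolynomial.aeval (fun kl : Fin 4 × Fin 4 =>
        MvPolynomial.C ((u i).1 kl.1 kl.2) * rootMonomial kl.1 kl.2) (P i)) = b.coord i v := by
      intro i
      have h1 := hP i 1
      rw [map_one, Module.End.one_apply] at h1
      rw [h1, eval_aeval]
      refine congrArg (fun f => MvPolynomial.eval f (P i)) (funext fun kl => ?_)
      rw [map_mul, MvPolynomial.eval_C, eval_zero_rootMonomial]
      by_cases hkl : kl.1 = kl.2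
      · rw [hkl, (hu i).diag]; simp
      · rw [Matrix.one_apply_ne hkl, mul_zero]
        exact (Matrix.one_apply_ne hkl).symm
    rw [map_sum, Finset.sum_congr rfl fun i _ => hterm i]
    have hbv : b i₀ = v := hb i₀
    have : ∀ i, b.coord i v = if i = i₀ then 1 else 0 := fun i => by
      refine (congrArg (b.coord i) hbv).symm.trans ?_
      rw [Module.Basis.coord_apply, Module.Basis.repr_self, Finsupp.single_apply]
      exact if_congr eq_comm rfl rfl
    simp [this]
  · rw [Representation.character, LinearMap.trace_eq_matrix_trace ℂ b, Matrix.trace, map_sum,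
      Finset.mul_sum]
    refine Finset.sum_congr rfl fun i _ => ?_
    have hx0 := prod_eq_one_ne_zero hx
    -- `diag x * u = (diag x * u * (diag x)⁻¹) * diag x`
    set t := diagSL x hx with ht
    have htv : ρ t v = torusWeight l m n x • v := by
      refine (hv.2 t fun i j hij => Matrix.diagonal_apply_ne _ hij.ne').trans ?_
      simp [torusWeight, ht, diagSL]
    have hsplit : ρ t (b i) = torusWeight l m n x • ρ (t * u i * t⁻¹) v := by
      rw [← hub, ← map_smul, ← htv, ← Module.End.mul_apply, ← map_mul, ← Module.End.mul_apply,
        ← map_mul, inv_mul_cancel_right]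
    rw [Matrix.diag_apply, LinearMap.toMatrix_apply, hsplit, map_smul, Finsupp.smul_apply,
      smul_eq_mul]
    congr 1
    rw [← Module.Basis.coord_apply, hP, eval_aeval]
    refine congrArg (fun f => MvPolynomial.eval f (P i)) (funext fun kl => ?_)
    rw [map_mul, MvPolynomial.eval_C, eval_rootMonomial hx0 _ (hu i)]
    have : (t * u i * t⁻¹).1 = Matrix.diagonal x * (u i).1 * (t⁻¹).1 := rfl
    rw [this, ht, coe_diagSL_inv, Matrix.mul_diagonal, Matrix.diagonal_mul]

end HighestWeight

/-! ### The radial differential equation as an identity of polynomials -/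

/-- The Euler operator in the `k`-th variable. -/
def euler (k : Fin 3) :
    Derivation ℂ (MvPolynomial (Fin 3) ℂ) (MvPolynomial (Fin 3) ℂ) :=
  (MvPolynomial.X k : MvPolynomial (Fin 3) ℂ) • MvPolynomial.pderiv k

theorem coeff_euler (k : Fin 3) (Q : MvPolynomial (Fin 3) ℂ) (d : Fin 3 →₀ ℕ) :
    (euler k Q).coeff d = d k * Q.coeff d := by
  induction Q using MvPolynomial.induction_on' with
  | monomial e a =>
    rw [euler, Derivation.smul_apply, smul_eq_mul, MvPolynomial.X_mul_pderiv_monomial,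
      MvPolynomial.coeff_smul, nsmul_eq_mul, MvPolynomial.coeff_monomial]
    split_ifs with h
    · rw [h]
    · simp
  | add p q hp hq => rw [map_add, MvPolynomial.coeff_add, hp, hq, MvPolynomial.coeff_add, mul_add]

theorem euler_comm (j k : Fin 3) (Q : MvPolynomial (Fin 3) ℂ) :
    euler j (euler k Q) = euler k (euler j Q) := by
  ext d
  simp only [coeff_euler]
  ring

theorem euler_X (j k : Fin 3) :
    euler j (MvPolynomial.X k) = if j = k then MvPolynomial.X k else 0 := by
  rw [euler, Derivation.smul_apply, smul_eq_mul, MvPolynomial.pderiv_X]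
  split_ifs with h
  · subst h; simp
  · simp [Ne.symm h]

/-- The action of `diag h` on `e^{l ω₁ + m ω₂ + n ω₃} Q`, where `Q` is a polynomial in the negative
simple roots. -/
def torusOp (l m n : ℕ) (h : Fin 4 → ℂ) (Q : MvPolynomial (Fin 3) ℂ) : MvPolynomial (Fin 3) ℂ :=
  MvPolynomial.C (l * h 0 + m * (h 0 + h 1) + n * (h 0 + h 1 + h 2)) * Q +
    ∑ k : Fin 3, MvPolynomial.C (h k.succ - h k.castSucc) * euler k Q

section Trace

variable {ι : Type*} [Fintype ι] [DecidableEq ι] {R : SL4 →* Matrix ι ι ℂ}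
  {P : ι → ι → MvPolynomial (Fin 4 × Fin 4) ℂ} {l m n : ℕ}

/-- If `tr (R (diag x) M)` is `e^λ Q`, then `tr (R (diag x) D(diag h) M)` is its derivative in the
direction `diag h`. -/
theorem trace_differential_diagonal (hR : HasPolynomialEntries R P) (M : Matrix ι ι ℂ)
    (Q : MvPolynomial (Fin 3) ℂ)
    (hQ : ∀ (x : Fin 4 → ℂ) (hx : ∏ i, x i = 1), Matrix.trace (R (diagSL x hx) * M) =
      torusWeight l m n x * MvPolynomial.eval (rootCoord x) Q)
    (h : Fin 4 → ℂ) (hh : ∑ i, h i = 0) (x : Fin 4 → ℂ) (hx : ∏ i, x i = 1) :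
    Matrix.trace (R (diagSL x hx) * (differential P (Matrix.diagonal h) * M)) =
      torusWeight l m n x * MvPolynomial.eval (rootCoord x) (torusOp l m n h Q) := by
  have hx0 := prod_eq_one_ne_zero hx
  -- differentiate the trace along the one-parameter subgroup of `diag h` in two ways
  have h1 : HasDerivAt (fun s => Matrix.trace (R (diagSL x hx) * R (expDiag h hh s) * M))
      (Matrix.trace (R (diagSL x hx) * differential P (Matrix.diagonal h) * M)) 0 := by
    simp only [Matrix.trace, Matrix.diag_apply]
    exact HasDerivAt.fun_sum fun i _ => (isTangent_expDiag h hh).hasDerivAt_mul_rep_mul hR _ _ i i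
  have hprod : ∀ s : ℂ, ∏ i, (x i * Complex.exp (s * h i)) = 1 := fun s => by
    rw [Finset.prod_mul_distrib, hx, one_mul, ← Complex.exp_sum, ← Finset.mul_sum, hh, mul_zero,
      Complex.exp_zero]
  have hcurve : ∀ s : ℂ, diagSL x hx * expDiag h hh s =
      diagSL (fun i => x i * Complex.exp (s * h i)) (hprod s) := by
    intro s
    refine Subtype.ext ?_
    exact Matrix.diagonal_mul_diagonal _ _
  set w : ℂ := l * h 0 + m * (h 0 + h 1) + n * (h 0 + h 1 + h 2) with hw
  have hweight : ∀ s : ℂ, torusWeight l m n (fun i => x i * Complex.exp (s * h i)) =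
      torusWeight l m n x * Complex.exp (s * w) := by
    intro s
    have e : Complex.exp (s * w) = Complex.exp (s * h 0) ^ l *
        (Complex.exp (s * h 0) * Complex.exp (s * h 1)) ^ m *
        (Complex.exp (s * h 0) * Complex.exp (s * h 1) * Complex.exp (s * h 2)) ^ n := by
      simp only [← Complex.exp_add, ← Complex.exp_nat_mul]
      congr 1
      rw [hw]
      ring
    rw [e]
    simp only [torusWeight, mul_pow]
    ring
  have hroot : ∀ (s : ℂ) (k : Fin 3), rootCoord (fun i => x i * Complex.exp (s * h i)) k =
      rootCoord x k * Complex.exp (s * (h k.succ - h k.castSucc)) := by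
    intro s k
    rw [mul_sub, Complex.exp_sub]
    fin_cases k <;> simp [rootCoord, div_mul_div_comm]
  have hc : ∀ k : Fin 3, HasDerivAt (fun s => rootCoord (fun i => x i * Complex.exp (s * h i)) k)
      ((h k.succ - h k.castSucc) * rootCoord x k) 0 := by
    intro k
    simp only [hroot]
    refine (((hasDerivAt_id (0 : ℂ)).mul_const _).cexp.const_mul _).congr_deriv ?_
    simp [mul_comm]
  have h0 : (fun i => x i * Complex.exp (0 * h i)) = x := by funext i; simp
  have h2 : HasDerivAt (fun s => Matrix.trace (R (diagSL x hx) * R (expDiag h hh s) * M))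
      (torusWeight l m n x * MvPolynomial.eval (rootCoord x) (torusOp l m n h Q)) 0 := by
    simp only [← map_mul, hcurve, hQ, hweight]
    have hd := ((((hasDerivAt_id (0 : ℂ)).mul_const w).cexp.const_mul (torusWeight l m n x)).mul
      (hasDerivAt_eval Q hc))
    clear_value w
    refine hd.congr_deriv ?_
    rw [h0, torusOp, ← hw]
    simp only [id_eq, zero_mul, Complex.exp_zero, one_mul, mul_one, map_add, map_mul,
      MvPolynomial.eval_C, map_sum]
    rw [mul_add]
    congr 1
    · ring
    · congr 1
      refine Finset.sum_congr rfl fun k _ => ?_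
      rw [euler, Derivation.smul_apply, smul_eq_mul, map_mul, MvPolynomial.eval_X]
      ring
  rw [← mul_assoc]
  exact h1.unique h2

end Trace

/-- The product of `1 - e^{-α}` over the positive roots, in the negative simple roots. -/
def weylDenom : MvPolynomial (Fin 3) ℂ :=
  let X := fun i : Fin 3 => (MvPolynomial.X i : MvPolynomial (Fin 3) ℂ)
  (1 - X 0) * (1 - X 1) * (1 - X 2) * (1 - X 0 * X 1) * (1 - X 1 * X 2) * (1 - X 0 * X 1 * X 2)

/-- The Laplacian of the weight lattice, conjugated by `e^{λ + ρ}` and shifted by a constant. -/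
def laplacian (l m n : ℕ) (F : MvPolynomial (Fin 3) ℂ) : MvPolynomial (Fin 3) ℂ :=
  euler 0 (euler 0 F) + euler 1 (euler 1 F) + euler 2 (euler 2 F) - euler 0 (euler 1 F)
    - euler 1 (euler 2 F) - (MvPolynomial.C (l : ℂ) + 1) * euler 0 F
    - (MvPolynomial.C (m : ℂ) + 1) * euler 1 F - (MvPolynomial.C (n : ℂ) + 1) * euler 2 F

/-- The radial part of the Casimir operator minus the scalar `c`, with denominators cleared. -/
def radialOp (l m n : ℕ) (c : ℂ) (Q : MvPolynomial (Fin 3) ℂ) : MvPolynomial (Fin 3) ℂ :=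
  let X := fun i : Fin 3 => (MvPolynomial.X i : MvPolynomial (Fin 3) ℂ)
  let S := fun i j : Fin 4 => torusOp l m n (fun k => (if k = i then 1 else 0) -
    (if k = j then 1 else 0)) Q
  weylDenom * (∑ i, torusOp l m n (fun k => (if k = i then 1 else 0) - 1 / 4)
      (torusOp l m n (fun k => (if k = i then 1 else 0) - 1 / 4) Q) - MvPolynomial.C c * Q) +
    ((1 + X 0) * ((1 - X 1) * (1 - X 2) * (1 - X 0 * X 1) * (1 - X 1 * X 2)
      * (1 - X 0 * X 1 * X 2)) * S 0 1 +
    (1 + X 0 * X 1) * ((1 - X 0) * (1 - X 1) * (1 - X 2) * (1 - X 1 * X 2)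
      * (1 - X 0 * X 1 * X 2)) * S 0 2 +
    (1 + X 0 * X 1 * X 2) * ((1 - X 0) * (1 - X 1) * (1 - X 2) * (1 - X 0 * X 1)
      * (1 - X 1 * X 2)) * S 0 3 +
    (1 + X 1) * ((1 - X 0) * (1 - X 2) * (1 - X 0 * X 1) * (1 - X 1 * X 2)
      * (1 - X 0 * X 1 * X 2)) * S 1 2 +
    (1 + X 1 * X 2) * ((1 - X 0) * (1 - X 1) * (1 - X 2) * (1 - X 0 * X 1)
      * (1 - X 0 * X 1 * X 2)) * S 1 3 +
    (1 + X 2) * ((1 - X 0) * (1 - X 1) * (1 - X 0 * X 1) * (1 - X 1 * X 2)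
      * (1 - X 0 * X 1 * X 2)) * S 2 3)

section WeylDenom

local notation "X0" => (MvPolynomial.X 0 : MvPolynomial (Fin 3) ℂ)
local notation "X1" => (MvPolynomial.X 1 : MvPolynomial (Fin 3) ℂ)
local notation "X2" => (MvPolynomial.X 2 : MvPolynomial (Fin 3) ℂ)

theorem euler_one_sub (k : Fin 3) (F : MvPolynomial (Fin 3) ℂ) :
    euler k (1 - F) = -euler k F := by
  rw [map_sub, Derivation.map_one_eq_zero, zero_sub]

theorem euler_mul (k : Fin 3) (F G : MvPolynomial (Fin 3) ℂ) :
    euler k (F * G) = F * euler k G + G * euler k F := by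
  rw [Derivation.leibniz, smul_eq_mul, smul_eq_mul]

theorem euler_zero_weylDenom : euler 0 weylDenom =
    -(X0 * ((1 - X1) * (1 - X2) * (1 - X0 * X1) * (1 - X1 * X2) * (1 - X0 * X1 * X2))
    + X0 * X1 * ((1 - X0) * (1 - X1) * (1 - X2) * (1 - X1 * X2) * (1 - X0 * X1 * X2))
    + X0 * X1 * X2 * ((1 - X0) * (1 - X1) * (1 - X2) * (1 - X0 * X1) * (1 - X1 * X2))) := by
  simp only [weylDenom, euler_mul, euler_one_sub, euler_X]
  simp
  ring

theorem euler_one_weylDenom : euler 1 weylDenom =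
    -(X1 * ((1 - X0) * (1 - X2) * (1 - X0 * X1) * (1 - X1 * X2) * (1 - X0 * X1 * X2))
    + X0 * X1 * ((1 - X0) * (1 - X1) * (1 - X2) * (1 - X1 * X2) * (1 - X0 * X1 * X2))
    + X1 * X2 * ((1 - X0) * (1 - X1) * (1 - X2) * (1 - X0 * X1) * (1 - X0 * X1 * X2))
    + X0 * X1 * X2 * ((1 - X0) * (1 - X1) * (1 - X2) * (1 - X0 * X1) * (1 - X1 * X2))) := by
  simp only [weylDenom, euler_mul, euler_one_sub, euler_X]
  simp
  ring

theorem euler_two_weylDenom : euler 2 weylDenom =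
    -(X2 * ((1 - X0) * (1 - X1) * (1 - X0 * X1) * (1 - X1 * X2) * (1 - X0 * X1 * X2))
    + X1 * X2 * ((1 - X0) * (1 - X1) * (1 - X2) * (1 - X0 * X1) * (1 - X0 * X1 * X2))
    + X0 * X1 * X2 * ((1 - X0) * (1 - X1) * (1 - X2) * (1 - X0 * X1) * (1 - X1 * X2))) := by
  simp only [weylDenom, euler_mul, euler_one_sub, euler_X]
  simp
  ring

/-- The Weyl denominator is harmonic: it is the numerator of the character formula for the trivial
representation. -/
theorem laplacian_weylDenom : laplacian 0 0 0 weylDenom = 0 := by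
  rw [laplacian, euler_zero_weylDenom, euler_one_weylDenom, euler_two_weylDenom]
  simp only [map_neg, map_add, euler_mul, euler_one_sub, euler_X]
  simp
  ring

set_option maxHeartbeats 4000000 in
/-- Multiplication by the Weyl denominator turns the radial part of the Casimir operator into a
Laplacian with constant coefficients. -/
theorem two_mul_laplacian_weylDenom_mul (l m n : ℕ) (c : ℂ) : ∃ κ : ℂ,
    ∀ Q : MvPolynomial (Fin 3) ℂ, 2 * laplacian l m n (weylDenom * Q) =
      radialOp l m n c Q + MvPolynomial.C κ * (weylDenom * Q) := by
  set s : ℂ := (l + 2 * m + 3 * n) / 4 with hs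
  refine ⟨c - ((l + m + n - s) ^ 2 + (m + n - s) ^ 2 + (n - s) ^ 2 + s ^ 2)
    - (3 * l + 4 * m + 3 * n), fun Q => ?_⟩
  -- second order part: the sum of the squares of the four coordinate operators
  have hsq : ∑ i, torusOp l m n (fun k => (if k = i then 1 else 0) - 1 / 4)
      (torusOp l m n (fun k => (if k = i then 1 else 0) - 1 / 4) Q) =
      MvPolynomial.C ((l + m + n - s) ^ 2 + (m + n - s) ^ 2 + (n - s) ^ 2 + s ^ 2) * Q +
      2 * (euler 0 (euler 0 Q) + euler 1 (euler 1 Q) + euler 2 (euler 2 Q) - euler 0 (euler 1 Q)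
        - euler 1 (euler 2 Q) - MvPolynomial.C (l : ℂ) * euler 0 Q
        - MvPolynomial.C (m : ℂ) * euler 1 Q - MvPolynomial.C (n : ℂ) * euler 2 Q) := by
    have hT : ∀ i (F : MvPolynomial (Fin 3) ℂ),
        torusOp l m n (fun k => (if k = i then 1 else 0) - 1 / 4) F =
        MvPolynomial.C ((![l + m + n, m + n, n, 0] : Fin 4 → ℂ) i - s) * F +
          ((![0, euler 0 F, euler 1 F, euler 2 F] : Fin 4 → MvPolynomial (Fin 3) ℂ) i -
          (![euler 0 F, euler 1 F, euler 2 F, 0] : Fin 4 → MvPolynomial (Fin 3) ℂ) i) := by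
      intro i F
      rw [torusOp, Fin.sum_univ_three]
      congr 1
      · congr 2
        fin_cases i <;> simp [hs] <;> ring
      · fin_cases i <;> simp <;> ring
    simp only [hT, Fin.sum_univ_four, Matrix.cons_val, map_add, map_sub, euler_mul,
      map_zero, map_pow, euler_comm 1 0, euler_comm 2 1]
    have hC : ∀ (k : Fin 3) (a : ℂ), euler k (MvPolynomial.C a) = 0 := fun k a =>
      (euler k).map_algebraMap a
    simp only [hC]
    ring
  have hpair : ∀ i j : Fin 4, torusOp l m n (fun k => (if k = i then 1 else 0) -
      (if k = j then 1 else 0)) Q =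
      ((![MvPolynomial.C (l : ℂ) + MvPolynomial.C (m : ℂ) + MvPolynomial.C (n : ℂ),
        MvPolynomial.C (m : ℂ) + MvPolynomial.C (n : ℂ), MvPolynomial.C (n : ℂ), 0] :
        Fin 4 → MvPolynomial (Fin 3) ℂ) i -
      (![MvPolynomial.C (l : ℂ) + MvPolynomial.C (m : ℂ) + MvPolynomial.C (n : ℂ),
        MvPolynomial.C (m : ℂ) + MvPolynomial.C (n : ℂ), MvPolynomial.C (n : ℂ), 0] :
        Fin 4 → MvPolynomial (Fin 3) ℂ) j) * Q +
      ((![0, euler 0 Q, euler 1 Q, euler 2 Q] : Fin 4 → MvPolynomial (Fin 3) ℂ) i -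
      (![euler 0 Q, euler 1 Q, euler 2 Q, 0] : Fin 4 → MvPolynomial (Fin 3) ℂ) i -
      ((![0, euler 0 Q, euler 1 Q, euler 2 Q] : Fin 4 → MvPolynomial (Fin 3) ℂ) j -
      (![euler 0 Q, euler 1 Q, euler 2 Q, 0] : Fin 4 → MvPolynomial (Fin 3) ℂ) j)) := by
    intro i j
    rw [torusOp, Fin.sum_univ_three]
    congr 1
    · congr 1
      fin_cases i <;> fin_cases j <;> simp <;> ring
    · fin_cases i <;> fin_cases j <;> simp <;> ring
  have hW := laplacian_weylDenom
  simp only [laplacian, Nat.cast_zero, map_zero, zero_add, one_mul] at hW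
  simp only [laplacian, euler_mul, map_add]
  rw [radialOp, hsq]
  dsimp only
  rw [hpair 0 1, hpair 0 2, hpair 0 3, hpair 1 2, hpair 1 3, hpair 2 3]
  simp only [Matrix.cons_val]
  generalize euler 0 (euler 0 weylDenom) = w00 at hW ⊢
  generalize euler 1 (euler 1 weylDenom) = w11 at hW ⊢
  generalize euler 2 (euler 2 weylDenom) = w22 at hW ⊢
  generalize euler 0 (euler 1 weylDenom) = w01 at hW ⊢
  generalize euler 1 (euler 2 weylDenom) = w12 at hW ⊢
  rw [euler_zero_weylDenom, euler_one_weylDenom, euler_two_weylDenom] at hW ⊢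
  have hκ : (MvPolynomial.C (3 * l + 4 * m + 3 * n : ℂ) : MvPolynomial (Fin 3) ℂ) =
      3 * MvPolynomial.C (l : ℂ) + 4 * MvPolynomial.C (m : ℂ) + 3 * MvPolynomial.C (n : ℂ) := by
    simp only [map_add, map_mul, map_ofNat]
  rw [weylDenom, map_sub, map_sub, hκ]
  linear_combination (2 * Q) * hW

end WeylDenom

section Radial

variable {ι : Type*} [Fintype ι] [DecidableEq ι] {R : SL4 →* Matrix ι ι ℂ}
  {P : ι → ι → MvPolynomial (Fin 4 × Fin 4) ℂ} {l m n : ℕ}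

theorem exists_rootCoord_eq (r : Fin 3 → ℂ) (hr : ∀ k, r k ≠ 0) :
    ∃ x : Fin 4 → ℂ, ∏ i, x i = 1 ∧ rootCoord x = r := by
  obtain ⟨z, hz⟩ := IsAlgClosed.exists_pow_nat_eq (r 0 ^ 3 * r 1 ^ 2 * r 2)⁻¹ (n := 4) (by norm_num)
  have h0 := hr 0
  have h1 := hr 1
  have h2 := hr 2
  have hz0 : z ≠ 0 := by
    rintro rfl
    have : (r 0 ^ 3 * r 1 ^ 2 * r 2)⁻¹ ≠ 0 := by positivity
    exact this (by rw [← hz]; norm_num)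
  refine ⟨![z, z * r 0, z * r 0 * r 1, z * r 0 * r 1 * r 2], ?_, ?_⟩
  · simp only [Fin.prod_univ_four, Matrix.cons_val]
    have : z * (z * r 0) * (z * r 0 * r 1) * (z * r 0 * r 1 * r 2) =
        z ^ 4 * (r 0 ^ 3 * r 1 ^ 2 * r 2) := by ring
    rw [this, hz]
    field_simp
  · funext k
    fin_cases k <;> simp [rootCoord] <;> field_simp

theorem torusWeight_ne_zero (l m n : ℕ) {x : Fin 4 → ℂ} (hx : ∏ i, x i = 1) :
    torusWeight l m n x ≠ 0 := by
  have hx0 := prod_eq_one_ne_zero hx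
  have h0 := hx0 0
  have h1 := hx0 1
  have h2 := hx0 2
  exact mul_ne_zero (mul_ne_zero (pow_ne_zero _ h0) (pow_ne_zero _ (mul_ne_zero h0 h1)))
    (pow_ne_zero _ (mul_ne_zero (mul_ne_zero h0 h1) h2))

theorem single_sub_single (i j : Fin 4) :
    (Matrix.single i i 1 - Matrix.single j j 1 : Matrix (Fin 4) (Fin 4) ℂ) =
      Matrix.diagonal fun k => (if k = i then 1 else 0) - (if k = j then 1 else 0) := by
  ext a b
  rw [Matrix.sub_apply, Matrix.diagonal_apply, Matrix.single_apply, Matrix.single_apply]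
  by_cases hab : a = b
  · subst hab
    simp [eq_comm]
  · have h1 : ∀ k, ¬ (k = a ∧ k = b) := fun k h => hab (h.1.symm.trans h.2)
    simp [hab, h1]

/-- The differential equation of the character, as an identity of polynomials: it holds at all
regular points of the torus. -/
theorem radialOp_eq_zero (hR : HasPolynomialEntries R P) {c : ℂ} (hc : casimir P = c • 1)
    {Q : MvPolynomial (Fin 3) ℂ}
    (hQ : ∀ (x : Fin 4 → ℂ) (hx : ∏ i, x i = 1), Matrix.trace (R (diagSL x hx)) =
      torusWeight l m n x * MvPolynomial.eval (rootCoord x) Q) :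
    radialOp l m n c Q = 0 := by
  have hQ1 : ∀ (x : Fin 4 → ℂ) (hx : ∏ i, x i = 1), Matrix.trace (R (diagSL x hx) * 1) =
      torusWeight l m n x * MvPolynomial.eval (rootCoord x) Q := by
    simpa only [mul_one] using hQ
  have hfirst : ∀ (h : Fin 4 → ℂ), ∑ i, h i = 0 → ∀ (x : Fin 4 → ℂ) (hx : ∏ i, x i = 1),
      Matrix.trace (R (diagSL x hx) * differential P (Matrix.diagonal h)) =
      torusWeight l m n x * MvPolynomial.eval (rootCoord x) (torusOp l m n h Q) := by
    intro h hh x hx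
    simpa only [mul_one] using trace_differential_diagonal hR 1 Q hQ1 h hh x hx
  set X := fun i : Fin 3 => (MvPolynomial.X i : MvPolynomial (Fin 3) ℂ)
  -- the additional factor vanishes at the points that come from no regular element of the torus
  suffices h : radialOp l m n c Q * (X 0 * X 1 * X 2 * weylDenom) = 0 by
    refine (mul_eq_zero.1 h).resolve_right fun h0 => ?_
    have := congrArg (MvPolynomial.eval (fun _ => (2 : ℂ))) h0
    simp only [X, weylDenom, map_mul, map_sub, map_one, MvPolynomial.eval_X, map_zero] at this
    norm_num at this
  refine MvPolynomial.funext fun r => ?_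
  rw [map_zero, map_mul]
  by_contra hne
  have hE := left_ne_zero_of_mul hne
  have hr := right_ne_zero_of_mul hne
  simp only [X, weylDenom, map_mul, map_sub, map_one, MvPolynomial.eval_X, mul_ne_zero_iff] at hr
  obtain ⟨⟨⟨r0, r1⟩, r2⟩, ⟨⟨⟨⟨d0, d1⟩, d2⟩, d01⟩, d12⟩, d012⟩ := hr
  obtain ⟨x, hx, rfl⟩ := exists_rootCoord_eq r (by intro k; fin_cases k <;> assumption)
  have hx0 := prod_eq_one_ne_zero hx
  have x0 := hx0 0
  have x1 := hx0 1
  have x2 := hx0 2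
  have x3 := hx0 3
  have e0 : rootCoord x 0 = x 1 / x 0 := rfl
  have e1 : rootCoord x 1 = x 2 / x 1 := rfl
  have e2 : rootCoord x 2 = x 3 / x 2 := rfl
  have e01 : rootCoord x 0 * rootCoord x 1 = x 2 / x 0 := by rw [e0, e1]; field_simp
  have e12 : rootCoord x 1 * rootCoord x 2 = x 3 / x 1 := by rw [e1, e2]; field_simp
  have e012 : rootCoord x 0 * rootCoord x 1 * rootCoord x 2 = x 3 / x 0 := by
    rw [e0, e1, e2]; field_simp
  have hfrac : ∀ i j, x i ≠ 0 → x i ≠ x j →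
      (x i + x j) / (x i - x j) = (1 + x j / x i) / (1 - x j / x i) := by
    intro i j hi hij
    have h1 : x i - x j ≠ 0 := sub_ne_zero.2 hij
    have h2 : 1 - x j / x i ≠ 0 := by
      rw [one_sub_div hi]
      exact div_ne_zero h1 hi
    field_simp
  have hd : ∀ i j, x i ≠ 0 → 1 - x j / x i ≠ 0 → x i ≠ x j := by
    intro i j hi h hij
    rw [← hij, div_self hi, sub_self] at h
    exact h rfl
  have n01 := hd 0 1 x0 (e0 ▸ d0)
  have n12 := hd 1 2 x1 (e1 ▸ d1)
  have n23 := hd 2 3 x2 (e2 ▸ d2)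
  have n02 := hd 0 2 x0 (e01 ▸ d01)
  have n13 := hd 1 3 x1 (e12 ▸ d12)
  have n03 := hd 0 3 x0 (e012 ▸ d012)
  have hinj : Function.Injective x := by
    intro i j hij
    fin_cases i <;> fin_cases j <;> first | rfl | (exfalso; simp_all)
  have hcas := casimir_radial hR hc x hx hinj
  simp only [single_sub_single, tracelessUnit_self] at hcas
  rw [hQ x hx] at hcas
  have hsum : ∀ i j : Fin 4, ∑ k, ((if k = i then (1 : ℂ) else 0) - (if k = j then 1 else 0)) = 0 :=
    fun i j => by simp
  have hpair := fun i j => hfirst _ (hsum i j) x hx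
  have hsq := fun i => trace_differential_diagonal hR _ _
    (hfirst _ (sum_tracelessUnit_exponent i)) _ (sum_tracelessUnit_exponent i) x hx
  simp only [hpair, hsq] at hcas
  rw [hfrac 0 1 x0 n01, hfrac 0 2 x0 n02, hfrac 0 3 x0 n03, hfrac 1 2 x1 n12, hfrac 1 3 x1 n13,
    hfrac 2 3 x2 n23, ← e0, ← e1, ← e2, ← e01, ← e12, ← e012, ← Finset.mul_sum, ← map_sum] at hcas
  refine hE ?_
  simp only [radialOp, weylDenom, map_add, map_mul, map_sub, map_one, MvPolynomial.eval_X,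
    MvPolynomial.eval_C]
  generalize MvPolynomial.eval (rootCoord x) (∑ i : Fin 4,
    torusOp l m n (fun k => (if k = i then 1 else 0) - 1 / 4)
      (torusOp l m n (fun k => (if k = i then 1 else 0) - 1 / 4) Q)) = A at hcas ⊢
  generalize MvPolynomial.eval (rootCoord x) Q = q at hcas ⊢
  generalize MvPolynomial.eval (rootCoord x) (torusOp l m n (fun k => (if k = 0 then 1 else 0) -
    (if k = 1 then 1 else 0)) Q) = S₁ at hcas ⊢
  generalize MvPolynomial.eval (rootCoord x) (torusOp l m n (fun k => (if k = 0 then 1 else 0) -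
    (if k = 2 then 1 else 0)) Q) = S₂ at hcas ⊢
  generalize MvPolynomial.eval (rootCoord x) (torusOp l m n (fun k => (if k = 0 then 1 else 0) -
    (if k = 3 then 1 else 0)) Q) = S₃ at hcas ⊢
  generalize MvPolynomial.eval (rootCoord x) (torusOp l m n (fun k => (if k = 1 then 1 else 0) -
    (if k = 2 then 1 else 0)) Q) = S₄ at hcas ⊢
  generalize MvPolynomial.eval (rootCoord x) (torusOp l m n (fun k => (if k = 1 then 1 else 0) -
    (if k = 3 then 1 else 0)) Q) = S₅ at hcas ⊢
  generalize MvPolynomial.eval (rootCoord x) (torusOp l m n (fun k => (if k = 2 then 1 else 0) -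
    (if k = 3 then 1 else 0)) Q) = S₆ at hcas ⊢
  clear e0 e1 e2 e01 e12 e012
  have hw := torusWeight_ne_zero l m n hx
  generalize torusWeight l m n x = w at hcas hw
  generalize rootCoord x 0 = a at *
  generalize rootCoord x 1 = b at *
  generalize rootCoord x 2 = d at *
  have hA : A = c * q - ((1 + a) / (1 - a) * S₁ + (1 + a * b) / (1 - a * b) * S₂
      + (1 + a * b * d) / (1 - a * b * d) * S₃ + (1 + b) / (1 - b) * S₄
      + (1 + b * d) / (1 - b * d) * S₅ + (1 + d) / (1 - d) * S₆) := by
    refine mul_left_cancel₀ hw ?_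
    linear_combination hcas
  rw [hA, sub_sub_cancel_left]
  have c₁ : (1 + a) / (1 - a) * (1 - a) = 1 + a := div_mul_cancel₀ _ d0
  have c₂ : (1 + a * b) / (1 - a * b) * (1 - a * b) = 1 + a * b := div_mul_cancel₀ _ d01
  have c₃ : (1 + a * b * d) / (1 - a * b * d) * (1 - a * b * d) = 1 + a * b * d :=
    div_mul_cancel₀ _ d012
  have c₄ : (1 + b) / (1 - b) * (1 - b) = 1 + b := div_mul_cancel₀ _ d1
  have c₅ : (1 + b * d) / (1 - b * d) * (1 - b * d) = 1 + b * d := div_mul_cancel₀ _ d12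
  have c₆ : (1 + d) / (1 - d) * (1 - d) = 1 + d := div_mul_cancel₀ _ d2
  generalize (1 + a) / (1 - a) = f₁ at *
  generalize (1 + a * b) / (1 - a * b) = f₂ at *
  generalize (1 + a * b * d) / (1 - a * b * d) = f₃ at *
  generalize (1 + b) / (1 - b) = f₄ at *
  generalize (1 + b * d) / (1 - b * d) = f₅ at *
  generalize (1 + d) / (1 - d) = f₆ at *
  linear_combination
    -((1 - b) * (1 - d) * (1 - a * b) * (1 - b * d) * (1 - a * b * d)) * S₁ * c₁
    - ((1 - a) * (1 - b) * (1 - d) * (1 - b * d) * (1 - a * b * d)) * S₂ * c₂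
    - ((1 - a) * (1 - b) * (1 - d) * (1 - a * b) * (1 - b * d)) * S₃ * c₃
    - ((1 - a) * (1 - d) * (1 - a * b) * (1 - b * d) * (1 - a * b * d)) * S₄ * c₄
    - ((1 - a) * (1 - b) * (1 - d) * (1 - a * b) * (1 - a * b * d)) * S₅ * c₅
    - ((1 - a) * (1 - b) * (1 - a * b) * (1 - b * d) * (1 - a * b * d)) * S₆ * c₆

end Radial

/-! ### The harmonic numerator of an irreducible character -/

section Harmonic

variable {V : Type*} [AddCommGroup V] [Module ℂ V] {ρ : Representation ℂ SL4 V} {l m n : ℕ}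

/-- The matrix representation of a representation in a basis. -/
def matrixRep {ι : Type*} [Fintype ι] [DecidableEq ι] (ρ : Representation ℂ SL4 V)
    (b : Module.Basis ι ℂ V) : SL4 →* Matrix ι ι ℂ :=
  (LinearMap.toMatrixAlgEquiv b : Module.End ℂ V →* Matrix ι ι ℂ).comp ρ

theorem IsRational.exists_hasPolynomialEntries {ι : Type*} [Fintype ι] [DecidableEq ι]
    (h : IsRational ρ) (b : Module.Basis ι ℂ V) :
    ∃ P, HasPolynomialEntries (matrixRep ρ b) P := by
  choose P hP using fun k l => h (b.coord k) (b l)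
  refine ⟨P, fun g k l => ?_⟩
  rw [← hP, matrixRep]
  exact LinearMap.toMatrixAlgEquiv_apply b (ρ g) k l

theorem IsRational.isRegularClassFunction_character [FiniteDimensional ℂ V] (h : IsRational ρ) :
    IsRegularClassFunction ρ.character := by
  obtain ⟨P, hP⟩ := h.exists_hasPolynomialEntries (Module.finBasis ℂ V)
  refine ⟨⟨∑ k, P k k, fun g => ?_⟩, fun g h => Representation.char_conj ρ g h⟩
  rw [Representation.character, LinearMap.trace_eq_matrix_trace ℂ (Module.finBasis ℂ V), map_sum]
  exact Finset.sum_congr rfl fun k _ => hP g k k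

theorem trace_matrixRep {ι : Type*} [Fintype ι] [DecidableEq ι] (b : Module.Basis ι ℂ V)
    (g : SL4) : Matrix.trace (matrixRep ρ b g) = ρ.character g :=
  (LinearMap.trace_eq_matrix_trace ℂ b _).symm

/-- Schur's lemma in matrix form. -/
theorem exists_eq_smul_one_of_commute {ι : Type*} [Fintype ι] [DecidableEq ι]
    [FiniteDimensional ℂ V] (h : ρ.IsIrreducible) (b : Module.Basis ι ℂ V) (M : Matrix ι ι ℂ)
    (hM : ∀ g, matrixRep ρ b g * M = M * matrixRep ρ b g) : ∃ c : ℂ, M = c • 1 := by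
  set T := (LinearMap.toMatrixAlgEquiv b).symm M with hT
  have hcomm : ∀ g v, T (ρ g v) = ρ g (T v) := by
    intro g v
    have h1 : T * ρ g = ρ g * T := by
      apply (LinearMap.toMatrixAlgEquiv b).injective
      rw [map_mul, map_mul, hT, AlgEquiv.apply_symm_apply]
      exact (hM g).symm
    exact LinearMap.congr_fun h1 v
  have hschur := Representation.IsIrreducible.algebraMap_intertwiningMap_bijective_of_isAlgClosed
    (ρ := ρ)
  obtain ⟨c, hc⟩ := hschur.2 (LinearMap.intertwiningMap_of_isIntertwiningMap ρ ρ T hcomm)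
  have h2 : T = c • 1 := by
    ext v
    exact (congrArg (fun f : Representation.IntertwiningMap ρ ρ => f.toLinearMap v) hc).symm
  refine ⟨c, ?_⟩
  rw [← (LinearMap.toMatrixAlgEquiv b).apply_symm_apply M, ← hT, h2, map_smul, map_one]

/-- Monomials are eigenvectors of the Laplacian. -/
theorem coeff_laplacian (F : MvPolynomial (Fin 3) ℂ) (d : Fin 3 →₀ ℕ) :
    (laplacian l m n F).coeff d = ((d 0 : ℂ) ^ 2 + d 1 ^ 2 + d 2 ^ 2 - d 0 * d 1 - d 1 * d 2
      - (l + 1) * d 0 - (m + 1) * d 1 - (n + 1) * d 2) * F.coeff d := by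
  have h : ∀ (a : ℕ) (k : Fin 3), (MvPolynomial.C (a : ℂ) + 1) * euler k F =
      MvPolynomial.C ((a : ℂ) + 1) * euler k F := fun a k => by rw [map_add, map_one]
  simp only [laplacian, h, MvPolynomial.coeff_add, MvPolynomial.coeff_sub, MvPolynomial.coeff_C_mul,
    coeff_euler]
  ring

/-- The point `λ + ρ - α`, where `λ = l ω₁ + m ω₂ + n ω₃` and `α = ∑ dₖ αₖ`, has the same length as
`λ + ρ`. -/
def OnSphere (l m n : ℕ) (d : Fin 3 →₀ ℕ) : Prop :=
  (d 0 : ℤ) ^ 2 + d 1 ^ 2 + d 2 ^ 2 - d 0 * d 1 - d 1 * d 2 =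
    (l + 1) * d 0 + (m + 1) * d 1 + (n + 1) * d 2

/-- The product of an irreducible character with the Weyl denominator is supported on a sphere:
this is the differential equation of the character. -/
theorem exists_harmonic_numerator (h : IsIrrepOfHighestWeight ρ l m n) :
    ∃ F : MvPolynomial (Fin 3) ℂ, F.coeff 0 = 1 ∧ (∀ d ∈ F.support, OnSphere l m n d) ∧
      ∀ (x : Fin 4 → ℂ) (hx : ∏ i, x i = 1), ρ.character (diagSL x hx) *
        MvPolynomial.eval (rootCoord x) weylDenom =
          torusWeight l m n x * MvPolynomial.eval (rootCoord x) F := by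
  have := h.finite
  obtain ⟨Q, hQ0, hQ⟩ := exists_character_polynomial h
  obtain ⟨P, hP⟩ := h.rational.exists_hasPolynomialEntries (Module.finBasis ℂ V)
  obtain ⟨c, hc⟩ := exists_eq_smul_one_of_commute h.irreducible (Module.finBasis ℂ V) (casimir P)
    (rep_mul_casimir hP)
  have hrad := radialOp_eq_zero hP hc (Q := Q) fun x hx => by rw [trace_matrixRep, hQ]
  obtain ⟨κ, hκ⟩ := two_mul_laplacian_weylDenom_mul l m n c
  have hcoeff : ∀ d, 2 * ((laplacian l m n (weylDenom * Q)).coeff d) =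
      κ * (weylDenom * Q).coeff d := by
    intro d
    have h1 := congrArg (MvPolynomial.coeff d) (hκ Q)
    rw [hrad, zero_add, MvPolynomial.coeff_C_mul] at h1
    rw [← h1, show (2 : MvPolynomial (Fin 3) ℂ) = MvPolynomial.C 2 from (map_ofNat _ 2).symm,
      MvPolynomial.coeff_C_mul]
  have h0 : (weylDenom * Q).coeff 0 = 1 := by
    rw [MvPolynomial.eval_zero] at hQ0
    rw [← MvPolynomial.constantCoeff_eq, map_mul, hQ0]
    simp [weylDenom]
  -- the constant term determines the eigenvalue of the Laplacian
  have hκ0 : κ = 0 := by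
    have h1 := hcoeff 0
    rw [coeff_laplacian, h0] at h1
    simpa using h1.symm
  refine ⟨weylDenom * Q, h0, fun d hd => ?_, fun x hx => ?_⟩
  · have h1 := hcoeff d
    rw [hκ0, zero_mul, coeff_laplacian] at h1
    have h2 := (mul_eq_zero.1 ((mul_eq_zero.1 h1).resolve_left two_ne_zero)).resolve_right
      (MvPolynomial.mem_support_iff.1 hd)
    have h3 : (d 0 : ℂ) ^ 2 + d 1 ^ 2 + d 2 ^ 2 - d 0 * d 1 - d 1 * d 2 =
      (l + 1) * d 0 + (m + 1) * d 1 + (n + 1) * d 2 := by linear_combination h2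
    unfold OnSphere
    exact_mod_cast h3
  · rw [hQ, map_mul]
    ring

end Harmonic

/-- A class function is invariant under transpositions of the diagonal entries. -/
theorem IsRegularClassFunction.apply_swap {f : SL4 → ℂ} (hf : IsRegularClassFunction f)
    (x : Fin 4 → ℂ) (hx : ∏ i, x i = 1) (i j : Fin 4) (hij : i ≠ j)
    (hx' : ∏ k, (x ∘ Equiv.swap i j) k = 1) :
    f (diagSL (x ∘ Equiv.swap i j) hx') = f (diagSL x hx) := by
  set s : Fin 4 → ℂ := fun k => if k = i then -1 else 1 with hs
  -- a signed permutation matrix of determinant one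
  let g : SL4 := ⟨Matrix.diagonal s * (Equiv.swap i j).permMatrix ℂ, by
    rw [Matrix.det_mul, Matrix.det_diagonal, Matrix.det_permutation, Equiv.Perm.sign_swap hij]
    simp [hs, Finset.prod_ite_eq']⟩
  rw [← hf.conj (diagSL x hx) g]
  congr 1
  rw [eq_mul_inv_iff_mul_eq]
  apply Subtype.ext
  change Matrix.diagonal (x ∘ Equiv.swap i j) *
      (Matrix.diagonal s * (Equiv.swap i j).permMatrix ℂ) =
    Matrix.diagonal s * (Equiv.swap i j).permMatrix ℂ * Matrix.diagonal x
  ext a b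
  rw [Matrix.diagonal_mul, Matrix.diagonal_mul, Matrix.mul_diagonal, Matrix.diagonal_mul]
  simp only [Equiv.Perm.permMatrix, PEquiv.toMatrix_apply, Equiv.toPEquiv_apply, Option.mem_def,
    Option.some.injEq, Function.comp]
  split_ifs with h
  · rw [h]; ring
  · ring

/-! ### Skew polynomials on a sphere -/

section Skew

/-- The effect of the `k`-th simple reflection on the values of the negative simple roots. -/
def reflectRoot (k : Fin 3) (r : Fin 3 → ℂ) : Fin 3 → ℂ :=
  ![![(r 0)⁻¹, r 0 * r 1, r 2], ![r 0 * r 1, (r 1)⁻¹, r 1 * r 2], ![r 0, r 1 * r 2, (r 2)⁻¹]] k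

/-- The sum of the coordinates of `d` at the neighbours of `k` in the Dynkin diagram. -/
def neighbourSum (k : Fin 3) (d : Fin 3 →₀ ℕ) : ℕ :=
  ![d 1, d 0 + d 2, d 1] k

/-- `F` is skew under the simple reflections, in the sense that `e^μ F` is, where `L k` is the value
of the weight `μ` at the `k`-th simple coroot. -/
def IsSkew (L : Fin 3 → ℕ) (F : MvPolynomial (Fin 3) ℂ) : Prop :=
  ∀ (k : Fin 3) (r : Fin 3 → ℂ), (∀ j, r j ≠ 0) →
    r k ^ L k * MvPolynomial.eval (reflectRoot k r) F = -MvPolynomial.eval r F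

theorem neighbourSum_congr {k : Fin 3} {d e : Fin 3 →₀ ℕ} (h : ∀ j, j ≠ k → d j = e j) :
    neighbourSum k d = neighbourSum k e := by
  fin_cases k <;> simp [neighbourSum, h]

theorem eval_reflectRoot_monomial (k : Fin 3) (r : Fin 3 → ℂ) (hr : ∀ j, r j ≠ 0) (N : ℕ)
    (d : Fin 3 →₀ ℕ) (hd : d k ≤ N) (c : ℂ) :
    r k ^ N * MvPolynomial.eval (reflectRoot k r) (MvPolynomial.monomial d c) =
      MvPolynomial.eval r
        (MvPolynomial.monomial (d.update k (N - d k + neighbourSum k d)) c) := by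
  obtain ⟨M, rfl⟩ := Nat.exists_eq_add_of_le hd
  have h0 := hr 0
  have h1 := hr 1
  have h2 := hr 2
  rw [MvPolynomial.eval_monomial, MvPolynomial.eval_monomial,
    Finsupp.prod_fintype _ _ fun _ => pow_zero _, Finsupp.prod_fintype _ _ fun _ => pow_zero _,
    Fin.prod_univ_three, Fin.prod_univ_three, Nat.add_sub_cancel_left]
  fin_cases k <;> simp [reflectRoot, neighbourSum, mul_pow, pow_add] <;> field_simp

/-- The coefficients of a skew polynomial change sign under the simple reflections of the exponents;
in particular, a reflection does not lead from the support to negative exponents. -/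
theorem IsSkew.exists_coeff_eq_neg {L : Fin 3 → ℕ} {F : MvPolynomial (Fin 3) ℂ} (hF : IsSkew L F)
    (k : Fin 3) {e : Fin 3 →₀ ℕ} (he : e ∈ F.support) :
    ∃ e' : Fin 3 →₀ ℕ, F.coeff e' = -F.coeff e ∧ e' k + e k = L k + neighbourSum k e ∧
      ∀ j, j ≠ k → e' j = e j := by
  set N := F.degreeOf k with hN
  have hle : ∀ d ∈ F.support, d k ≤ N := fun d hd => MvPolynomial.monomial_le_degreeOf k hd
  set s : (Fin 3 →₀ ℕ) → (Fin 3 →₀ ℕ) := fun d =>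
    d.update k (N + L k - d k + neighbourSum k d) with hs
  set G := ∑ d ∈ F.support, MvPolynomial.monomial (s d) (F.coeff d) with hG
  have hinj : ∀ d ∈ F.support, s d = s e → d = e := by
    intro d hd h
    have hj : ∀ j, j ≠ k → d j = e j := fun j hj => by
      have := DFunLike.congr_fun h j
      simpa [hs, Finsupp.update_apply, hj] using this
    have hk := DFunLike.congr_fun h k
    simp only [hs, Finsupp.update_apply, if_pos, neighbourSum_congr hj] at hk
    have h1 := hle d hd
    have h2 := hle e he
    ext j
    by_cases hjk : j = k
    · subst hjk; omega
    · exact hj j hjk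
  -- `G` is the reflected polynomial, multiplied by a power of the `k`-th variable
  have hGF : G = -(MvPolynomial.monomial (Finsupp.single k N) 1 * F) := by
    rw [← add_eq_zero_iff_eq_neg]
    set X := fun i : Fin 3 => (MvPolynomial.X i : MvPolynomial (Fin 3) ℂ)
    suffices h : (G + MvPolynomial.monomial (Finsupp.single k N) 1 * F) * ∏ i, X i = 0 from
      (mul_eq_zero.1 h).resolve_right
        (Finset.prod_ne_zero_iff.2 fun i _ => MvPolynomial.X_ne_zero i)
    refine MvPolynomial.funext fun r => ?_
    rw [map_zero, map_mul, map_prod]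
    simp only [X, MvPolynomial.eval_X]
    by_cases hr : ∀ j, r j ≠ 0
    · have hGr : MvPolynomial.eval r G =
          r k ^ (N + L k) * MvPolynomial.eval (reflectRoot k r) F := by
        conv_rhs => rw [F.as_sum]
        rw [hG, map_sum, map_sum, Finset.mul_sum]
        refine Finset.sum_congr rfl fun d hd => ?_
        rw [eval_reflectRoot_monomial k r hr _ d ((hle d hd).trans (Nat.le_add_right _ _))]
      rw [map_add, hGr, map_mul, MvPolynomial.eval_monomial,
        Finsupp.prod_single_index (h := fun n e => r n ^ e) (pow_zero _), pow_add, mul_assoc,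
        hF k r hr]
      ring
    · push Not at hr
      obtain ⟨j, hj⟩ := hr
      rw [Finset.prod_eq_zero (Finset.mem_univ j) hj, mul_zero]
  have h1 : G.coeff (s e) = F.coeff e := by
    rw [hG, MvPolynomial.coeff_sum, Finset.sum_eq_single_of_mem e he]
    · rw [MvPolynomial.coeff_monomial, if_pos rfl]
    · intro d hd hde
      rw [MvPolynomial.coeff_monomial, if_neg fun h => hde (hinj d hd h)]
  rw [hGF, MvPolynomial.coeff_neg, MvPolynomial.coeff_monomial_mul'] at h1
  have hne := MvPolynomial.mem_support_iff.1 he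
  split_ifs at h1 with h2
  · refine ⟨s e - Finsupp.single k N, by rw [← h1, one_mul, neg_neg], ?_, fun j hj => ?_⟩
    · have h3 := h2 k
      have h4 := hle e he
      simp only [hs, Finsupp.update_apply, if_pos, Finsupp.single_eq_same,
        Finsupp.tsub_apply] at h3 ⊢
      omega
    · simp [hs, Finsupp.tsub_apply, Finsupp.update_apply, hj]
  · exact absurd (h1.symm.trans neg_zero) hne

/-- A skew polynomial whose support lies on the sphere vanishes if its constant term does: an
exponent `α` of least degree in its support makes `λ + ρ - α` strictly dominant, and then
`|λ + ρ - α| < |λ + ρ|` unless `α = 0`. -/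
theorem IsSkew.eq_zero {l m n : ℕ} {F : MvPolynomial (Fin 3) ℂ}
    (hF : IsSkew ![l + 1, m + 1, n + 1] F) (hS : ∀ d ∈ F.support, OnSphere l m n d)
    (h0 : F.coeff 0 = 0) : F = 0 := by
  by_contra hne
  obtain ⟨e, he, hmin⟩ := Finset.exists_min_image F.support (fun d => d 0 + d 1 + d 2)
    (MvPolynomial.support_nonempty.2 hne)
  -- strict dominance
  have hlt : ∀ k, 2 * e k < ![l + 1, m + 1, n + 1] k + neighbourSum k e := by
    intro k
    obtain ⟨e', hc, hk, hj⟩ := hF.exists_coeff_eq_neg k he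
    have hne' := MvPolynomial.mem_support_iff.1 he
    have he' : e' ∈ F.support := by
      rw [MvPolynomial.mem_support_iff, hc]
      exact neg_ne_zero.2 hne'
    have hle : e k ≤ e' k := by
      have := hmin e' he'
      fin_cases k <;> simp [hj] at this ⊢ <;> omega
    have hne'' : e' k ≠ e k := by
      intro h
      have : e' = e := by
        ext j
        by_cases hjk : j = k
        · rw [hjk, h]
        · exact hj j hjk
      rw [this] at hc
      exact hne' (self_eq_neg.1 hc)
    omega
  have hd := hS e he
  have l0 : 2 * e 0 < l + 1 + e 1 := hlt 0
  have l1 : 2 * e 1 < m + 1 + (e 0 + e 2) := hlt 1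
  have l2 : 2 * e 2 < n + 1 + e 1 := hlt 2
  unfold OnSphere at hd
  zify at l0 l1 l2
  have p0 : (0 : ℤ) ≤ e 0 := Nat.cast_nonneg _
  have p1 : (0 : ℤ) ≤ e 1 := Nat.cast_nonneg _
  have p2 : (0 : ℤ) ≤ e 2 := Nat.cast_nonneg _
  have q0 : (e 0 : ℤ) * (2 * e 0 - (l + 1 + e 1)) ≤ 0 :=
    mul_nonpos_of_nonneg_of_nonpos p0 (by linarith)
  have q1 : (e 1 : ℤ) * (2 * e 1 - (m + 1 + (e 0 + e 2))) ≤ 0 :=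
    mul_nonpos_of_nonneg_of_nonpos p1 (by linarith)
  have q2 : (e 2 : ℤ) * (2 * e 2 - (n + 1 + e 1)) ≤ 0 :=
    mul_nonpos_of_nonneg_of_nonpos p2 (by linarith)
  have r0 : (0 : ℤ) ≤ l * e 0 := by positivity
  have r1 : (0 : ℤ) ≤ m * e 1 := by positivity
  have r2 : (0 : ℤ) ≤ n * e 2 := by positivity
  have hsum : (e 0 : ℤ) + e 1 + e 2 ≤ 0 := by nlinarith
  have : e = 0 := by
    ext j
    fin_cases j <;> simp <;> omega
  rw [this] at he
  exact MvPolynomial.mem_support_iff.1 he h0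

/-- A polynomial is skew if it represents a skew function on the torus. -/
theorem isSkew_of_apply_swap {l m n : ℕ} {F : MvPolynomial (Fin 3) ℂ} {Φ : (Fin 4 → ℂ) → ℂ}
    (hΦ : ∀ x : Fin 4 → ℂ, ∏ i, x i = 1 →
      Φ x = torusWeight l m n x * MvPolynomial.eval (rootCoord x) F)
    (hskew : ∀ (i j : Fin 4), i ≠ j → ∀ x : Fin 4 → ℂ, ∏ i, x i = 1 →
      Φ (x ∘ Equiv.swap i j) = -Φ x) :
    IsSkew ![l, m, n] F := by
  intro k r hr
  obtain ⟨x, hx, rfl⟩ := exists_rootCoord_eq r hr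
  have hx0 := prod_eq_one_ne_zero hx
  have h0 := hx0 0
  have h1 := hx0 1
  have h2 := hx0 2
  have h3 := hx0 3
  have hk : k.castSucc ≠ k.succ := (Fin.castSucc_lt_succ).ne
  have hx' : ∏ i, (x ∘ Equiv.swap k.castSucc k.succ) i = 1 := by
    rw [← hx]
    exact Equiv.prod_comp (Equiv.swap k.castSucc k.succ) x
  have h4 := hskew _ _ hk x hx
  rw [hΦ _ hx', hΦ _ hx] at h4
  have hroot : rootCoord (x ∘ Equiv.swap k.castSucc k.succ) = reflectRoot k (rootCoord x) := by
    funext j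
    fin_cases k <;> fin_cases j <;>
      simp [rootCoord, reflectRoot, Equiv.swap_apply_def] <;> field_simp
  have hw : torusWeight l m n (x ∘ Equiv.swap k.castSucc k.succ) =
      torusWeight l m n x * rootCoord x k ^ (![l, m, n] k) := by
    fin_cases k <;> simp [rootCoord, torusWeight, Equiv.swap_apply_def, mul_pow, div_pow] <;>
      field_simp
  rw [hroot, hw] at h4
  refine mul_left_cancel₀ (torusWeight_ne_zero l m n hx) ?_
  rw [← mul_assoc, h4, mul_neg]

end Skew

/-! ### The Weyl character formula -/

section Weyl

/-- The alternant `det (xᵢ ^ κⱼ)`. -/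
def alternant (κ : Fin 4 → ℤ) (x : Fin 4 → ℂ) : ℂ :=
  (Matrix.of fun i j => x i ^ κ j).det

/-- The weight `l ω₁ + m ω₂ + n ω₃ + ρ`, as a strictly decreasing sequence of natural numbers that
ends with `0`. -/
def strictWeight (l m n : ℕ) : Fin 4 → ℕ :=
  ![l + m + n + 3, m + n + 2, n + 1, 0]

theorem alternant_comp_swap (κ : Fin 4 → ℤ) (x : Fin 4 → ℂ) {i j : Fin 4} (hij : i ≠ j) :
    alternant κ (x ∘ Equiv.swap i j) = -alternant κ x := by
  have h := Matrix.det_permute (Equiv.swap i j) (Matrix.of fun i j => x i ^ κ j)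
  rw [Equiv.Perm.sign_swap hij] at h
  exact h.trans (by simp [alternant])

theorem alternant_strictWeight_zero (x : Fin 4 → ℂ) :
    alternant (fun j => (strictWeight 0 0 0 j : ℤ)) x =
      (x 0 - x 1) * (x 0 - x 2) * (x 0 - x 3) * (x 1 - x 2) * (x 1 - x 3) * (x 2 - x 3) := by
  simp only [alternant, zpow_natCast]
  simp [Matrix.det_succ_row_zero, Fin.sum_univ_succ, strictWeight, Fin.succAbove]
  ring

theorem alternant_strictWeight_zero_ne_zero {x : Fin 4 → ℂ} (hx : Function.Injective x) :
    alternant (fun j => (strictWeight 0 0 0 j : ℤ)) x ≠ 0 := by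
  have h : ∀ i j, i ≠ j → x i - x j ≠ 0 := fun i j hij => sub_ne_zero.2 (hx.ne hij)
  rw [alternant_strictWeight_zero]
  simp only [ne_eq, mul_eq_zero, not_or]
  refine ⟨⟨⟨⟨⟨?_, ?_⟩, ?_⟩, ?_⟩, ?_⟩, ?_⟩ <;> exact h _ _ (by decide)

theorem torusWeight_mul_eval_weylDenom {x : Fin 4 → ℂ} (hx : ∏ i, x i = 1) :
    torusWeight 1 1 1 x * MvPolynomial.eval (rootCoord x) weylDenom =
      alternant (fun j => (strictWeight 0 0 0 j : ℤ)) x := by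
  have hx0 := prod_eq_one_ne_zero hx
  have h0 := hx0 0
  have h1 := hx0 1
  have h2 := hx0 2
  rw [alternant_strictWeight_zero]
  simp [torusWeight, weylDenom, rootCoord]
  field_simp

/-- The exponents, in the negative simple roots, of the terms of the alternant divided by its
leading term: the coordinates of `κ - κ ∘ σ` in the simple roots. The subtractions do not truncate,
since `κ` is decreasing. -/
def weylExponent (l m n : ℕ) (σ : Equiv.Perm (Fin 4)) : Fin 3 →₀ ℕ :=
  let κ := strictWeight l m n
  Finsupp.equivFunOnFinite.symm ![κ 0 - κ (σ 0), κ 0 + κ 1 - (κ (σ 0) + κ (σ 1)), κ (σ 3)]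

/-- The alternant divided by its leading term. -/
def weylNumerator (l m n : ℕ) : MvPolynomial (Fin 3) ℂ :=
  ∑ σ : Equiv.Perm (Fin 4),
    MvPolynomial.monomial (weylExponent l m n σ) ((Equiv.Perm.sign σ : ℤ) : ℂ)

variable (l m n : ℕ)

/-- The coordinates of `κ - κ ∘ σ`, without subtractions. -/
theorem weylExponent_add (σ : Equiv.Perm (Fin 4)) :
    weylExponent l m n σ 0 + strictWeight l m n (σ 0) = l + m + n + 3 ∧
    weylExponent l m n σ 1 + strictWeight l m n (σ 1) = weylExponent l m n σ 0 + (m + n + 2) ∧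
    weylExponent l m n σ 2 + strictWeight l m n (σ 2) = weylExponent l m n σ 1 + (n + 1) ∧
    strictWeight l m n (σ 3) = weylExponent l m n σ 2 := by
  have h0 : ∀ i, strictWeight l m n i ≤ l + m + n + 3 := by
    intro i; fin_cases i <;> simp [strictWeight] <;> omega
  have h1 : ∀ i j, i ≠ j → strictWeight l m n i + strictWeight l m n j ≤
      (l + m + n + 3) + (m + n + 2) := by
    intro i j hij
    fin_cases i <;> fin_cases j <;> first | exact absurd rfl hij | (simp [strictWeight]; try omega)
  have h2 : ∑ i, strictWeight l m n (σ i) = ∑ i, strictWeight l m n i :=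
    Equiv.sum_comp σ (strictWeight l m n)
  rw [Fin.sum_univ_four, Fin.sum_univ_four] at h2
  have h3 := h0 (σ 0)
  have h4 := h1 (σ 0) (σ 1) (σ.injective.ne (by decide))
  have e0 : weylExponent l m n σ 0 = l + m + n + 3 - strictWeight l m n (σ 0) := rfl
  have e1 : weylExponent l m n σ 1 = (l + m + n + 3) + (m + n + 2) -
    (strictWeight l m n (σ 0) + strictWeight l m n (σ 1)) := rfl
  have e2 : weylExponent l m n σ 2 = strictWeight l m n (σ 3) := rfl
  have k0 : strictWeight l m n 0 = l + m + n + 3 := rfl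
  have k1 : strictWeight l m n 1 = m + n + 2 := rfl
  have k2 : strictWeight l m n 2 = n + 1 := rfl
  have k3 : strictWeight l m n 3 = 0 := rfl
  rw [k0, k1, k2, k3] at h2
  rw [e0, e1, e2]
  omega

theorem strictWeight_injective : Function.Injective (strictWeight l m n) := by
  intro i j hij
  fin_cases i <;> fin_cases j <;> first | rfl | (exfalso; simp [strictWeight] at hij; try omega)

theorem onSphere_of_mem_support_weylNumerator (d : Fin 3 →₀ ℕ)
    (hd : d ∈ (weylNumerator l m n).support) : OnSphere l m n d := by
  obtain ⟨σ, -, hσ⟩ := Finset.mem_biUnion.1 (MvPolynomial.support_sum hd)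
  rw [Finset.mem_singleton.1 (MvPolynomial.support_monomial_subset hσ)]
  obtain ⟨h0, h1, h2, h3⟩ := weylExponent_add l m n σ
  -- the weights `κ` and `κ ∘ σ` have the same length
  have hsq : ∑ i, (strictWeight l m n (σ i) : ℤ) ^ 2 = ∑ i, (strictWeight l m n i : ℤ) ^ 2 :=
    Equiv.sum_comp σ fun i => (strictWeight l m n i : ℤ) ^ 2
  rw [Fin.sum_univ_four, Fin.sum_univ_four] at hsq
  have k0 : (strictWeight l m n 0 : ℤ) = l + m + n + 3 := by simp [strictWeight]
  have k1 : (strictWeight l m n 1 : ℤ) = m + n + 2 := by simp [strictWeight]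
  have k2 : (strictWeight l m n 2 : ℤ) = n + 1 := by simp [strictWeight]
  have k3 : (strictWeight l m n 3 : ℤ) = 0 := by simp [strictWeight]
  zify at h0 h1 h2 h3
  rw [k0, k1, k2, k3, eq_sub_of_add_eq' h0, eq_sub_of_add_eq' h1, eq_sub_of_add_eq' h2, h3] at hsq
  unfold OnSphere
  linarith

theorem coeff_zero_weylNumerator : (weylNumerator l m n).coeff 0 = 1 := by
  rw [weylNumerator, MvPolynomial.coeff_sum, Finset.sum_eq_single_of_mem 1 (Finset.mem_univ _)]
  · have h : weylExponent l m n 1 = 0 := by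
      ext j
      fin_cases j <;> simp [weylExponent, strictWeight]
    rw [MvPolynomial.coeff_monomial, if_pos h]
    simp
  · intro σ _ hσ
    rw [MvPolynomial.coeff_monomial, if_neg]
    intro h
    obtain ⟨h0, h1, h2, h3⟩ := weylExponent_add l m n σ
    rw [h] at h0 h1 h2 h3
    refine hσ (Equiv.ext fun i => strictWeight_injective l m n ?_)
    simp only [Finsupp.coe_zero, Pi.zero_apply, zero_add] at h0 h1 h2 h3
    fin_cases i
    · exact h0
    · exact h1
    · exact h2
    · exact h3

theorem torusWeight_mul_eval_weylNumerator {x : Fin 4 → ℂ} (hx : ∏ i, x i = 1) :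
    torusWeight (l + 1) (m + 1) (n + 1) x * MvPolynomial.eval (rootCoord x) (weylNumerator l m n) =
      alternant (fun j => (strictWeight l m n j : ℤ)) x := by
  have hx0 := prod_eq_one_ne_zero hx
  have y0 := hx0 0
  have y1 := hx0 1
  have y2 := hx0 2
  rw [alternant, ← Matrix.det_transpose, Matrix.det_apply', weylNumerator, map_sum, Finset.mul_sum]
  refine Finset.sum_congr rfl fun σ _ => ?_
  obtain ⟨h0, h1, h2, h3⟩ := weylExponent_add l m n σ
  rw [MvPolynomial.eval_monomial, Finsupp.prod_fintype _ _ fun _ => pow_zero _,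
    Fin.prod_univ_three, Fin.prod_univ_four]
  simp only [Matrix.transpose_apply, Matrix.of_apply, zpow_natCast, rootCoord, Matrix.cons_val]
  rw [mul_left_comm]
  congr 1
  generalize weylExponent l m n σ 0 = d0 at *
  generalize weylExponent l m n σ 1 = d1 at *
  generalize weylExponent l m n σ 2 = d2 at *
  have hw : torusWeight (l + 1) (m + 1) (n + 1) x =
      x 0 ^ (l + m + n + 3) * x 1 ^ (m + n + 2) * x 2 ^ (n + 1) := by
    rw [torusWeight]
    ring
  rw [hw, ← h0, h3, div_pow, div_pow, div_pow]
  have e1 : x 1 ^ d0 * x 1 ^ (m + n + 2) = x 1 ^ d1 * x 1 ^ strictWeight l m n (σ 1) := by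
    rw [← pow_add, ← pow_add, h1]
  have e2 : x 2 ^ d1 * x 2 ^ (n + 1) = x 2 ^ d2 * x 2 ^ strictWeight l m n (σ 2) := by
    rw [← pow_add, ← pow_add, h2]
  rw [pow_add (x 0)]
  generalize x 1 ^ (m + n + 2) = p1 at *
  generalize x 2 ^ (n + 1) = p2 at *
  generalize x 1 ^ strictWeight l m n (σ 1) = s1 at *
  generalize x 2 ^ strictWeight l m n (σ 2) = s2 at *
  field_simp
  linear_combination x 3 ^ d2 * x 2 ^ d1 * p2 * e1 + x 3 ^ d2 * x 1 ^ d1 * s1 * e2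

variable {l m n}
variable {V : Type*} [AddCommGroup V] [Module ℂ V] {ρ : Representation ℂ SL4 V}

/-- The Weyl character formula for `SL₄`: the difference between the two possible numerators is
skew, lies on the sphere and has no constant term. -/
theorem character_mul_alternant (h : IsIrrepOfHighestWeight ρ l m n) (x : Fin 4 → ℂ)
    (hx : ∏ i, x i = 1) :
    ρ.character (diagSL x hx) * alternant (fun j => (strictWeight 0 0 0 j : ℤ)) x =
      alternant (fun j => (strictWeight l m n j : ℤ)) x := by
  have := h.finite
  obtain ⟨F, hF0, hFS, hF⟩ := exists_harmonic_numerator h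
  have hF' : ∀ (x : Fin 4 → ℂ) (hx : ∏ i, x i = 1),
      ρ.character (diagSL x hx) * alternant (fun j => (strictWeight 0 0 0 j : ℤ)) x =
        torusWeight (l + 1) (m + 1) (n + 1) x * MvPolynomial.eval (rootCoord x) F := by
    intro x hx
    have hw : torusWeight (l + 1) (m + 1) (n + 1) x =
        torusWeight l m n x * torusWeight 1 1 1 x := by
      simp only [torusWeight]
      ring
    rw [← torusWeight_mul_eval_weylDenom hx, hw]
    linear_combination torusWeight 1 1 1 x * hF x hx
  have hskew : IsSkew ![l + 1, m + 1, n + 1] (F - weylNumerator l m n) := by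
    refine isSkew_of_apply_swap (Φ := fun x =>
      (if hx : ∏ i, x i = 1 then ρ.character (diagSL x hx) else 0) *
        alternant (fun j => (strictWeight 0 0 0 j : ℤ)) x -
      alternant (fun j => (strictWeight l m n j : ℤ)) x) (fun x hx => ?_) fun i j hij x hx => ?_
    · rw [dif_pos hx, hF', ← torusWeight_mul_eval_weylNumerator l m n hx, map_sub, mul_sub]
    · have hx' : ∏ k, (x ∘ Equiv.swap i j) k = 1 := by
        rw [← hx]
        exact Equiv.prod_comp (Equiv.swap i j) x
      simp only [dif_pos hx, dif_pos hx', alternant_comp_swap _ _ hij]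
      rw [h.rational.isRegularClassFunction_character.apply_swap x hx i j hij]
      ring
  have hzero : F - weylNumerator l m n = 0 := by
    refine hskew.eq_zero (fun d hd => ?_) ?_
    · rcases Finset.mem_union.1 (MvPolynomial.support_sub _ _ _ hd) with hd | hd
      · exact hFS d hd
      · exact onSphere_of_mem_support_weylNumerator l m n d hd
    · rw [MvPolynomial.coeff_sub, hF0, coeff_zero_weylNumerator, sub_self]
  rw [hF', sub_eq_zero.1 hzero, torusWeight_mul_eval_weylNumerator l m n hx]

/-- Two irreducible representations of the same highest weight have the same character. -/
theorem IsIrreducibleCharacter.unique {χ₁ χ₂ : SL4 → ℂ} (h₁ : IsIrreducibleCharacter l m n χ₁)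
    (h₂ : IsIrreducibleCharacter l m n χ₂) : χ₁ = χ₂ := by
  obtain ⟨V₁, _, _, ρ₁, hρ₁, rfl⟩ := h₁
  obtain ⟨V₂, _, _, ρ₂, hρ₂, rfl⟩ := h₂
  have := hρ₁.finite
  have := hρ₂.finite
  refine hρ₁.rational.isRegularClassFunction_character.ext
    hρ₂.rational.isRegularClassFunction_character fun x hx hinj => ?_
  refine mul_right_cancel₀ (alternant_strictWeight_zero_ne_zero hinj) ?_
  rw [character_mul_alternant hρ₁, character_mul_alternant hρ₂]

end Weyl

/-! ### Existence of the irreducible representations -/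

section Existence

variable {V : Type} [AddCommGroup V] [Module ℂ V] {ρ : Representation ℂ SL4 V} {l m n : ℕ}

/-- A rational representation generated by a highest weight vector has an irreducible quotient of
the same highest weight, namely that by a maximal invariant subspace not containing the vector. -/
theorem exists_isIrreducibleCharacter_of_span_eq_top [FiniteDimensional ℂ V] (hρ : IsRational ρ)
    {v : V} (hv : IsHighestWeightVector ρ l m n v)
    (hspan : Submodule.span ℂ (Set.range fun g => ρ g v) = ⊤) :
    ∃ χ, IsIrreducibleCharacter l m n χ := by
  obtain ⟨M, ⟨hM, hvM⟩, hmax⟩ := (wellFounded_gt (α := Submodule ℂ V)).has_min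
    {M | (∀ g, M ≤ M.comap (ρ g)) ∧ v ∉ M}
    ⟨⊥, fun g => bot_le, fun h => hv.1 ((Submodule.mem_bot ℂ).1 h)⟩
  let τ := ρ.quotient M hM
  have hτ : ∀ g w, τ g (M.mkQ w) = M.mkQ (ρ g w) := fun g w => rfl
  refine ⟨τ.character, V ⧸ M, inferInstance, inferInstance, τ, ⟨inferInstance, ?_, ?_, ?_⟩, rfl⟩
  · intro φ w
    obtain ⟨w, rfl⟩ := M.mkQ_surjective w
    obtain ⟨P, hP⟩ := hρ (φ ∘ₗ M.mkQ) w
    exact ⟨P, hP⟩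
  · have hne : (⊥ : Subrepresentation τ) ≠ ⊤ := by
      intro h
      have h1 : M.mkQ v ∈ (⊥ : Subrepresentation τ).toSubmodule := by
        rw [h]
        exact Submodule.mem_top
      exact hvM ((Submodule.Quotient.mk_eq_zero M).1 ((Submodule.mem_bot ℂ).1 h1))
    refine @IsSimpleOrder.mk _ _ _ ⟨⟨_, _, hne⟩⟩ fun N => ?_
    have hN : ∀ g, N.toSubmodule.comap M.mkQ ≤ (N.toSubmodule.comap M.mkQ).comap (ρ g) :=
      fun g w hw => N.apply_mem_toSubmodule g hw
    by_cases hvN : v ∈ N.toSubmodule.comap M.mkQ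
    · right
      apply Subrepresentation.toSubmodule_injective
      change N.toSubmodule = ⊤
      have h1 : N.toSubmodule.comap M.mkQ = ⊤ := by
        rw [eq_top_iff, ← hspan, Submodule.span_le]
        rintro _ ⟨g, rfl⟩
        exact hN g hvN
      rw [eq_top_iff]
      intro w _
      obtain ⟨w, rfl⟩ := M.mkQ_surjective w
      have h2 : w ∈ N.toSubmodule.comap M.mkQ := h1 ▸ Submodule.mem_top
      exact h2
    · left
      apply Subrepresentation.toSubmodule_injective
      change N.toSubmodule = ⊥
      have hle : M ≤ N.toSubmodule.comap M.mkQ := fun w hw => by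
        rw [Submodule.mem_comap, Submodule.mkQ_apply, (Submodule.Quotient.mk_eq_zero M).2 hw]
        exact N.toSubmodule.zero_mem
      have heq : M = N.toSubmodule.comap M.mkQ :=
        hle.eq_of_not_lt (hmax _ ⟨hN, hvN⟩)
      rw [eq_bot_iff]
      intro w hw
      obtain ⟨w, rfl⟩ := M.mkQ_surjective w
      have h2 : w ∈ M := by rw [heq]; exact hw
      exact (Submodule.Quotient.mk_eq_zero M).2 h2
  · refine ⟨M.mkQ v, fun h => hvM ((Submodule.Quotient.mk_eq_zero M).1 h), fun b hb => ?_⟩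
    rw [hτ, hv.2 b hb, map_smul]

/-- The action of `SL₄` by right translations on the functions on it. -/
def rightTranslation : Representation ℂ SL4 (SL4 → ℂ) where
  toFun h :=
    { toFun := fun f g => f (g * h)
      map_add' := fun _ _ => rfl
      map_smul' := fun _ _ => rfl }
  map_one' := by
    ext f g
    simp
  map_mul' h h' := by
    ext f g
    simp [mul_assoc]

theorem rightTranslation_apply (h : SL4) (f : SL4 → ℂ) (g : SL4) :
    rightTranslation h f g = f (g * h) := rfl

/-- The translates of a regular function lie in a finite-dimensional space, and their coordinates
are regular functions of the translation. -/
theorem exists_rightTranslation_eq_sum {f : SL4 → ℂ} {F : MvPolynomial (Fin 4 × Fin 4) ℂ}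
    (hF : ∀ g : SL4, f g = MvPolynomial.eval (fun ij => g.1 ij.1 ij.2) F) :
    ∃ (s : Finset (Fin 4 × Fin 4 →₀ ℕ)) (a : (Fin 4 × Fin 4 →₀ ℕ) → SL4 → ℂ), ∀ h : SL4,
      rightTranslation h f = ∑ d ∈ s, MvPolynomial.eval (fun ij => h.1 ij.1 ij.2)
        (MvPolynomial.monomial d (1 : ℂ)) • a d := by
  -- expand `F (g * h)` as a polynomial in the entries of `h`
  let G : MvPolynomial (Fin 4 × Fin 4) (SL4 → ℂ) :=
    MvPolynomial.aeval (fun ij : Fin 4 × Fin 4 => ∑ k, MvPolynomial.C (fun g : SL4 => g.1 ij.1 k) *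
      (MvPolynomial.X (k, ij.2) : MvPolynomial (Fin 4 × Fin 4) (SL4 → ℂ))) F
  refine ⟨G.support, fun d => G.coeff d, fun h => ?_⟩
  funext g
  have h1 : ∀ F : MvPolynomial (Fin 4 × Fin 4) ℂ,
      MvPolynomial.eval₂ (Pi.evalRingHom (fun _ : SL4 => ℂ) g) (fun ij => h.1 ij.1 ij.2)
        (MvPolynomial.aeval (fun ij : Fin 4 × Fin 4 => ∑ k,
          MvPolynomial.C (fun g : SL4 => g.1 ij.1 k) *
            (MvPolynomial.X (k, ij.2) : MvPolynomial (Fin 4 × Fin 4) (SL4 → ℂ))) F) =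
      MvPolynomial.eval (fun ij => (g * h).1 ij.1 ij.2) F := by
    intro F
    induction F using MvPolynomial.induction_on with
    | C a =>
      rw [MvPolynomial.aeval_C, MvPolynomial.eval_C, MvPolynomial.algebraMap_apply,
        MvPolynomial.eval₂_C]
      rfl
    | add p q hp hq => rw [map_add, MvPolynomial.eval₂_add, hp, hq, map_add]
    | mul_X p i hp =>
      rw [map_mul, MvPolynomial.eval₂_mul, hp, MvPolynomial.aeval_X, map_mul, MvPolynomial.eval_X,
        MvPolynomial.eval₂_sum]
      simp [MvPolynomial.eval₂_mul, Matrix.mul_apply]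
  rw [rightTranslation_apply, hF, ← h1, MvPolynomial.eval₂_eq', Finset.sum_apply]
  refine Finset.sum_congr rfl fun d _ => ?_
  rw [MvPolynomial.eval_monomial, one_mul, Finsupp.prod_fintype _ _ fun _ => pow_zero _]
  rw [Pi.smul_apply, smul_eq_mul, mul_comm]
  rfl

/-- The highest weight vector of weight `l ω₁ + m ω₂ + n ω₃` in the regular functions. -/
def highestWeightFunction (l m n : ℕ) (g : SL4) : ℂ :=
  g.1 0 0 ^ l * minor₂ g.1 ^ m * minor₃ g.1 ^ n

theorem highestWeightFunction_mul (g b : SL4) (hb : ∀ i j : Fin 4, j < i → b.1 i j = 0) :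
    highestWeightFunction l m n (g * b) = ((b.1 0 0) ^ l * (b.1 0 0 * b.1 1 1) ^ m
      * (b.1 0 0 * b.1 1 1 * b.1 2 2) ^ n) * highestWeightFunction l m n g := by
  have b10 := hb 1 0 (by decide)
  have b20 := hb 2 0 (by decide)
  have b30 := hb 3 0 (by decide)
  have b21 := hb 2 1 (by decide)
  have b31 := hb 3 1 (by decide)
  have b32 := hb 3 2 (by decide)
  have hmul : ∀ i j, (g * b).1 i j = ∑ k, g.1 i k * b.1 k j := fun i j => Matrix.mul_apply
  have h1 : (g * b).1 0 0 = b.1 0 0 * g.1 0 0 := by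
    rw [hmul, Fin.sum_univ_four, b10, b20, b30]
    ring
  have h2 : minor₂ (g * b).1 = b.1 0 0 * b.1 1 1 * minor₂ g.1 := by
    simp only [minor₂, hmul, Fin.sum_univ_four, b10, b20, b30, b21, b31]
    ring
  have h3 : minor₃ (g * b).1 = b.1 0 0 * b.1 1 1 * b.1 2 2 * minor₃ g.1 := by
    simp only [minor₃, hmul, Fin.sum_univ_four, b10, b20, b30, b21, b31, b32]
    ring
  rw [highestWeightFunction, highestWeightFunction, h1, h2, h3]
  ring

theorem highestWeightFunction_one : highestWeightFunction l m n 1 = 1 := by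
  simp [highestWeightFunction, minor₂, minor₃]

theorem exists_eval_eq_highestWeightFunction (l m n : ℕ) :
    ∃ F : MvPolynomial (Fin 4 × Fin 4) ℂ, ∀ g : SL4,
      highestWeightFunction l m n g = MvPolynomial.eval (fun ij => g.1 ij.1 ij.2) F := by
  refine ⟨MvPolynomial.X (0, 0) ^ l * minor₂ (fun i j => MvPolynomial.X (i, j)) ^ m *
    minor₃ (fun i j => MvPolynomial.X (i, j)) ^ n, fun g => ?_⟩
  simp [highestWeightFunction, minor₂, minor₃]

variable (l m n) in
/-- The translates of the highest weight function span a rational representation, generated by a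
highest weight vector. -/
theorem exists_isIrreducibleCharacter : ∃ χ, IsIrreducibleCharacter l m n χ := by
  set f := highestWeightFunction l m n with hf
  obtain ⟨F, hF⟩ := exists_eval_eq_highestWeightFunction l m n
  obtain ⟨s, a, hsum⟩ := exists_rightTranslation_eq_sum hF
  let W : Subrepresentation rightTranslation :=
    ⟨Submodule.span ℂ (Set.range fun h => rightTranslation h f), fun h w hw => by
      induction hw using Submodule.span_induction with
      | mem x hx =>
        obtain ⟨k, rfl⟩ := hx
        exact Submodule.subset_span ⟨h * k, by
          change rightTranslation (h * k) f = rightTranslation h (rightTranslation k f)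
          rw [map_mul, Module.End.mul_apply]⟩
      | zero => rw [map_zero]; exact Submodule.zero_mem _
      | add x y _ _ hx hy => rw [map_add]; exact Submodule.add_mem _ hx hy
      | smul c x _ hx => rw [map_smul]; exact Submodule.smul_mem _ c hx⟩
  have hle : W.toSubmodule ≤ Submodule.span ℂ (Set.range fun d : s => a d) := by
    refine Submodule.span_le.2 ?_
    rintro _ ⟨h, rfl⟩
    change rightTranslation h f ∈ _
    rw [hsum]
    exact Submodule.sum_mem _ fun d hd =>
      Submodule.smul_mem _ _ (Submodule.subset_span ⟨⟨d, hd⟩, rfl⟩)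
  have := FiniteDimensional.span_of_finite ℂ (Set.finite_range fun d : s => a d)
  have hfin : FiniteDimensional ℂ W.toSubmodule := Submodule.finiteDimensional_of_le hle
  have hfW : f ∈ W.toSubmodule := Submodule.subset_span ⟨1, by
    change rightTranslation 1 f = f
    rw [map_one, Module.End.one_apply]⟩
  have hcoe : ∀ h w, (W.toRepresentation h w : SL4 → ℂ) = rightTranslation h w := fun h w => rfl
  refine exists_isIrreducibleCharacter_of_span_eq_top (ρ := W.toRepresentation) (v := ⟨f, hfW⟩)
    ?_ ⟨fun h => ?_, fun b hb => ?_⟩ ?_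
  · -- matrix coefficients extend to the space of all functions
    rintro φ ⟨w, hw⟩
    obtain ⟨ψ, hψ⟩ := LinearMap.exists_extend φ
    have hφ : ∀ w : W.toSubmodule, φ w = ψ w := fun w => by rw [← hψ]; rfl
    suffices h : ∀ w ∈ W.toSubmodule, ∃ P : MvPolynomial (Fin 4 × Fin 4) ℂ, ∀ g : SL4,
        ψ (rightTranslation g w) = MvPolynomial.eval (fun ij => g.1 ij.1 ij.2) P by
      obtain ⟨P, hP⟩ := h w hw
      exact ⟨P, fun g => by rw [hφ, hcoe, hP]⟩
    clear hw w
    intro w hw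
    induction hw using Submodule.span_induction with
    | mem x hx =>
      obtain ⟨k, rfl⟩ := hx
      refine ⟨∑ d ∈ s, MvPolynomial.C (ψ (a d)) * MvPolynomial.aeval (fun ij : Fin 4 × Fin 4 =>
        ∑ j, MvPolynomial.X (ij.1, j) * MvPolynomial.C (k.1 j ij.2))
          (MvPolynomial.monomial d (1 : ℂ)), fun g => ?_⟩
      change ψ (rightTranslation g (rightTranslation k f)) = _
      rw [← Module.End.mul_apply, ← map_mul, hsum, map_sum, map_sum]
      refine Finset.sum_congr rfl fun d _ => ?_
      rw [map_smul, smul_eq_mul, map_mul, MvPolynomial.eval_C, eval_aeval, mul_comm]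
      congr 3
      funext ij
      simp [Matrix.mul_apply]
    | zero => exact ⟨0, by simp⟩
    | add x y _ _ hx hy =>
      obtain ⟨P, hP⟩ := hx
      obtain ⟨Q, hQ⟩ := hy
      exact ⟨P + Q, fun g => by rw [map_add, map_add, hP, hQ, map_add]⟩
    | smul c x _ hx =>
      obtain ⟨P, hP⟩ := hx
      exact ⟨MvPolynomial.C c * P, fun g => by
        rw [map_smul, map_smul, hP, map_mul, MvPolynomial.eval_C, smul_eq_mul]⟩
  · have h1 := congrArg (fun w : W.toSubmodule => (w : SL4 → ℂ) 1) h
    exact one_ne_zero (highestWeightFunction_one.symm.trans h1)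
  · apply Subtype.ext
    funext g
    exact highestWeightFunction_mul g b hb
  · -- the orbit spans `W` by definition; transport this to the type of elements of `W`
    have himg : Submodule.map W.toSubmodule.subtype (Submodule.span ℂ (Set.range fun g =>
        W.toRepresentation g ⟨f, hfW⟩)) = W.toSubmodule := by
      rw [Submodule.map_span, ← Set.range_comp]
      rfl
    refine Submodule.map_injective_of_injective W.toSubmodule.injective_subtype ?_
    rw [himg, Submodule.map_top, Submodule.range_subtype]

theorem isIrreducibleCharacter_A (l m n : ℕ) : IsIrreducibleCharacter l m n (A l m n) :=
  Classical.epsilon_spec (exists_isIrreducibleCharacter l m n)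

theorem isIrreducibleCharacter_iff {χ : SL4 → ℂ} :
    IsIrreducibleCharacter l m n χ ↔ χ = A l m n :=
  ⟨fun h => h.unique (isIrreducibleCharacter_A l m n), fun h => h ▸ isIrreducibleCharacter_A l m n⟩

theorem isRegularClassFunction_A (l m n : ℕ) : IsRegularClassFunction (A l m n) := by
  obtain ⟨V, _, _, ρ, hρ, h⟩ := isIrreducibleCharacter_A l m n
  have := hρ.finite
  exact h ▸ hρ.rational.isRegularClassFunction_character

theorem A_mul_alternant (l m n : ℕ) (x : Fin 4 → ℂ) (hx : ∏ i, x i = 1) :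
    A l m n (diagSL x hx) * alternant (fun j => (strictWeight 0 0 0 j : ℤ)) x =
      alternant (fun j => (strictWeight l m n j : ℤ)) x := by
  obtain ⟨V, _, _, ρ, hρ, h⟩ := isIrreducibleCharacter_A l m n
  exact h ▸ character_mul_alternant hρ x hx

end Existence

/-! ### The Pieri rules -/

section Pieri

/-- The geometric series with ratio `y`. -/
def geom (y : ℂ) : PowerSeries ℂ :=
  PowerSeries.mk fun k => y ^ k

/-- The complete symmetric polynomials in the inverses of `x₁, …, x₄`. -/
def completeInv (x : Fin 4 → ℂ) (k : ℕ) : ℂ :=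
  PowerSeries.coeff k (∏ i, geom (x i)⁻¹)

theorem geom_eq (y : ℂ) : geom y = 1 + PowerSeries.X * (PowerSeries.C y * geom y) := by
  ext k
  rcases k with _ | k
  · simp [geom]
  · rw [map_add, PowerSeries.coeff_succ_X_mul, PowerSeries.coeff_C_mul, geom,
      PowerSeries.coeff_mk, PowerSeries.coeff_mk, PowerSeries.coeff_one, if_neg k.succ_ne_zero,
      pow_succ']
    ring

/-- Splitting off the first `p` terms of the series `∑ₑ x ^ (κ - e) z ^ e`. -/
theorem geom_mul_C_zpow {x : ℂ} (hx : x ≠ 0) (κ : ℤ) (p : ℕ) :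
    geom x⁻¹ * PowerSeries.C (x ^ κ) =
      ∑ e ∈ Finset.range p, PowerSeries.X ^ e * PowerSeries.C (x ^ (κ - e)) +
        PowerSeries.X ^ p * (geom x⁻¹ * PowerSeries.C (x ^ (κ - p))) := by
  induction p with
  | zero => simp
  | succ p ih =>
    rw [ih, Finset.sum_range_succ]
    conv_lhs => rw [geom_eq]
    have h : x ^ (κ - (p + 1 : ℕ)) = x⁻¹ * x ^ (κ - p) := by
      rw [show κ - ((p + 1 : ℕ) : ℤ) = (κ - p) - 1 by push_cast; ring, zpow_sub_one₀ hx, mul_comm]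
    rw [h, map_mul, pow_succ]
    ring

/-- Multiplication of an alternant by a complete symmetric polynomial: in the matrix with the
columns `∑ₑ xᵢ ^ (κⱼ - e) z ^ e`, subtracting multiples of each column from the preceding one makes
the first three columns finite sums, so that only horizontal strips contribute. -/
theorem completeInv_mul_alternant {x : Fin 4 → ℂ} (hx : ∀ i, x i ≠ 0) (κ : Fin 4 → ℤ)
    (p₀ p₁ p₂ k : ℕ) (h₀ : κ 0 - p₀ = κ 1) (h₁ : κ 1 - p₁ = κ 2) (h₂ : κ 2 - p₂ = κ 3) :
    completeInv x k * alternant κ x =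
      ∑ r ∈ Fintype.piFinset fun j => Finset.range (![p₀, p₁, p₂, k + 1] j),
        if ∑ j, r j = k then alternant (fun j => κ j - r j) x else 0 := by
  set q : Fin 4 → ℕ := ![p₀, p₁, p₂, k + 1] with hq
  let M : Matrix (Fin 4) (Fin 4) (PowerSeries ℂ) :=
    Matrix.of fun i j => geom (x i)⁻¹ * PowerSeries.C (x i ^ κ j)
  have hM : M.det = (∏ i, geom (x i)⁻¹) * PowerSeries.C (alternant κ x) := by
    rw [alternant, RingHom.map_det]
    exact Matrix.det_mul_column (fun i => geom (x i)⁻¹)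
      (Matrix.of fun i j => PowerSeries.C (x i ^ κ j))
  -- the column operations
  let T : Matrix (Fin 4) (Fin 4) (PowerSeries ℂ) :=
    !![1, 0, 0, 0; -PowerSeries.X ^ p₀, 1, 0, 0; 0, -PowerSeries.X ^ p₁, 1, 0;
      0, 0, -PowerSeries.X ^ p₂, 1]
  have hT : T.det = 1 := by
    simp [T, Matrix.det_succ_row_zero, Fin.sum_univ_succ, Fin.succAbove]
  -- the finite parts of the columns; the remainder `w` of the last one enters with `z ^ (k + 1)`,
  -- and so does not contribute to the coefficient of `z ^ k`
  let N : Matrix (Fin 4) (Fin 4) (PowerSeries ℂ) := Matrix.of fun i j =>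
    ∑ e ∈ Finset.range (q j), PowerSeries.X ^ e * PowerSeries.C (x i ^ (κ j - e))
  let w : Fin 4 → PowerSeries ℂ := fun i =>
    geom (x i)⁻¹ * PowerSeries.C (x i ^ (κ 3 - (k + 1 : ℕ)))
  have hMT : M * T = N.updateCol 3 (N.col 3 + (PowerSeries.X ^ (k + 1) : PowerSeries ℂ) • w) := by
    ext1 i j
    rw [Matrix.mul_apply, Fin.sum_univ_four]
    fin_cases j
    · have := geom_mul_C_zpow (hx i) (κ 0) p₀
      rw [h₀] at this
      simp [M, T, N, hq, this]
      ring
    · have := geom_mul_C_zpow (hx i) (κ 1) p₁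
      rw [h₁] at this
      simp [M, T, N, hq, this]
      ring
    · have := geom_mul_C_zpow (hx i) (κ 2) p₂
      rw [h₂] at this
      simp [M, T, N, hq, this]
      ring
    · have := geom_mul_C_zpow (hx i) (κ 3) (k + 1)
      simp [M, T, N, hq, w, this]
  have hN : N.det = ∑ r ∈ Fintype.piFinset fun j => Finset.range (q j),
      PowerSeries.X ^ (∑ j, r j) * PowerSeries.C (alternant (fun j => κ j - r j) x) := by
    rw [← Matrix.det_transpose]
    let det := (Matrix.detRowAlternating (R := PowerSeries ℂ) (n := Fin 4)).toMultilinearMap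
    have h := det.map_sum_finset
      (fun j (e : ℕ) i => PowerSeries.X ^ e * PowerSeries.C (x i ^ (κ j - e)))
      (fun j => Finset.range (q j))
    have hNt : Nᵀ = fun j => ∑ e ∈ Finset.range (q j), fun i =>
        (PowerSeries.X ^ e * PowerSeries.C (x i ^ (κ j - e)) : PowerSeries ℂ) := by
      ext1 j i
      rw [Finset.sum_apply]
      rfl
    rw [hNt]
    refine h.trans (Finset.sum_congr rfl fun r _ => ?_)
    rw [alternant, RingHom.map_det, ← Finset.prod_pow_eq_pow_sum, ← Matrix.det_transpose]
    exact Matrix.det_mul_column (fun j => (PowerSeries.X ^ r j : PowerSeries ℂ)) _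
  have hdet : (∏ i, geom (x i)⁻¹) * PowerSeries.C (alternant κ x) =
      N.det + PowerSeries.X ^ (k + 1) * (N.updateCol 3 w).det := by
    rw [← hM, ← mul_one M.det, ← hT, ← Matrix.det_mul, hMT, Matrix.det_updateCol_add,
      Matrix.det_updateCol_smul]
    congr 2
    exact Matrix.updateCol_eq_self N 3
  have hcoeff := congrArg (PowerSeries.coeff k) hdet
  rw [PowerSeries.coeff_mul_C, map_add, PowerSeries.coeff_X_pow_mul', if_neg (by omega), add_zero,
    hN, map_sum] at hcoeff
  refine hcoeff.trans (Finset.sum_congr rfl fun r _ => ?_)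
  rw [PowerSeries.coeff_X_pow_mul', PowerSeries.coeff_C]
  by_cases hs : ∑ j, r j = k
  · rw [if_pos hs, if_pos hs.le, if_pos (Nat.sub_eq_zero_of_le hs.ge)]
  · rw [if_neg hs]
    split_ifs with h1 h2
    · exact absurd (le_antisymm h1 (Nat.sub_eq_zero_iff_le.1 h2)) hs
    · rfl
    · rfl

/-- On the torus of `SL₄`, alternants only depend on the exponents modulo constants. -/
theorem alternant_sub_const (κ : Fin 4 → ℤ) (c : ℤ) {x : Fin 4 → ℂ} (hx : ∏ i, x i = 1) :
    alternant (fun j => κ j - c) x = alternant κ x := by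
  have h := Matrix.det_mul_column (fun i => x i ^ (-c)) (Matrix.of fun i j => x i ^ κ j)
  rw [Finset.prod_zpow, hx, one_zpow, one_mul] at h
  rw [alternant, alternant, ← h]
  congr 1
  ext i j
  rw [Matrix.of_apply, Matrix.of_apply, Matrix.of_apply, ← zpow_add₀ (prod_eq_one_ne_zero hx i)]
  congr 1
  ring

/-- The alternant attached to the weight `l ω₁ + m ω₂ + n ω₃ + ρ`. -/
def weightAlternant (l m n : ℤ) (x : Fin 4 → ℂ) : ℂ :=
  alternant ![l + m + n + 3, m + n + 2, n + 1, 0] x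

theorem alternant_strictWeight (l m n : ℕ) (x : Fin 4 → ℂ) :
    alternant (fun j => (strictWeight l m n j : ℤ)) x = weightAlternant l m n x := by
  rw [weightAlternant]
  congr 1
  funext j
  fin_cases j <;> simp [strictWeight]

/-- Inversion of the torus exchanges a weight with the dual one. -/
theorem weightAlternant_inv (l m n : ℤ) {x : Fin 4 → ℂ} (hx : ∏ i, x i = 1) :
    weightAlternant l m n (fun i => (x i)⁻¹) = weightAlternant n m l x := by
  have h := Matrix.det_permute' Fin.revPerm
    (Matrix.of fun i j => (x i)⁻¹ ^ ((![l + m + n + 3, m + n + 2, n + 1, 0] : Fin 4 → ℤ) j))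
  have hs : Equiv.Perm.sign (Fin.revPerm : Equiv.Perm (Fin 4)) = 1 := by decide
  rw [hs, Units.val_one, Int.cast_one, one_mul] at h
  rw [weightAlternant, alternant, ← h, weightAlternant,
    ← alternant_sub_const _ (l + m + n + 3) hx, alternant]
  congr 1
  ext i j
  rw [Matrix.submatrix_apply, Matrix.of_apply, Matrix.of_apply, inv_zpow', id]
  congr 1
  fin_cases j <;> simp [Fin.rev] <;> ring

/-- The horizontal strips of size `k` that can be removed from the weight `l ω₁ + m ω₂ + n ω₃`, by
the numbers of boxes removed from the first three rows. -/
def strips (l m n k : ℕ) : Finset (ℕ × ℕ × ℕ) :=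
  (Finset.range (l + 1) ×ˢ Finset.range (m + 1) ×ˢ Finset.range (n + 1)).filter
    fun e => e.1 + e.2.1 + e.2.2 ≤ k

theorem mem_strips {l m n k : ℕ} {e : ℕ × ℕ × ℕ} : e ∈ strips l m n k ↔
    e.1 ≤ l ∧ e.2.1 ≤ m ∧ e.2.2 ≤ n ∧ e.1 + e.2.1 + e.2.2 ≤ k := by
  simp only [strips, Finset.mem_filter, Finset.mem_product, Finset.mem_range, Nat.lt_succ_iff]
  tauto

/-- Pieri's rule. The `k - e₁ - e₂ - e₃` boxes removed from the fourth row change the last exponent,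
which is then normalized to zero again. -/
theorem completeInv_mul_weightAlternant {x : Fin 4 → ℂ} (hx : ∏ i, x i = 1) (l m n k : ℕ) :
    completeInv x k * weightAlternant l m n x = ∑ e ∈ strips l m n k,
      weightAlternant (l - e.1 + e.2.1) (m - e.2.1 + e.2.2)
        (n - e.2.2 + (k - e.1 - e.2.1 - e.2.2)) x := by
  have h := completeInv_mul_alternant (prod_eq_one_ne_zero hx)
    ![(l : ℤ) + m + n + 3, m + n + 2, n + 1, 0] (l + 1) (m + 1) (n + 1) k
    (by simp; ring) (by simp; ring) (by simp)
  rw [weightAlternant, h, ← Finset.sum_filter]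
  refine Finset.sum_nbij' (fun r => (r 0, r 1, r 2))
    (fun e => ![e.1, e.2.1, e.2.2, k - e.1 - e.2.1 - e.2.2]) ?_ ?_ ?_ ?_ ?_
  · intro r hr
    simp only [Finset.mem_filter, Fintype.mem_piFinset, Finset.mem_range, Fin.forall_fin_succ,
      Fin.sum_univ_four] at hr
    simp at hr
    rw [mem_strips]
    dsimp only
    omega
  · intro e he
    rw [mem_strips] at he
    simp only [Finset.mem_filter, Fintype.mem_piFinset, Finset.mem_range, Fin.forall_fin_succ,
      Fin.sum_univ_four]
    simp
    omega
  · intro r hr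
    simp only [Finset.mem_filter, Fin.sum_univ_four] at hr
    funext j
    fin_cases j <;> simp
    omega
  · intro e _
    rfl
  · intro r hr
    simp only [Finset.mem_filter, Fin.sum_univ_four] at hr
    have hk : (k : ℤ) = r 0 + r 1 + r 2 + r 3 := by exact_mod_cast hr.2.symm
    rw [weightAlternant, ← alternant_sub_const _ (-(r 3 : ℤ)) hx]
    refine congrArg (fun κ => alternant κ x) (funext fun j => ?_)
    rw [hk]
    fin_cases j <;> simp <;> ring

section Character

variable {x : Fin 4 → ℂ} (hx : ∏ i, x i = 1) (hinj : Function.Injective x)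

include hx in
theorem A_mul_weightAlternant (l m n : ℕ) :
    A l m n (diagSL x hx) * weightAlternant 0 0 0 x = weightAlternant l m n x := by
  have h := A_mul_alternant l m n x hx
  rw [alternant_strictWeight, alternant_strictWeight] at h
  exact_mod_cast h

include hx in
theorem completeInv_mul_weightAlternant_zero (k : ℕ) :
    completeInv x k * weightAlternant 0 0 0 x = weightAlternant 0 0 k x := by
  have h := completeInv_mul_weightAlternant hx 0 0 0 k
  have hs : strips 0 0 0 k = {(0, 0, 0)} := by
    ext ⟨a, b, c⟩
    rw [mem_strips, Finset.mem_singleton, Prod.mk.injEq, Prod.mk.injEq]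
    dsimp only
    omega
  rw [hs, Finset.sum_singleton] at h
  simpa using h

include hinj in
theorem weightAlternant_zero_ne_zero : weightAlternant 0 0 0 x ≠ 0 := by
  have h := alternant_strictWeight_zero_ne_zero hinj
  rw [alternant_strictWeight] at h
  exact_mod_cast h

include hinj in
theorem A_right_eq_completeInv (k : ℕ) : A 0 0 k (diagSL x hx) = completeInv x k := by
  refine mul_right_cancel₀ (weightAlternant_zero_ne_zero hinj) ?_
  rw [A_mul_weightAlternant, completeInv_mul_weightAlternant_zero hx]
  rfl

include hinj in
theorem A_left_eq_completeInv_inv (k : ℕ) :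
    A k 0 0 (diagSL x hx) = completeInv (fun i => (x i)⁻¹) k := by
  have hx' : ∏ i, (x i)⁻¹ = 1 := by rw [Finset.prod_inv_distrib, hx, inv_one]
  have h := completeInv_mul_weightAlternant_zero hx' k
  rw [weightAlternant_inv _ _ _ hx, weightAlternant_inv _ _ _ hx] at h
  refine mul_right_cancel₀ (weightAlternant_zero_ne_zero hinj) ?_
  rw [A_mul_weightAlternant, h]
  rfl

include hinj in
/-- Pieri's rule for the symmetric powers of the dual of the standard representation. -/
theorem A_right_mul_weightAlternant (l m n k : ℕ) :
    A 0 0 k (diagSL x hx) * weightAlternant l m n x = ∑ e ∈ strips l m n k,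
      weightAlternant (l - e.1 + e.2.1) (m - e.2.1 + e.2.2)
        (n - e.2.2 + (k - e.1 - e.2.1 - e.2.2)) x := by
  rw [A_right_eq_completeInv hx hinj, completeInv_mul_weightAlternant hx]

include hinj in
/-- Pieri's rule for the product of a symmetric power of the standard representation with an
irreducible representation of highest weight `u ω₂`. -/
theorem A_left_mul_weightAlternant_middle (t u : ℕ) :
    A t 0 0 (diagSL x hx) * weightAlternant 0 u 0 x =
      ∑ q ∈ Finset.range (min t u + 1), weightAlternant (t - q) (u - q) q x := by
  have hx' : ∏ i, (x i)⁻¹ = 1 := by rw [Finset.prod_inv_distrib, hx, inv_one]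
  have h := completeInv_mul_weightAlternant hx' 0 u 0 t
  simp only [weightAlternant_inv _ _ _ hx, Nat.cast_zero] at h
  rw [A_left_eq_completeInv_inv hx hinj, h]
  refine Finset.sum_nbij' (fun e => e.2.1) (fun q => (0, q, 0)) ?_ ?_ ?_ ?_ ?_
  · rintro ⟨a, b, c⟩ he
    rw [mem_strips] at he
    rw [Finset.mem_range]
    dsimp only at he ⊢
    omega
  · intro q hq
    rw [Finset.mem_range] at hq
    rw [mem_strips]
    dsimp only
    omega
  · rintro ⟨a, b, c⟩ he
    rw [mem_strips] at he
    dsimp only at he ⊢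
    rw [Prod.mk.injEq, Prod.mk.injEq]
    omega
  · intro q _
    rfl
  · rintro ⟨a, b, c⟩ he
    rw [mem_strips] at he
    dsimp only at he ⊢
    obtain rfl : a = 0 := by omega
    obtain rfl : c = 0 := by omega
    congr 1 <;> simp

include hinj in
/-- The product of a symmetric power of the standard representation with one of its dual. -/
theorem A_left_mul_A_right_mul_weightAlternant_zero (t v : ℕ) :
    A t 0 0 (diagSL x hx) * A 0 0 v (diagSL x hx) * weightAlternant 0 0 0 x =
      ∑ e ∈ Finset.range (min t v + 1), weightAlternant (t - e) 0 (v - e) x := by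
  have h := A_right_mul_weightAlternant hx hinj t 0 0 v
  have h2 := A_mul_weightAlternant hx t 0 0
  rw [mul_right_comm, h2, mul_comm, h]
  refine Finset.sum_nbij' (fun e => e.1) (fun q => (q, 0, 0)) ?_ ?_ ?_ ?_ ?_
  · rintro ⟨a, b, c⟩ he
    rw [mem_strips] at he
    rw [Finset.mem_range]
    dsimp only at he ⊢
    omega
  · intro q hq
    rw [Finset.mem_range] at hq
    rw [mem_strips]
    dsimp only
    omega
  · rintro ⟨a, b, c⟩ he
    rw [mem_strips] at he
    dsimp only at he ⊢
    rw [Prod.mk.injEq, Prod.mk.injEq]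
    omega
  · intro q _
    rfl
  · rintro ⟨a, b, c⟩ he
    rw [mem_strips] at he
    dsimp only at he ⊢
    obtain rfl : b = 0 := by omega
    obtain rfl : c = 0 := by omega
    congr 1 <;> simp

include hinj in
/-- The Cartan component of the product of symmetric powers, by telescoping the sum of
`A_left_mul_A_right_mul_weightAlternant_zero`. -/
theorem A_succ_zero_succ (t v : ℕ) :
    A (t + 1) 0 (v + 1) (diagSL x hx) =
      A (t + 1) 0 0 (diagSL x hx) * A 0 0 (v + 1) (diagSL x hx) -
        A t 0 0 (diagSL x hx) * A 0 0 v (diagSL x hx) := by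
  refine mul_right_cancel₀ (weightAlternant_zero_ne_zero hinj) ?_
  rw [sub_mul, A_left_mul_A_right_mul_weightAlternant_zero hx hinj,
    A_left_mul_A_right_mul_weightAlternant_zero hx hinj,
    A_mul_weightAlternant hx, Nat.add_min_add_right, Finset.sum_range_succ']
  simp

include hinj in
theorem A_zero_eq_mul_of_eq_zero (t v : ℕ) (h : t = 0 ∨ v = 0) :
    A t 0 v (diagSL x hx) = A t 0 0 (diagSL x hx) * A 0 0 v (diagSL x hx) := by
  refine mul_right_cancel₀ (weightAlternant_zero_ne_zero hinj) ?_
  have h0 : min t v = 0 := by omega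
  rw [A_left_mul_A_right_mul_weightAlternant_zero hx hinj, A_mul_weightAlternant hx, h0]
  simp

end Character

end Pieri

/-! ### The product of `A[t,0,v]` and `A[0,u,0]` -/

section Product

variable {x : Fin 4 → ℂ} (hx : ∏ i, x i = 1) (hinj : Function.Injective x)

/-- The index set of the terms of `A[t,0,0] A[0,0,v] A[0,u,0]`: quadruples `(q, e)` such that the
strip `e` of size at most `v` can be removed from the weight `(t - q) ω₁ + (u - q) ω₂ + q ω₃`. -/
def pairStrips (t u v : ℕ) : Finset (ℕ × ℕ × ℕ × ℕ) :=
  (Finset.range (u + 1) ×ˢ Finset.range (t + 1) ×ˢ Finset.range (u + 1) ×ˢ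
    Finset.range (u + 1)).filter fun p => p.1 + p.2.1 ≤ t ∧ p.1 + p.2.2.1 ≤ u ∧ p.2.2.2 ≤ p.1 ∧
      p.2.1 + p.2.2.1 + p.2.2.2 ≤ v

theorem mem_pairStrips {t u v : ℕ} {p : ℕ × ℕ × ℕ × ℕ} : p ∈ pairStrips t u v ↔
    p.1 + p.2.1 ≤ t ∧ p.1 + p.2.2.1 ≤ u ∧ p.2.2.2 ≤ p.1 ∧ p.2.1 + p.2.2.1 + p.2.2.2 ≤ v := by
  simp only [pairStrips, Finset.mem_filter, Finset.mem_product, Finset.mem_range]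
  omega

/-- The term of `A[t,0,0] A[0,0,v] A[0,u,0]` with index `p`. -/
def pairTerm (t u v : ℤ) (x : Fin 4 → ℂ) (p : ℕ × ℕ × ℕ × ℕ) : ℂ :=
  weightAlternant (t - p.1 - p.2.1 + p.2.2.1) (u - p.1 - p.2.2.1 + p.2.2.2)
    (p.1 - p.2.2.2 + (v - p.2.1 - p.2.2.1 - p.2.2.2)) x

include hinj in
theorem A_left_mul_A_right_mul_weightAlternant_middle (t u v : ℕ) :
    A t 0 0 (diagSL x hx) * A 0 0 v (diagSL x hx) * weightAlternant 0 u 0 x =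
      ∑ p ∈ pairStrips t u v, pairTerm t u v x p := by
  have h : ∀ q ∈ Finset.range (min t u + 1), A 0 0 v (diagSL x hx) *
      weightAlternant (t - q) (u - q) q x = ∑ e ∈ strips (t - q) (u - q) q v,
        pairTerm t u v x (q, e) := by
    intro q hq
    rw [Finset.mem_range] at hq
    have h := A_right_mul_weightAlternant hx hinj (t - q) (u - q) q v
    rwa [Nat.cast_sub (by omega), Nat.cast_sub (by omega)] at h
  rw [mul_right_comm, A_left_mul_weightAlternant_middle hx hinj, mul_comm, Finset.mul_sum,
    Finset.sum_congr rfl h, Finset.sum_sigma']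
  refine Finset.sum_nbij' (fun p => (p.1, p.2)) (fun p => ⟨p.1, p.2⟩) ?_ ?_ ?_ ?_ ?_
  · rintro ⟨q, e⟩ hp
    rw [Finset.mem_sigma, Finset.mem_range, mem_strips] at hp
    rw [mem_pairStrips]
    dsimp only at hp ⊢
    omega
  · rintro ⟨q, e⟩ hp
    rw [mem_pairStrips] at hp
    rw [Finset.mem_sigma, Finset.mem_range, mem_strips]
    dsimp only at hp ⊢
    omega
  · intro p _
    rfl
  · intro p _
    rfl
  · intro p _
    rfl

/-- The index set of the constituents of `A[t,0,v] A[0,u,0]`. -/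
def productIndices (t u v : ℕ) : Finset (ℕ × ℕ × ℕ) :=
  (Finset.range (u + 1) ×ˢ Finset.range (u + 1) ×ˢ Finset.range (u + 1)).filter fun p =>
    p.1 + p.2.2 ≤ t ∧ p.1 + p.2.1 + p.2.2 ≤ u ∧ p.1 + p.2.1 ≤ v

theorem mem_productIndices {t u v : ℕ} {p : ℕ × ℕ × ℕ} : p ∈ productIndices t u v ↔
    p.1 + p.2.2 ≤ t ∧ p.1 + p.2.1 + p.2.2 ≤ u ∧ p.1 + p.2.1 ≤ v := by
  simp only [productIndices, Finset.mem_filter, Finset.mem_product, Finset.mem_range]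
  omega

/-- The strips without boxes in the first row, reparametrized by `(e₃, e₂, q - e₃)`. -/
theorem sum_pairStrips_filter_zero (t u v : ℕ) :
    ∑ p ∈ (pairStrips t u v).filter (fun p => p.2.1 = 0), pairTerm t u v x p =
      ∑ p ∈ productIndices t u v, weightAlternant ((t + p.2.1 - (p.1 + p.2.2) : ℕ))
        ((u - (p.2.1 + p.2.2) : ℕ)) ((v + p.2.2 - (p.1 + p.2.1) : ℕ)) x := by
  refine Finset.sum_nbij' (fun p => (p.2.2.2, p.2.2.1, p.1 - p.2.2.2))
    (fun p => (p.1 + p.2.2, 0, p.2.1, p.1)) ?_ ?_ ?_ ?_ ?_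
  · rintro ⟨q, a, b, c⟩ hp
    rw [Finset.mem_filter, mem_pairStrips] at hp
    rw [mem_productIndices]
    dsimp only at hp ⊢
    omega
  · rintro ⟨a, b, c⟩ hp
    rw [mem_productIndices] at hp
    rw [Finset.mem_filter, mem_pairStrips]
    dsimp only at hp ⊢
    omega
  · rintro ⟨q, a, b, c⟩ hp
    rw [Finset.mem_filter, mem_pairStrips] at hp
    dsimp only at hp ⊢
    rw [Prod.mk.injEq, Prod.mk.injEq, Prod.mk.injEq]
    omega
  · rintro ⟨a, b, c⟩ _
    dsimp only
    rw [Nat.add_sub_cancel_left]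
  · rintro ⟨q, a, b, c⟩ hp
    rw [Finset.mem_filter, mem_pairStrips] at hp
    dsimp only at hp
    rw [pairTerm]
    congr 1 <;> dsimp only <;> omega

/-- The strips with a box in the first row are those for `(t - 1, u, v - 1)` with one more such box;
they cancel in `A[t,0,v] = A[t,0,0] A[0,0,v] - A[t-1,0,0] A[0,0,v-1]`. -/
theorem sum_pairStrips_filter_pos (t u v : ℕ) :
    ∑ p ∈ (pairStrips (t + 1) u (v + 1)).filter (fun p => ¬ p.2.1 = 0),
      pairTerm (t + 1 : ℕ) u (v + 1 : ℕ) x p = ∑ p ∈ pairStrips t u v, pairTerm t u v x p := by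
  refine Finset.sum_nbij' (fun p => (p.1, p.2.1 - 1, p.2.2)) (fun p => (p.1, p.2.1 + 1, p.2.2))
    ?_ ?_ ?_ ?_ ?_
  · rintro ⟨q, a, b, c⟩ hp
    rw [Finset.mem_filter, mem_pairStrips] at hp
    rw [mem_pairStrips]
    dsimp only at hp ⊢
    omega
  · rintro ⟨q, a, b, c⟩ hp
    rw [mem_pairStrips] at hp
    rw [Finset.mem_filter, mem_pairStrips]
    dsimp only at hp ⊢
    omega
  · rintro ⟨q, a, b, c⟩ hp
    rw [Finset.mem_filter] at hp
    dsimp only at hp ⊢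
    rw [Nat.sub_add_cancel (Nat.pos_of_ne_zero hp.2)]
  · rintro ⟨q, a, b, c⟩ _
    rfl
  · rintro ⟨q, a, b, c⟩ hp
    rw [Finset.mem_filter, mem_pairStrips] at hp
    dsimp only at hp
    rw [pairTerm, pairTerm]
    congr 1 <;> dsimp only <;> omega

include hinj in
theorem A_mul_weightAlternant_middle_eq_sum (t u v : ℕ) :
    A t 0 v (diagSL x hx) * weightAlternant 0 u 0 x =
      ∑ p ∈ productIndices t u v, weightAlternant ((t + p.2.1 - (p.1 + p.2.2) : ℕ))
        ((u - (p.2.1 + p.2.2) : ℕ)) ((v + p.2.2 - (p.1 + p.2.1) : ℕ)) x := by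
  rw [← sum_pairStrips_filter_zero]
  by_cases h : t = 0 ∨ v = 0
  · rw [A_zero_eq_mul_of_eq_zero hx hinj t v h,
      A_left_mul_A_right_mul_weightAlternant_middle hx hinj,
      Finset.filter_true_of_mem]
    intro p hp
    rw [mem_pairStrips] at hp
    omega
  · push Not at h
    obtain ⟨t, rfl⟩ := Nat.exists_eq_succ_of_ne_zero h.1
    obtain ⟨v, rfl⟩ := Nat.exists_eq_succ_of_ne_zero h.2
    rw [Nat.succ_eq_add_one, Nat.succ_eq_add_one, A_succ_zero_succ hx hinj, sub_mul,
      A_left_mul_A_right_mul_weightAlternant_middle hx hinj,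
      A_left_mul_A_right_mul_weightAlternant_middle hx hinj,
      ← Finset.sum_filter_add_sum_filter_not (pairStrips (t + 1) u (v + 1)) (fun p => p.2.1 = 0),
      sum_pairStrips_filter_pos, add_sub_cancel_right]

/-- The decomposition of `A[t,0,v] A[0,u,0]` into irreducible characters. None of the subtractions
truncates. -/
theorem A_mul_A_eq_sum (t u v : ℕ) :
    A t 0 v * A 0 u 0 = ∑ p ∈ productIndices t u v,
      A (t + p.2.1 - (p.1 + p.2.2)) (u - (p.2.1 + p.2.2)) (v + p.2.2 - (p.1 + p.2.1)) := by
  refine ((isRegularClassFunction_A t 0 v).mul (isRegularClassFunction_A 0 u 0)).ext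
    (IsRegularClassFunction.sum _ fun p _ => isRegularClassFunction_A _ _ _) fun x hx hinj => ?_
  refine mul_right_cancel₀ (weightAlternant_zero_ne_zero hinj) ?_
  have h := A_mul_weightAlternant hx 0 u 0
  rw [Nat.cast_zero] at h
  rw [Pi.mul_apply, mul_assoc, h, A_mul_weightAlternant_middle_eq_sum hx hinj,
    Finset.sum_apply, Finset.sum_mul]
  exact Finset.sum_congr rfl fun p _ => (A_mul_weightAlternant hx _ _ _).symm

end Product

/-! ### The identity of formal power series -/

section Series

theorem coeff_formalSum {ι : Type*} (f : ι → PS) (d : Fin 3 →₀ ℕ) :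
    MvPowerSeries.coeff d (formalSum f) = ∑ᶠ i, MvPowerSeries.coeff d (f i) := rfl

theorem coeff_const_mul_monomial (c : ℂ) (i j k : ℕ) (d : Fin 3 →₀ ℕ) :
    MvPowerSeries.coeff d (const c * (X ^ i * Y ^ j * Z ^ k)) =
      if d 0 = i ∧ d 1 = j ∧ d 2 = k then c else 0 := by
  rw [const, X, Y, Z, MvPowerSeries.coeff_C_mul, MvPowerSeries.X_pow_eq, MvPowerSeries.X_pow_eq,
    MvPowerSeries.X_pow_eq, MvPowerSeries.monomial_mul_monomial,
    MvPowerSeries.monomial_mul_monomial, MvPowerSeries.coeff_monomial]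
  have h : d = Finsupp.single 0 i + Finsupp.single 1 j + Finsupp.single 2 k ↔
      d 0 = i ∧ d 1 = j ∧ d 2 = k := by
    rw [Finsupp.ext_iff]
    simp [Fin.forall_fin_succ]
  simp only [h]
  split_ifs <;> simp

theorem coeff_monomial_series (i j k : ℕ) (d : Fin 3 →₀ ℕ) :
    MvPowerSeries.coeff d (X ^ i * Y ^ j * Z ^ k) =
      if d 0 = i ∧ d 1 = j ∧ d 2 = k then 1 else 0 := by
  have h := coeff_const_mul_monomial 1 i j k d
  rwa [const, map_one, one_mul] at h

theorem exactDiv_pow_sub_pow {a b : PS} (h : a - b ≠ 0) (k : ℕ) :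
    exactDiv (a ^ (k + 1) - b ^ (k + 1)) (a - b) =
      ∑ i ∈ Finset.range (k + 1), b ^ i * a ^ (k - i) := by
  refine exactDiv_eq h ?_
  have h1 := (Commute.all b a).geom_sum₂_mul (k + 1)
  rw [Nat.add_sub_cancel] at h1
  linear_combination -h1

theorem one_sub_X_mul_Z_ne_zero : (1 - X * Z : PS) ≠ 0 := by
  intro h
  have h1 := congrArg (MvPowerSeries.coeff 0) h
  have h2 := coeff_monomial_series 1 0 1 0
  have h3 := coeff_monomial_series 0 0 0 0
  simp only [pow_one, pow_zero, mul_one] at h2 h3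
  rw [map_sub, h2, h3] at h1
  simp at h1

theorem X_sub_Y_mul_Z_ne_zero : (X - Y * Z : PS) ≠ 0 := by
  intro h
  have h1 := congrArg (MvPowerSeries.coeff (Finsupp.single 0 1)) h
  have h2 := coeff_monomial_series 0 1 1 (Finsupp.single 0 1)
  have h3 := coeff_monomial_series 1 0 0 (Finsupp.single 0 1)
  simp only [pow_one, pow_zero, mul_one, one_mul] at h2 h3
  rw [map_sub, h2, h3] at h1
  simp at h1

theorem Z_sub_X_mul_Y_ne_zero : (Z - X * Y : PS) ≠ 0 := by
  intro h
  have h1 := congrArg (MvPowerSeries.coeff (Finsupp.single 2 1)) h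
  have h2 := coeff_monomial_series 1 1 0 (Finsupp.single 2 1)
  have h3 := coeff_monomial_series 0 0 1 (Finsupp.single 2 1)
  simp only [pow_one, pow_zero, mul_one, one_mul] at h2 h3
  rw [map_sub, h2, h3] at h1
  simp at h1

/-- The index set of the monomials of a term of the left-hand side: one exponent for each of the
three geometric sums. -/
def geomIndices (l m n : ℕ) : Finset (ℕ × ℕ × ℕ) :=
  Finset.range (m + 1) ×ˢ Finset.range (l + 1) ×ˢ Finset.range (n + 1)

theorem lhsTerm_eq (g : SL4) (l m n : ℕ) :
    lhsTerm g (l, m, n) = ∑ q ∈ geomIndices l m n, const (A l m n g) *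
      (X ^ (q.1 + (l - q.2.1) + q.2.2) * Y ^ (m + q.2.1 + q.2.2) *
        Z ^ (q.1 + q.2.1 + (n - q.2.2))) := by
  have h1 := exactDiv_pow_sub_pow one_sub_X_mul_Z_ne_zero m
  rw [one_pow] at h1
  simp only [lhsTerm]
  rw [h1, exactDiv_pow_sub_pow X_sub_Y_mul_Z_ne_zero, exactDiv_pow_sub_pow Z_sub_X_mul_Y_ne_zero,
    mul_assoc, mul_assoc, Finset.sum_mul_sum, ← Finset.sum_product', Finset.sum_mul_sum,
    ← Finset.sum_product', Finset.mul_sum, geomIndices]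
  refine Finset.sum_congr rfl fun q _ => ?_
  simp only [mul_pow, one_pow, pow_add]
  ring

theorem coeff_lhsTerm (g : SL4) (p : ℕ × ℕ × ℕ) (d : Fin 3 →₀ ℕ) :
    MvPowerSeries.coeff d (lhsTerm g p) = ∑ _q ∈ (geomIndices p.1 p.2.1 p.2.2).filter
      (fun q => d 0 = q.1 + (p.1 - q.2.1) + q.2.2 ∧ d 1 = p.2.1 + q.2.1 + q.2.2 ∧
        d 2 = q.1 + q.2.1 + (p.2.2 - q.2.2)), A p.1 p.2.1 p.2.2 g := by
  obtain ⟨l, m, n⟩ := p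
  rw [lhsTerm_eq, map_sum, Finset.sum_filter]
  exact Finset.sum_congr rfl fun q _ => coeff_const_mul_monomial _ _ _ _ _

/-- A box containing the indices of the terms in which a monomial occurs. -/
def termBox (d : Fin 3 →₀ ℕ) : Finset (ℕ × ℕ × ℕ) :=
  Finset.range (d 0 + d 1 + 1) ×ˢ Finset.range (d 1 + 1) ×ˢ Finset.range (d 1 + d 2 + 1)

theorem support_coeff_lhsTerm_subset (g : SL4) (d : Fin 3 →₀ ℕ) :
    (Function.support fun p => MvPowerSeries.coeff d (lhsTerm g p)) ⊆ termBox d := by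
  intro p hp
  rw [Function.mem_support, coeff_lhsTerm] at hp
  obtain ⟨q, hq, -⟩ := Finset.exists_ne_zero_of_sum_ne_zero hp
  simp only [geomIndices, Finset.mem_filter, Finset.mem_product, Finset.mem_range] at hq
  simp only [termBox, Finset.coe_product, Finset.coe_range, Set.mem_prod, Set.mem_Iio]
  omega

theorem formallySummable_lhsTerm (g : SL4) : FormallySummable (lhsTerm g) := fun d =>
  (termBox d).finite_toSet.subset (support_coeff_lhsTerm_subset g d)

/-- The coefficient of `Xᵗ Yᵘ Zᵛ` on the left-hand side is the decomposition of `A[t,0,v] A[0,u,0]`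
into irreducible characters: a monomial of the geometric sums determines the term it comes from. -/
theorem coeff_formalSum_lhsTerm (g : SL4) (d : Fin 3 →₀ ℕ) :
    MvPowerSeries.coeff d (formalSum (lhsTerm g)) = A (d 0) 0 (d 2) g * A 0 (d 1) 0 g := by
  have h := congrFun (A_mul_A_eq_sum (d 0) (d 1) (d 2)) g
  rw [Pi.mul_apply, Finset.sum_apply] at h
  rw [coeff_formalSum, finsum_eq_sum_of_support_subset _ (support_coeff_lhsTerm_subset g d), h]
  simp only [coeff_lhsTerm]
  rw [Finset.sum_sigma']
  refine Finset.sum_nbij' (fun s => s.2)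
    (fun q =>
      ⟨(d 0 + q.2.1 - (q.1 + q.2.2), d 1 - (q.2.1 + q.2.2), d 2 + q.2.2 - (q.1 + q.2.1)), q⟩)
    ?_ ?_ ?_ ?_ ?_
  · rintro ⟨⟨l, m, n⟩, a, b, c⟩ hs
    simp only [termBox, geomIndices, Finset.mem_sigma, Finset.mem_filter, Finset.mem_product,
      Finset.mem_range] at hs
    rw [mem_productIndices]
    dsimp only
    omega
  · rintro ⟨a, b, c⟩ hq
    rw [mem_productIndices] at hq
    simp only [termBox, geomIndices, Finset.mem_sigma, Finset.mem_filter, Finset.mem_product,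
      Finset.mem_range]
    dsimp only at hq
    omega
  · rintro ⟨⟨l, m, n⟩, a, b, c⟩ hs
    simp only [geomIndices, Finset.mem_sigma, Finset.mem_filter, Finset.mem_product,
      Finset.mem_range] at hs
    dsimp only
    congr 2
    · omega
    · congr 1 <;> omega
  · intro q _
    rfl
  · rintro ⟨⟨l, m, n⟩, a, b, c⟩ hs
    simp only [geomIndices, Finset.mem_sigma, Finset.mem_filter, Finset.mem_product,
      Finset.mem_range] at hs
    dsimp only
    congr 1 <;> omega

theorem coeff_rhsTerm₁ (g : SL4) (p : ℕ × ℕ) (d : Fin 3 →₀ ℕ) :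
    MvPowerSeries.coeff d (rhsTerm₁ g p) =
      if d 0 = p.1 ∧ d 1 = 0 ∧ d 2 = p.2 then A p.1 0 p.2 g else 0 := by
  rw [← coeff_const_mul_monomial, rhsTerm₁, pow_zero, mul_one, mul_assoc]

theorem coeff_rhsTerm₂ (g : SL4) (u : ℕ) (d : Fin 3 →₀ ℕ) :
    MvPowerSeries.coeff d (rhsTerm₂ g u) =
      if d 0 = 0 ∧ d 1 = u ∧ d 2 = 0 then A 0 u 0 g else 0 := by
  rw [← coeff_const_mul_monomial, rhsTerm₂, pow_zero, pow_zero, mul_one, one_mul]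

theorem formallySummable_rhsTerm₁ (g : SL4) : FormallySummable (rhsTerm₁ g) := fun d =>
  (Set.finite_singleton (d 0, d 2)).subset fun p hp => by
    rw [Set.mem_ofPred_eq, coeff_rhsTerm₁] at hp
    by_contra hne
    refine hp (if_neg fun h => hne ?_)
    rw [Set.mem_singleton_iff, h.1, h.2.2]

theorem formallySummable_rhsTerm₂ (g : SL4) : FormallySummable (rhsTerm₂ g) := fun d =>
  (Set.finite_singleton (d 1)).subset fun u hu => by
    rw [Set.mem_ofPred_eq, coeff_rhsTerm₂] at hu
    by_contra hne
    exact hu (if_neg fun h => hne h.2.1.symm)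

theorem coeff_formalSum_rhsTerm₁ (g : SL4) (d : Fin 3 →₀ ℕ) :
    MvPowerSeries.coeff d (formalSum (rhsTerm₁ g)) = if d 1 = 0 then A (d 0) 0 (d 2) g else 0 := by
  rw [coeff_formalSum, finsum_eq_single _ (d 0, d 2)]
  · rw [coeff_rhsTerm₁]
    simp
  · intro p hp
    rw [coeff_rhsTerm₁, if_neg]
    exact fun h => hp (Prod.ext h.1.symm h.2.2.symm)

theorem coeff_formalSum_rhsTerm₂ (g : SL4) (d : Fin 3 →₀ ℕ) :
    MvPowerSeries.coeff d (formalSum (rhsTerm₂ g)) =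
      if d 0 = 0 ∧ d 2 = 0 then A 0 (d 1) 0 g else 0 := by
  rw [coeff_formalSum, finsum_eq_single _ (d 1)]
  · rw [coeff_rhsTerm₂]
    simp
  · intro u hu
    rw [coeff_rhsTerm₂, if_neg]
    exact fun h => hu h.2.1.symm

theorem coeff_formalSum_mul_formalSum (g : SL4) (d : Fin 3 →₀ ℕ) :
    MvPowerSeries.coeff d (formalSum (rhsTerm₁ g) * formalSum (rhsTerm₂ g)) =
      A (d 0) 0 (d 2) g * A 0 (d 1) 0 g := by
  rw [MvPowerSeries.coeff_mul, Finset.sum_eq_single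
    (Finsupp.single 0 (d 0) + Finsupp.single 2 (d 2), Finsupp.single 1 (d 1))]
  · rw [coeff_formalSum_rhsTerm₁, coeff_formalSum_rhsTerm₂]
    simp
  · rintro ⟨e, f⟩ hef hne
    rw [Finset.HasAntidiagonal.mem_antidiagonal] at hef
    rw [coeff_formalSum_rhsTerm₁, coeff_formalSum_rhsTerm₂]
    by_contra h
    rw [← ne_eq, mul_ne_zero_iff] at h
    simp only [ne_eq, ite_eq_right_iff, Classical.not_imp] at h
    obtain ⟨⟨h1, -⟩, ⟨h0, h2⟩, -⟩ := h
    dsimp only at hef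
    refine hne (Prod.ext ?_ ?_) <;> ext j <;> subst hef <;> fin_cases j <;> simp_all
  · intro h
    refine absurd (Finset.HasAntidiagonal.mem_antidiagonal.2 ?_) h
    ext j
    fin_cases j <;> simp

end Series

end SL4Char

end

theorem mainTheorem4 :
    -- `A l m n` is the one and only character of an irreducible representation of `SL₄`
    -- of highest weight `l ω₁ + m ω₂ + n ω₃`
    (∀ (l m n : ℕ) (χ : SL4Char.SL4 → ℂ),
      SL4Char.IsIrreducibleCharacter l m n χ ↔ χ = SL4Char.A l m n) ∧
    -- the identity of power series
    (∀ g : SL4Char.SL4,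
      SL4Char.FormallySummable (SL4Char.lhsTerm g) ∧
      SL4Char.FormallySummable (SL4Char.rhsTerm₁ g) ∧
      SL4Char.FormallySummable (SL4Char.rhsTerm₂ g) ∧
      SL4Char.formalSum (SL4Char.lhsTerm g) =
        SL4Char.formalSum (SL4Char.rhsTerm₁ g) * SL4Char.formalSum (SL4Char.rhsTerm₂ g)) := by
  refine ⟨fun l m n χ => SL4Char.isIrreducibleCharacter_iff, fun g =>
    ⟨SL4Char.formallySummable_lhsTerm g, SL4Char.formallySummable_rhsTerm₁ g,
      SL4Char.formallySummable_rhsTerm₂ g, ?_⟩⟩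
  ext d
  rw [SL4Char.coeff_formalSum_lhsTerm, SL4Char.coeff_formalSum_mul_formalSum]
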